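/- Let $k$ be an algebraically closed field of characteristic $p>0$ and let $\mathcal C$ be a finite category (its class of morphisms is a finite set). Let $k\mathcal C$ be its category algebra, i.e. the $k$-vector space with basis the morphisms of $\mathcal C$, in which the product $g\cdot f$ of two morphisms is the composite $g\circ f$ if it is defined and $0$ otherwise. Identify functors from $\mathcal C$ to $k$-vector spaces with left $k\mathcal C$-modules via $F\mapsto\bigoplus_{x}F(x)$, let $\underline k$ be the constant functor with value $k$ (all morphisms acting as the identity), and put $\mathrm H^n(\mathcal C,\underline k)=\mathrm{Ext}^n_{k\mathcal C}(\underline k,\underline k)$. Let $G$ be a finite group with $p\mid |G|$, and let $\mathbf G$ be $G$ viewed as a category with one object. For a covariant functor $\pi:\mathcal C\to\mathbf G$, let $\mathrm{res}_\pi^n:\mathrm H^n(\mathbf G,\underline k)\to\mathrm H^n(\mathcal C,\underline k)$ be the map induced by the exact functor "precomposition with $\pi$". Suppose that $k\mathcal C$ is a Frobenius $k$-algebra (it is finite-dimensional and isomorphic to $\mathrm{Hom}_k(k\mathcal C,k)$ as a left $k\mathcal C$-module), and that there is a covariant functor $\pi:\mathcal C\to\mathbf G$ such that $\mathrm{res}_\pi^n$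 is injective for every $n\ge 0$. Then $k\mathcal C$ has Happel's property, i.e. if its Hochschild cohomological dimension $\mathrm{hch.dim}(k\mathcal C)=\sup\{n\in\mathbb N\mid \mathrm{HH}^n(k\mathcal C)\neq 0\}$ is finite, then so is its global dimension. More precisely, $\mathrm{hch.dim}(k\mathcal C)=\infty$ and $\mathrm{gldim}(k\mathcal C)=\infty$. Here $\mathrm{HH}^n(A)=\mathrm{Ext}^n_{A\otimes_k A^{\mathrm{op}}}(A,A)$. -/

import Mathlib

open CategoryTheory CategoryTheory.Limits
open scoped TensorProduct

universe u

noncomputable section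

/-! ### The category algebra -/

/-- The category algebra `k C` of a category `C`: the free `k`-module on the set of all morphisms
of `C`, multiplication being given by composition of morphisms (zero if not composable). -/
def CategoryAlgebra (k : Type u) [Field k] (C : Type) [SmallCategory C] : Type u :=
  (Σ (X Y : C), X ⟶ Y) →₀ k

namespace CategoryAlgebra

variable (k : Type u) [Field k] {C : Type} [SmallCategory C]

instance : AddCommGroup (CategoryAlgebra k C) :=
  inferInstanceAs (AddCommGroup ((Σ (X Y : C), X ⟶ Y) →₀ k))

instance : Module k (CategoryAlgebra k C) :=
  inferInstanceAs (Module k ((Σ (X Y : C), X ⟶ Y) →₀ k))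

/-- The basis element of the category algebra given by a morphism. -/
def of {X Y : C} (f : X ⟶ Y) : CategoryAlgebra k C :=
  Finsupp.single (⟨X, Y, f⟩ : Σ (X Y : C), X ⟶ Y) (1 : k)

/-- Linear maps out of the category algebra are freely determined on morphisms. -/
def lift {V : Type*} [AddCommGroup V] [Module k V] (φ : ∀ (X Y : C), (X ⟶ Y) → V) :
    CategoryAlgebra k C →ₗ[k] V :=
  Finsupp.lsum k (fun a : (Σ (X Y : C), X ⟶ Y) =>
    (LinearMap.id : k →ₗ[k] k).smulRight (φ a.1 a.2.1 a.2.2))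

variable {k}

@[simp] theorem lift_of {V : Type*} [AddCommGroup V] [Module k V]
    (φ : ∀ (X Y : C), (X ⟶ Y) → V) {X Y : C} (f : X ⟶ Y) :
    lift k φ (of k f) = φ X Y f := by
  unfold lift of
  erw [Finsupp.lsum_single]
  simp

theorem hom_ext {V : Type*} [AddCommGroup V] [Module k V] {φ ψ : CategoryAlgebra k C →ₗ[k] V}
    (h : ∀ (X Y : C) (f : X ⟶ Y), φ (of k f) = ψ (of k f)) : φ = ψ := by
  apply Finsupp.lhom_ext'
  rintro ⟨X, Y, f⟩
  ext
  exact h X Y f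

open scoped Classical in
/-- The product `g * f` of two morphisms: the composite of `f` followed by `g` if the target of `f`
is the source of `g`, and zero otherwise. -/
def mulHom {X Y Z W : C} (g : Z ⟶ W) (f : X ⟶ Y) : CategoryAlgebra k C :=
  if h : Y = Z then of k (f ≫ eqToHom h ≫ g) else 0

/-- The bilinear extension of `mulHom`. -/
def mulBilin : CategoryAlgebra k C →ₗ[k] CategoryAlgebra k C →ₗ[k] CategoryAlgebra k C :=
  lift k (fun _ _ g => lift k (fun _ _ f => mulHom g f))

instance : Mul (CategoryAlgebra k C) := ⟨fun a b => mulBilin a b⟩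

theorem mul_eq (a b : CategoryAlgebra k C) : a * b = mulBilin a b := rfl

theorem of_mul_of_eq_mulHom {X Y Z W : C} (g : Z ⟶ W) (f : X ⟶ Y) :
    of k g * of k f = mulHom g f := by
  simp [mul_eq, mulBilin]

@[simp] theorem of_mul_of {X Y Z : C} (g : Y ⟶ Z) (f : X ⟶ Y) :
    of k g * of k f = of k (f ≫ g) := by
  simp [of_mul_of_eq_mulHom, mulHom]

theorem of_mul_of_ne {X Y Z W : C} (g : Z ⟶ W) (f : X ⟶ Y) (h : Y ≠ Z) :
    of k g * of k f = 0 := by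
  simp [of_mul_of_eq_mulHom, mulHom, h]

theorem mul_assoc' (a b c : CategoryAlgebra k C) : a * b * c = a * (b * c) := by
  let L : CategoryAlgebra k C →ₗ[k] CategoryAlgebra k C →ₗ[k] CategoryAlgebra k C →ₗ[k]
      CategoryAlgebra k C := LinearMap.mk₂ k (fun a b => mulBilin (mulBilin a b))
        (by intros; simp) (by intros; simp) (by intros; simp) (by intros; simp)
  let R : CategoryAlgebra k C →ₗ[k] CategoryAlgebra k C →ₗ[k] CategoryAlgebra k C →ₗ[k]
      CategoryAlgebra k C := LinearMap.mk₂ k (fun a b => mulBilin a ∘ₗ mulBilin b)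
        (by intros; ext; simp) (by intros; ext; simp) (by intros; ext; simp)
        (by intros; ext; simp)
  have h : L = R := by
    apply hom_ext; intro X Y f
    apply hom_ext; intro X' Y' f'
    apply hom_ext; intro X'' Y'' f''
    change of k f * of k f' * of k f'' = of k f * (of k f' * of k f'')
    by_cases h1 : Y' = X
    · subst h1
      by_cases h2 : Y'' = X'
      · subst h2
        simp
      · rw [of_mul_of, of_mul_of_ne _ _ h2, of_mul_of_ne _ _ h2]
        exact (map_zero (mulBilin (of k f))).symm
    · rw [of_mul_of_ne _ _ h1]
      by_cases h2 : Y'' = X'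
      · subst h2
        rw [of_mul_of, of_mul_of_ne _ _ h1]
        exact LinearMap.map_zero₂ mulBilin _
      · rw [of_mul_of_ne _ _ h2]
        exact (LinearMap.map_zero₂ mulBilin _).trans (map_zero (mulBilin (of k f))).symm
  exact congrArg (fun T => T a b c) h

variable [Fintype C]

instance : One (CategoryAlgebra k C) := ⟨∑ X : C, of k (𝟙 X)⟩

theorem one_eq : (1 : CategoryAlgebra k C) = ∑ X : C, of k (𝟙 X) := rfl

theorem one_mul' (a : CategoryAlgebra k C) : 1 * a = a := by
  have h : mulBilin (1 : CategoryAlgebra k C) = LinearMap.id := by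
    apply hom_ext; intro X Y f
    rw [one_eq, map_sum, LinearMap.sum_apply, Finset.sum_eq_single Y]
    · exact (of_mul_of _ _).trans (by simp)
    · intro Z _ hZ
      exact of_mul_of_ne _ _ hZ.symm
    · simp
  exact congrArg (fun T => T a) h

theorem mul_one' (a : CategoryAlgebra k C) : a * 1 = a := by
  have h : (mulBilin (k := k) (C := C)).flip (1 : CategoryAlgebra k C) = LinearMap.id := by
    apply hom_ext; intro X Y f
    change mulBilin (of k f) 1 = of k f
    rw [one_eq, map_sum, Finset.sum_eq_single X]
    · exact (of_mul_of f (𝟙 X)).trans (by simp)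
    · intro Z _ hZ
      exact of_mul_of_ne f (𝟙 Z) hZ
    · simp
  exact congrArg (fun T => T a) h

instance : Ring (CategoryAlgebra k C) where
  __ := (inferInstance : AddCommGroup (CategoryAlgebra k C))
  left_distrib a b c := map_add (mulBilin a) b c
  right_distrib a b c := LinearMap.map_add₂ mulBilin a b c
  zero_mul a := LinearMap.map_zero₂ mulBilin a
  mul_zero a := map_zero (mulBilin a)
  mul_assoc := mul_assoc'
  one_mul := one_mul'
  mul_one := mul_one'

instance : Algebra k (CategoryAlgebra k C) :=
  Algebra.ofModule (fun r a b => LinearMap.map_smul₂ mulBilin r a b)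
    (fun r a b => map_smul (mulBilin a) r b)

theorem algHom_ext_mul {B : Type*} [Ring B] [Algebra k B] (φ : CategoryAlgebra k C →ₗ[k] B)
    (h : ∀ (X Y Z W : C) (g : Z ⟶ W) (f : X ⟶ Y),
      φ (of k g * of k f) = φ (of k g) * φ (of k f)) (a b : CategoryAlgebra k C) :
    φ (a * b) = φ a * φ b := by
  have key : mulBilin.compr₂ φ = (LinearMap.mul k B).compl₁₂ φ φ := by
    apply hom_ext; intro Z W g
    apply hom_ext; intro X Y f
    exact h X Y Z W g f
  exact congrArg (fun T => T a b) key

end CategoryAlgebra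

/-! ### Functors and modules over the category algebra -/

namespace CategoryAlgebra

variable {k : Type u} [Field k] {C : Type} [SmallCategory C]

section ModuleOfFunctor

open scoped Classical in
/-- A morphism `f : X ⟶ Y` acts on `⨁ Z, F Z` by sending the summand `F X` to the summand `F Y`
through `F f`, and the other summands to zero. -/
def homAction (F : C ⥤ ModuleCat.{u} k) {X Y : C} (f : X ⟶ Y) :
    Module.End k (∀ Z : C, F.obj Z) :=
  LinearMap.single k (fun Z : C => F.obj Z) Y ∘ₗ (F.map f).hom ∘ₗ LinearMap.proj X

theorem homAction_same (F : C ⥤ ModuleCat.{u} k) {X Y : C} (f : X ⟶ Y) (m : ∀ Z : C, F.obj Z) :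
    homAction F f m Y = (F.map f).hom (m X) := by
  simp [homAction]

theorem homAction_ne (F : C ⥤ ModuleCat.{u} k) {X Y Z : C} (f : X ⟶ Y) (m : ∀ Z : C, F.obj Z)
    (h : Z ≠ Y) : homAction F f m Z = 0 := by
  simp [homAction, h]

variable [Fintype C]

/-- The action of the category algebra on `⨁ Z, F Z`. -/
def action (F : C ⥤ ModuleCat.{u} k) : CategoryAlgebra k C →ₐ[k] Module.End k (∀ Z : C, F.obj Z) :=
  AlgHom.ofLinearMap (lift k (fun _ _ f => homAction F f))
    (by
      apply LinearMap.ext; intro m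
      funext Z
      rw [one_eq, map_sum, LinearMap.sum_apply, Finset.sum_apply, Finset.sum_eq_single Z]
      · rw [lift_of, homAction_same, F.map_id]
        rfl
      · intro W _ hW
        rw [lift_of, homAction_ne _ _ _ hW.symm]
      · simp)
    (algHom_ext_mul _ (by
      intro X Y Z W g f
      apply LinearMap.ext; intro m
      funext V
      rw [Module.End.mul_apply, lift_of, lift_of]
      by_cases h : Y = Z
      · subst h
        rw [of_mul_of, lift_of]
        by_cases hV : V = W
        · subst hV
          rw [homAction_same, homAction_same, homAction_same, F.map_comp]
          rfl
        · rw [homAction_ne _ _ _ hV, homAction_ne _ _ _ hV]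
      · rw [of_mul_of_ne _ _ h, map_zero]
        by_cases hV : V = W
        · subst hV
          rw [homAction_same, homAction_ne _ _ _ (Ne.symm h), map_zero]
          rfl
        · rw [homAction_ne _ _ _ hV]
          rfl))

/-- The `k C`-module `⨁ Z, F Z` attached to a functor `F` from `C` to `k`-vector spaces
(`C` has only finitely many objects, so that the direct sum is the product). -/
def ModuleOfFunctor (F : C ⥤ ModuleCat.{u} k) : Type u := ∀ Z : C, F.obj Z

instance (F : C ⥤ ModuleCat.{u} k) : AddCommGroup (ModuleOfFunctor F) :=
  inferInstanceAs (AddCommGroup (∀ Z : C, F.obj Z))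

instance (F : C ⥤ ModuleCat.{u} k) : Module (CategoryAlgebra k C) (ModuleOfFunctor F) :=
  Module.compHom (∀ Z : C, F.obj Z) (action F).toRingHom

/-- The component of an element of `⨁ Z, F Z` at `Z`. -/
def ModuleOfFunctor.proj {F : C ⥤ ModuleCat.{u} k} (Z : C) : ModuleOfFunctor F →+ F.obj Z :=
  Pi.evalAddMonoidHom (fun Z : C => F.obj Z) Z

@[ext] theorem ModuleOfFunctor.ext {F : C ⥤ ModuleCat.{u} k} {m m' : ModuleOfFunctor F}
    (h : ∀ Z, proj Z m = proj Z m') : m = m' := funext h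

theorem proj_of_smul_same (F : C ⥤ ModuleCat.{u} k) {X Y : C} (f : X ⟶ Y)
    (m : ModuleOfFunctor F) :
    ModuleOfFunctor.proj Y (of k f • m) = (F.map f).hom (ModuleOfFunctor.proj X m) := by
  change lift k (fun _ _ f => homAction F f) (of k f) m Y = _
  rw [lift_of]
  exact homAction_same F f m

theorem proj_of_smul_ne (F : C ⥤ ModuleCat.{u} k) {X Y Z : C} (f : X ⟶ Y)
    (m : ModuleOfFunctor F) (h : Z ≠ Y) :
    ModuleOfFunctor.proj Z (of k f • m) = 0 := by
  change lift k (fun _ _ f => homAction F f) (of k f) m Z = _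
  rw [lift_of]
  exact homAction_ne F f m h

theorem proj_algebraMap_smul (F : C ⥤ ModuleCat.{u} k) (r : k) (m : ModuleOfFunctor F) (Z : C) :
    ModuleOfFunctor.proj Z (algebraMap k (CategoryAlgebra k C) r • m) =
      r • ModuleOfFunctor.proj Z m := by
  change action F (algebraMap k _ r) m Z = _
  rw [AlgHom.commutes]
  rfl

/-- An additive map between `k C`-modules that commutes with scalars and morphisms is linear. -/
def linearMapMk {M N : Type*} [AddCommGroup M] [AddCommGroup N]
    [Module (CategoryAlgebra k C) M] [Module (CategoryAlgebra k C) N] (φ : M →+ N)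
    (hk : ∀ (r : k) (m : M), φ (algebraMap k (CategoryAlgebra k C) r • m) =
      algebraMap k (CategoryAlgebra k C) r • φ m)
    (h : ∀ (X Y : C) (f : X ⟶ Y) (m : M), φ (of k f • m) = of k f • φ m) :
    M →ₗ[CategoryAlgebra k C] N where
  toFun := φ
  map_add' := φ.map_add
  map_smul' a m := by
    let _ : Module k M := Module.compHom M (algebraMap k (CategoryAlgebra k C))
    let _ : Module k N := Module.compHom N (algebraMap k (CategoryAlgebra k C))
    have hN (r : k) (m : N) : r • m = algebraMap k (CategoryAlgebra k C) r • m := rfl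
    let L : CategoryAlgebra k C →ₗ[k] N :=
      { toFun := fun a => φ (a • m)
        map_add' := by intros; simp [add_smul]
        map_smul' := by intro r a; simp [hN, ← hk, Algebra.smul_def, mul_smul] }
    let R : CategoryAlgebra k C →ₗ[k] N :=
      { toFun := fun a => a • φ m
        map_add' := by intros; simp [add_smul]
        map_smul' := by intro r a; simp [hN, Algebra.smul_def, mul_smul] }
    have : L = R := hom_ext fun X Y f => h X Y f m
    exact congrArg (fun T => T a) this

/-- The map `⨁ Z, F Z → ⨁ Z, G Z` induced by a natural transformation. -/
def moduleMap {F G : C ⥤ ModuleCat.{u} k} (η : F ⟶ G) :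
    ModuleOfFunctor F →ₗ[CategoryAlgebra k C] ModuleOfFunctor G :=
  linearMapMk
    { toFun := fun m Z => (η.app Z).hom (ModuleOfFunctor.proj Z m)
      map_zero' := funext fun Z => by rw [map_zero, map_zero]; rfl
      map_add' := fun m m' => funext fun Z => by rw [map_add, map_add]; rfl }
    (by
      intro r m
      ext Z
      rw [proj_algebraMap_smul]
      change (η.app Z).hom (ModuleOfFunctor.proj Z _) =
        r • (η.app Z).hom (ModuleOfFunctor.proj Z m)
      rw [proj_algebraMap_smul, map_smul])
    (by
      intro X Y f m
      ext Z
      by_cases hZ : Z = Y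
      · subst hZ
        rw [proj_of_smul_same]
        change (η.app Z).hom (ModuleOfFunctor.proj Z _) =
          (G.map f).hom ((η.app X).hom (ModuleOfFunctor.proj X m))
        rw [proj_of_smul_same]
        exact congrArg (fun T => T.hom (ModuleOfFunctor.proj X m)) (η.naturality f)
      · rw [proj_of_smul_ne _ _ _ hZ]
        change (η.app Z).hom (ModuleOfFunctor.proj Z _) = 0
        rw [proj_of_smul_ne _ _ _ hZ, map_zero])

end ModuleOfFunctor

section FunctorOfModule

variable [Fintype C] {M N : Type u} [AddCommGroup M] [Module (CategoryAlgebra k C) M]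
  [AddCommGroup N] [Module (CategoryAlgebra k C) N]

variable (k M) in
/-- The value `1_X • M` of a `k C`-module `M` at an object `X` of `C`. -/
def value (X : C) : AddSubgroup M where
  carrier := {m | of k (𝟙 X) • m = m}
  zero_mem' := smul_zero _
  add_mem' {a b} (ha : _ = _) (hb : _ = _) := by
    change _ • (a + b) = a + b
    rw [smul_add, ha, hb]
  neg_mem' {a} (ha : _ = _) := by
    change _ • (-a) = -a
    rw [smul_neg, ha]

theorem mem_value {X : C} {m : M} : m ∈ value k M X ↔ of k (𝟙 X) • m = m := Iff.rfl

theorem of_smul_mem_value {X Y : C} (f : X ⟶ Y) (m : M) : of k f • m ∈ value k M Y := by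
  rw [mem_value, ← mul_smul, of_mul_of, Category.comp_id]

theorem algebraMap_smul_mem_value {X : C} (r : k) {m : M} (hm : m ∈ value k M X) :
    algebraMap k (CategoryAlgebra k C) r • m ∈ value k M X := by
  rw [mem_value] at hm ⊢
  rw [← mul_smul, ← Algebra.commutes, mul_smul, hm]

instance (X : C) : Module k (value k M X) where
  smul r m := ⟨algebraMap k (CategoryAlgebra k C) r • m.1, algebraMap_smul_mem_value r m.2⟩
  one_smul m := Subtype.ext (by
    change algebraMap k (CategoryAlgebra k C) 1 • m.1 = m.1
    rw [map_one, one_smul])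
  mul_smul r s m := Subtype.ext (by
    change algebraMap k (CategoryAlgebra k C) (r * s) • m.1 = algebraMap k _ r • algebraMap k _ s • m.1
    rw [map_mul, mul_smul])
  smul_zero r := Subtype.ext (smul_zero _)
  smul_add r m m' := Subtype.ext (smul_add _ _ _)
  add_smul r s m := Subtype.ext (by
    change algebraMap k (CategoryAlgebra k C) (r + s) • m.1 =
      algebraMap k _ r • m.1 + algebraMap k _ s • m.1
    rw [map_add, add_smul])
  zero_smul m := Subtype.ext (by
    change algebraMap k (CategoryAlgebra k C) 0 • m.1 = 0
    rw [map_zero, zero_smul])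

theorem coe_smul_value {X : C} (r : k) (m : value k M X) :
    (r • m).1 = algebraMap k (CategoryAlgebra k C) r • m.1 := rfl

variable (M) in
/-- The action of a morphism `f : X ⟶ Y` on the values of a `k C`-module. -/
def valueHom {X Y : C} (f : X ⟶ Y) : value k M X →ₗ[k] value k M Y where
  toFun m := ⟨of k f • m.1, of_smul_mem_value f m.1⟩
  map_add' a b := Subtype.ext (smul_add _ _ _)
  map_smul' r m := Subtype.ext (by
    change of k f • (algebraMap k (CategoryAlgebra k C) r • m.1) = algebraMap k _ r • (of k f • m.1)
    rw [← mul_smul, ← Algebra.commutes, mul_smul])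

/-- The map on values induced by a `k C`-linear map. -/
def valueMap (φ : M →ₗ[CategoryAlgebra k C] N) (X : C) : value k M X →ₗ[k] value k N X where
  toFun m := ⟨φ m.1, by rw [mem_value, ← map_smul, mem_value.1 m.2]⟩
  map_add' a b := Subtype.ext (map_add φ _ _)
  map_smul' r m := Subtype.ext (map_smul φ _ _)

end FunctorOfModule

variable (k C) [Fintype C]

/-- The functor `F ↦ ⨁ Z, F Z` from functors `C ⥤ Vect k` to `k C`-modules. -/
def toModule : (C ⥤ ModuleCat.{u} k) ⥤ ModuleCat.{u} (CategoryAlgebra k C) where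
  obj F := ModuleCat.of _ (ModuleOfFunctor F)
  map η := ModuleCat.ofHom (moduleMap η)
  map_id _ := rfl
  map_comp _ _ := rfl

/-- The functor sending a `k C`-module `M` to the functor `X ↦ 1_X • M`. -/
def toFunctor : ModuleCat.{u} (CategoryAlgebra k C) ⥤ (C ⥤ ModuleCat.{u} k) where
  obj M :=
    { obj := fun X => ModuleCat.of k (value k M X)
      map := fun f => ModuleCat.ofHom (valueHom M f)
      map_id := fun X => ModuleCat.hom_ext (LinearMap.ext fun m => Subtype.ext m.2)
      map_comp := fun f g => ModuleCat.hom_ext (LinearMap.ext fun m => Subtype.ext (by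
        change of k (f ≫ g) • m.1 = of k g • of k f • m.1
        rw [← mul_smul, of_mul_of])) }
  map φ :=
    { app := fun X => ModuleCat.ofHom (valueMap φ.hom X)
      naturality := fun X Y f =>
        ModuleCat.hom_ext (LinearMap.ext fun m => Subtype.ext (map_smul φ.hom (of k f) m.1)) }
  map_id _ := rfl
  map_comp _ _ := rfl

/-! ### Restriction along a functor -/

/-- Restriction of modules along a functor `P : C ⥤ D`: identifying modules over the category
algebras with functors to `k`-vector spaces, this is precomposition with `P`. -/
def resFunctor {D : Type} [SmallCategory D] [Fintype D] (P : C ⥤ D) :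
    ModuleCat.{u} (CategoryAlgebra k D) ⥤ ModuleCat.{u} (CategoryAlgebra k C) :=
  toFunctor k D ⋙ (Functor.whiskeringLeft C D (ModuleCat.{u} k)).obj P ⋙ toModule k C

variable {C}

/-- The functor recovered from the module `⨁ Z, F Z` is `F`. -/
def toFunctorToModuleIso (F : C ⥤ ModuleCat.{u} k) :
    F ≅ (toFunctor k C).obj ((toModule k C).obj F) := by
  classical
  exact NatIso.ofComponents (fun X => LinearEquiv.toModuleIso
    (LinearEquiv.symm
    { toFun := fun m => ModuleOfFunctor.proj X m.1
      map_add' := fun m m' => map_add (ModuleOfFunctor.proj X) m.1 m'.1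
      map_smul' := fun r m => proj_algebraMap_smul F r m.1 X
      invFun := fun v => ⟨(Pi.single X v : ∀ Z : C, F.obj Z), by
        change of k (𝟙 X) • (show ModuleOfFunctor F from Pi.single X v) = Pi.single X v
        ext Z
        by_cases hZ : Z = X
        · subst hZ
          rw [proj_of_smul_same, F.map_id]
          rfl
        · rw [proj_of_smul_ne _ _ _ hZ]
          exact (Pi.single_eq_of_ne (M := fun Z : C => F.obj Z) hZ v).symm⟩
      left_inv := by
        intro m
        apply Subtype.ext
        have hm := mem_value.1 m.2
        apply ModuleOfFunctor.ext
        intro Z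
        by_cases hZ : Z = X
        · subst hZ
          exact Pi.single_eq_same (M := fun Z : C => F.obj Z) Z _
        · refine (Pi.single_eq_of_ne (M := fun Z : C => F.obj Z) hZ _).trans ?_
          exact ((congrArg (ModuleOfFunctor.proj (F := F) Z) hm).symm.trans
            (proj_of_smul_ne F (𝟙 X) m.1 hZ)).symm
      right_inv := fun v => Pi.single_eq_same (M := fun Z : C => F.obj Z) X v }))
    (by
      intro X Y f
      apply ModuleCat.hom_ext
      apply LinearMap.ext
      intro v
      apply Subtype.ext
      change (show ModuleOfFunctor F from Pi.single Y ((F.map f).hom v)) =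
        of k f • (show ModuleOfFunctor F from Pi.single X v)
      ext Z
      by_cases hZ : Z = Y
      · subst hZ
        rw [proj_of_smul_same]
        exact (Pi.single_eq_same (M := fun Z : C => F.obj Z) Z _).trans
          (congrArg (F.map f).hom (Pi.single_eq_same (M := fun Z : C => F.obj Z) X v).symm)
      · rw [proj_of_smul_ne _ _ _ hZ]
        exact Pi.single_eq_of_ne (M := fun Z : C => F.obj Z) hZ _)

section Exact

variable {k} {D : Type} [SmallCategory D] [Fintype D] (P : C ⥤ D)

/-- The component at `X` of an element of the restriction of `M`, as an element of `M`. -/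
def resComponent {M : ModuleCat.{u} (CategoryAlgebra k D)} (X : C)
    (m : (resFunctor k C P).obj M) : M :=
  (show value k M (P.obj X) from (show ∀ Z : C, value k M (P.obj Z) from m) X).1

theorem resComponent_map {M N : ModuleCat.{u} (CategoryAlgebra k D)} (φ : M ⟶ N)
    (m : (resFunctor k C P).obj M) (X : C) :
    resComponent P X (((resFunctor k C P).map φ).hom m) = φ.hom (resComponent P X m) := rfl

theorem of_smul_resComponent {M : ModuleCat.{u} (CategoryAlgebra k D)} (X : C)
    (m : (resFunctor k C P).obj M) :
    of k (𝟙 (P.obj X)) • resComponent P X m = resComponent P X m :=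
  (show value k M (P.obj X) from (show ∀ Z : C, value k M (P.obj Z) from m) X).2

instance : (resFunctor k C P).Additive where
  map_add := rfl

theorem resFunctor_shortExact (S : ShortComplex (ModuleCat.{u} (CategoryAlgebra k D)))
    (hS : S.ShortExact) : (S.map (resFunctor k C P)).ShortExact := by
  have hf := hS.moduleCat_injective_f
  have hg := hS.moduleCat_surjective_g
  have hex := (ShortComplex.ShortExact.moduleCat_exact_iff_function_exact S).1 hS.exact
  apply ModuleCat.shortComplex_shortExact
  · intro m
    constructor
    · intro hm
      have key (X : C) : ∃ n : value k S.X₁ (P.obj X),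
          S.f.hom n.1 = resComponent P X m := by
        have h0 : S.g.hom (resComponent P X m) = 0 :=
          congrArg (fun z => resComponent P X z) hm
        obtain ⟨n, hn⟩ := (hex _).1 h0
        refine ⟨⟨n, ?_⟩, hn⟩
        rw [mem_value]
        apply hf
        rw [map_smul]
        exact (congrArg (fun z => of k (𝟙 (P.obj X)) • z) hn).trans
          ((of_smul_resComponent P X m).trans hn.symm)
      choose n hn using key
      exact ⟨n, funext fun X => Subtype.ext (hn X)⟩
    · rintro ⟨n, rfl⟩
      refine funext fun X => Subtype.ext ?_
      exact (hex _).2 ⟨_, rfl⟩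
  · intro m m' h
    refine funext fun X => Subtype.ext (hf ?_)
    exact congrArg (fun z => resComponent P X z) h
  · intro m
    have key (X : C) : ∃ n : value k S.X₂ (P.obj X),
        S.g.hom n.1 = resComponent P X m := by
      obtain ⟨n, hn⟩ := hg (resComponent P X m)
      refine ⟨⟨of k (𝟙 (P.obj X)) • n, of_smul_mem_value _ _⟩, ?_⟩
      rw [map_smul]
      exact (congrArg (fun z => of k (𝟙 (P.obj X)) • z) hn).trans
        (of_smul_resComponent P X m)
    choose n hn using key
    exact ⟨n, funext fun X => Subtype.ext (hn X)⟩

instance : PreservesFiniteLimits (resFunctor k C P) :=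
  (((resFunctor k C P).exact_tfae.out 0 3 :).1 (resFunctor_shortExact P)).1

instance : PreservesFiniteColimits (resFunctor k C P) :=
  (((resFunctor k C P).exact_tfae.out 0 3 :).1 (resFunctor_shortExact P)).2

end Exact

/-! ### Cohomology of categories -/

variable (C)

/-- The `k C`-module corresponding to the constant functor with value `k`. -/
def constModule : ModuleCat.{u} (CategoryAlgebra k C) :=
  (toModule k C).obj ((Functor.const C).obj (ModuleCat.of k k))

/-- The ordinary cohomology `Hⁿ(C, k) = Extⁿ_{k C}(k, k)` of the category `C`. -/
abbrev Cohomology (n : ℕ) : Type u :=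
  Abelian.Ext.{u} (constModule k C) (constModule k C) n

variable {C} {D : Type} [SmallCategory D] [Fintype D]

/-- The restriction of the constant module is the constant module. -/
def resConstIso (P : C ⥤ D) : constModule k C ≅ (resFunctor k C P).obj (constModule k D) :=
  (toModule k C).mapIso (Functor.isoWhiskerLeft P
    (toFunctorToModuleIso k ((Functor.const D).obj (ModuleCat.of k k))))

/-- The restriction map `Hⁿ(D, k) → Hⁿ(C, k)` along a functor `P : C ⥤ D`: apply the exact
functor `resFunctor` to an extension class and identify the restriction of the constant module
with the constant module. -/
def cohomologyRes (P : C ⥤ D) (n : ℕ) (e : Cohomology k D n) : Cohomology k C n :=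
  ((Abelian.Ext.mk₀ (resConstIso k P).hom).comp (e.mapExactFunctor (resFunctor k C P))
    (zero_add n)).comp (Abelian.Ext.mk₀ (resConstIso k P).inv) (add_zero n)

end CategoryAlgebra

/-! ### Frobenius algebras, Hochschild cohomology, global dimension -/

/-- A Frobenius `k`-algebra: a finite-dimensional algebra `A` that is isomorphic, as a left
`A`-module, to its dual `Hom_k(A, k)`, on which `a` acts by `(a • φ) c = φ (c * a)`. -/
def IsFrobeniusAlgebra (k A : Type u) [Field k] [Ring A] [Algebra k A] : Prop :=
  Module.Finite k A ∧
    ∃ e : A ≃ₗ[k] Module.Dual k A, ∀ a b c : A, e (a * b) c = e b (c * a)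

/-- An algebra `A` as a module over its enveloping algebra `A ⊗ Aᵒᵖ`, with
`(a ⊗ b) • x = a * x * b`. -/
def envelopingModule (k A : Type u) [Field k] [Ring A] [Algebra k A] :
    ModuleCat.{u} (A ⊗[k] Aᵐᵒᵖ) :=
  letI : Module (A ⊗[k] Aᵐᵒᵖ) A := TensorProduct.Algebra.module
  ModuleCat.of (A ⊗[k] Aᵐᵒᵖ) A

/-- Hochschild cohomology `HHⁿ(A) = Extⁿ_{A ⊗ Aᵒᵖ}(A, A)` of an algebra over a field. -/
abbrev HochschildCohomology (k A : Type u) [Field k] [Ring A] [Algebra k A] (n : ℕ) : Type u :=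
  Abelian.Ext.{u} (envelopingModule k A) (envelopingModule k A) n

/-- The Hochschild cohomological dimension `sup {n | HHⁿ(A) ≠ 0}` of `A`. -/
def hchDim (k A : Type u) [Field k] [Ring A] [Algebra k A] : ℕ∞ :=
  sSup {d : ℕ∞ | ∃ n : ℕ, d = n ∧ Nontrivial (HochschildCohomology k A n)}

/-- The (left) global dimension of a ring: the supremum of the projective dimensions of all
its modules. -/
def globalDim (A : Type u) [Ring A] : WithBot ℕ∞ :=
  ⨆ M : ModuleCat.{u} A, projectiveDimension M

/-- Happel's property: if the Hochschild cohomological dimension of `A` is finite, then so is its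
global dimension. -/
def HappelProperty (k A : Type u) [Field k] [Ring A] [Algebra k A] : Prop :=
  hchDim k A < ⊤ → globalDim A < ⊤

end

/-!
The argument shows that `HHⁿ(k C)` and `Extⁿ(k, k)` over `k C` are nonzero for arbitrarily large
`n`, so that both dimensions are infinite and Happel's property holds because its premise fails.
Two facts are needed: the cohomology of `G` with coefficients in `k` is nonzero in arbitrarily large
degrees, and restriction along `π` from the cohomology of `G` to that of `C` vanishes in every
degree in which `HHⁿ(k C)` does.

*Cohomology of `G`.* Let `N` be the normalizer of a subgroup `E` of order `p`, and let `N` act on a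
finite set `Y` in such a way that `E` acts freely. The simplices on `Y` that contain no whole orbit
of `E` form a sphere, the join of the boundaries of the simplices spanned by the orbits. Its
cochains are projective over `E` except in the augmentation degree, and it is acyclic below the top
degree (`exists_faceCoboundary_eq`), where `N` acts on the cohomology through a character
(`exists_fundamental_functional`). Dimension shifting along this complex raises the degree of
cohomology classes of `N` by a fixed amount without killing their restrictions to `E`, and it kills
the restrictions to subgroups fixing a point of `Y`. Since the characters of `N` have finite order,
this yields classes with trivial coefficients in arbitrarily large degrees
(`exists_cocycle_restrict_ne_zero`). When `Y` consists of the cosets of the subgroups of `N` that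
meet `E` trivially, the double coset formula shows that the transfer of such a class to `G` has
the same nonzero restriction to `E` (`exists_invariant_cocycle`). These classes are cocycles on
tuples of elements of `G`; as the functions on tuples form injective modules, they are seen by `Ext`
(`exists_nontrivial_cohomology`).

*Hochschild cohomology.* For an algebra `A` over `k` and a left module `W`, the exact functor
`Hom_k(W, -)` from left modules to bimodules and the action map `A ⟶ Hom_k(W, W)` give a comparison
map `Ext_A(W, N) ⟶ Ext_{A ⊗ Aᵐᵒᵖ}(A, Hom_k(W, N))`. It is injective
(`eq_zero_of_actionBimoduleHom_comp_eq_zero`), because it is bijective in degree zero and every `N`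
embeds in a cofree module `J` for which `Hom_k(W, J)` is acyclic. On the other hand,
`M ↦ M ⊗ k C` with the diagonal left action along `π` (`diagonalFunctor`) is an exact functor from
`k G`-modules to bimodules which sends the trivial module to the regular bimodule
(`diagonalConstIso`), and therefore gives a map `Hⁿ(G, k) ⟶ HHⁿ(k C)`. The natural maps
`M ⊗ k C ⟶ Hom_k(k, res M)` (`diagonalToHomNatTrans`) show that restriction along `π` followed by
the injective comparison map factors through this map (`cohomologyRes_eq_zero`). If restriction is
injective, then `HHⁿ(k C)` and `Hⁿ(C, k)` are nonzero whenever `Hⁿ(G, k)` is.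
-/

noncomputable section

/-! ### Equivariant cochains on tuples -/

section Cochains

variable (k : Type*) [Field k] {S : Type*} {V : Type*} [AddCommGroup V] [Module k V]

/-- The coboundary of functions on tuples: the alternating sum over the omission of one entry.
Tuples are indexed by their length, so that length `i` corresponds to degree `i - 1` and the
length `0` is the augmentation. -/
def coboundary (i : ℕ) : ((Fin i → S) → V) →ₗ[k] ((Fin (i + 1) → S) → V) where
  toFun c x := ∑ j : Fin (i + 1), (-1 : ℤ) ^ (j : ℕ) • c (x ∘ j.succAbove)
  map_add' c c' := by
    funext x
    simp [Finset.sum_add_distrib]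
  map_smul' r c := by
    funext x
    simp [Finset.smul_sum, smul_comm r]

theorem coboundary_apply {i : ℕ} (c : (Fin i → S) → V) (x : Fin (i + 1) → S) :
    coboundary k i c x = ∑ j : Fin (i + 1), (-1 : ℤ) ^ (j : ℕ) • c (x ∘ j.succAbove) := rfl

theorem coboundary_cons {i : ℕ} (c : (Fin (i + 1) → S) → V) (s : S) (x : Fin (i + 1) → S) :
    coboundary k (i + 1) c (Fin.cons s x : Fin (i + 2) → S) =
      c x - coboundary k i (fun y => c (Fin.cons s y : Fin (i + 1) → S)) x := by
  rw [coboundary_apply, Fin.sum_univ_succ, coboundary_apply, sub_eq_add_neg,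
    ← Finset.sum_neg_distrib]
  congr 1
  · simp only [Fin.val_zero, pow_zero, one_smul]
    congr 1
  · refine Finset.sum_congr rfl fun j _ => ?_
    have : (Fin.cons s x : Fin (i + 2) → S) ∘ j.succ.succAbove =
        (Fin.cons s (x ∘ j.succAbove) : Fin (i + 1) → S) := by
      funext l
      refine Fin.cases ?_ (fun l => ?_) l <;> simp
    rw [this]
    simp [pow_succ]

theorem coboundary_zero_apply (c : (Fin 0 → S) → V) (x : Fin 1 → S) :
    coboundary k 0 c x = c Fin.elim0 := by
  rw [coboundary_apply, Fin.sum_univ_succ, Fin.sum_univ_zero, add_zero, Fin.val_zero, pow_zero,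
    one_smul]
  exact congrArg c (Subsingleton.elim _ _)

theorem coboundary_coboundary {i : ℕ} (c : (Fin i → S) → V) :
    coboundary k (i + 1) (coboundary k i c) = 0 := by
  induction i with
  | zero =>
    funext x
    rw [← Fin.cons_self_tail x, coboundary_cons, coboundary_zero_apply, coboundary_zero_apply,
      coboundary_zero_apply, sub_self]
    rfl
  | succ i ih =>
    funext x
    rw [← Fin.cons_self_tail x, coboundary_cons]
    have : (fun y => coboundary k (i + 1) c (Fin.cons (x 0) y : Fin (i + 2) → S)) =
        c - coboundary k i (fun y => c (Fin.cons (x 0) y : Fin (i + 1) → S)) := by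
      funext y
      exact coboundary_cons k c _ y
    rw [this, map_sub, ih, sub_zero, sub_self]
    rfl

/-- Inserting a fixed first entry is a contracting homotopy. -/
theorem coboundary_cons_of_cocycle {i : ℕ} {c : (Fin (i + 1) → S) → V}
    (hc : coboundary k (i + 1) c = 0) (s : S) :
    coboundary k i (fun y => c (Fin.cons s y : Fin (i + 1) → S)) = c := by
  funext x
  have := congrFun hc (Fin.cons s x : Fin (i + 2) → S)
  rw [coboundary_cons, Pi.zero_apply, sub_eq_zero] at this
  exact this.symm

variable {k}

theorem coboundary_comp_linear {W : Type*} [AddCommGroup W] [Module k W] (q : V →ₗ[k] W) {i : ℕ}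
    (c : (Fin i → S) → V) :
    coboundary k i (fun x => q (c x)) = fun x => q (coboundary k i c x) := by
  funext x
  simp [coboundary_apply]

variable {N : Type*} [Group N] [MulAction N S]

theorem coboundary_comp_smul {i : ℕ} (c : (Fin i → S) → V) (n : N) (x : Fin (i + 1) → S) :
    coboundary k i (fun y => c (n • y)) x = coboundary k i c (n • x) := rfl

/-- A cochain with values in a representation of `N` is equivariant under a subgroup `H`. -/
def EquivariantCochain (ρ : Representation k N V) (H : Subgroup N) {i : ℕ}
    (c : (Fin i → S) → V) : Prop :=
  ∀ h ∈ H, ∀ x, c (h • x) = ρ h (c x)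

theorem EquivariantCochain.mono {ρ : Representation k N V} {H H' : Subgroup N} (h : H ≤ H')
    {i : ℕ} {c : (Fin i → S) → V} (hc : EquivariantCochain ρ H' c) : EquivariantCochain ρ H c :=
  fun n hn x => hc n (h hn) x

theorem EquivariantCochain.coboundary {ρ : Representation k N V} {H : Subgroup N} {i : ℕ}
    {c : (Fin i → S) → V} (hc : EquivariantCochain ρ H c) :
    EquivariantCochain ρ H (coboundary k i c) := by
  intro h hh x
  simp only [coboundary_apply, map_sum, map_zsmul]
  exact Finset.sum_congr rfl fun j _ => congrArg _ (hc h hh _)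

theorem EquivariantCochain.sub {ρ : Representation k N V} {H : Subgroup N} {i : ℕ}
    {c c' : (Fin i → S) → V} (hc : EquivariantCochain ρ H c) (hc' : EquivariantCochain ρ H c') :
    EquivariantCochain ρ H (c - c') := by
  intro h hh x
  simp [hc h hh x, hc' h hh x]

theorem EquivariantCochain.comp {W : Type*} [AddCommGroup W] [Module k W]
    {ρ : Representation k N V} {ρ' : Representation k N W} {H : Subgroup N} {q : V →ₗ[k] W}
    (hq : ∀ h ∈ H, ∀ v, q (ρ h v) = ρ' h (q v)) {i : ℕ}
    {c : (Fin i → S) → V} (hc : EquivariantCochain ρ H c) :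
    EquivariantCochain ρ' H (fun x => q (c x)) := by
  intro h hh x
  simp only [hc h hh x, hq h hh]

/-- Over a set with a free action, given through an equivariant map `a` to the group, equivariant
cochains lift along surjections. -/
theorem EquivariantCochain.exists_lift {W : Type*} [AddCommGroup W] [Module k W]
    {ρ : Representation k N V} {ρ' : Representation k N W} {q : V →ₗ[k] W}
    (hq : ∀ n v, q (ρ n v) = ρ' n (q v)) {a : S → N} (ha : ∀ (n : N) (s : S), a (n • s) = n * a s)
    {i : ℕ} {c : (Fin (i + 1) → S) → W} (hc : EquivariantCochain ρ' ⊤ c)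
    (hr : ∀ x, c x ∈ LinearMap.range q) :
    ∃ b : (Fin (i + 1) → S) → V, EquivariantCochain ρ ⊤ b ∧ ∀ x, q (b x) = c x := by
  choose s hs using hr
  refine ⟨fun x => ρ (a (x 0)) (s ((a (x 0))⁻¹ • x)), ?_, ?_⟩
  · intro n _ x
    simp only [Pi.smul_apply, ha, mul_inv_rev, mul_smul, inv_smul_smul, map_mul,
      Module.End.mul_apply]
  · intro x
    rw [hq, hs, ← hc _ (Subgroup.mem_top _), smul_inv_smul]

variable [Fintype N]

open scoped Classical in
/-- Higman's criterion: the identity is the trace over `H` of a `k`-linear endomorphism. For the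
restriction of `ρ` to `H` this means projectivity relative to the trivial subgroup, i.e.
projectivity as a `k[H]`-module. -/
def HigmanProjective (ρ : Representation k N V) (H : Subgroup N) : Prop :=
  ∃ T : V →ₗ[k] V, ∀ v, ∑ h : H, ρ (h : N) (T (ρ (h : N)⁻¹ v)) = v

/-- Equivariant cochains with values in a projective representation are acyclic in positive degrees:
average the contracting homotopy with the endomorphism of Higman's criterion. -/
theorem HigmanProjective.exists_coboundary {ρ : Representation k N V} {H : Subgroup N}
    (hρ : HigmanProjective ρ H) [Nonempty S] {i : ℕ} {c : (Fin (i + 2) → S) → V}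
    (hc : EquivariantCochain ρ H c) (hd : coboundary k _ c = 0) :
    ∃ b : (Fin (i + 1) → S) → V, EquivariantCochain ρ H b ∧ coboundary k _ b = c := by
  classical
  obtain ⟨T, hT⟩ := hρ
  let s : S := Classical.arbitrary S
  let b₀ : (Fin (i + 1) → S) → V := fun y => c (Fin.cons s y : Fin (i + 2) → S)
  have hb₀ : coboundary k _ b₀ = c := coboundary_cons_of_cocycle k hd s
  refine ⟨fun x => ∑ h : H, ρ (h : N) (T (b₀ ((h : N)⁻¹ • x))), ?_, ?_⟩
  · intro n hn x
    rw [map_sum]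
    refine Fintype.sum_equiv (Equiv.mulLeft (⟨n, hn⟩ : H)⁻¹) _ _ fun h => ?_
    simp [mul_smul]
  · funext x
    have : (fun x => ∑ h : H, ρ (h : N) (T (b₀ ((h : N)⁻¹ • x)))) =
        ∑ h : H, fun x => (ρ (h : N) ∘ₗ T) (b₀ ((h : N)⁻¹ • x)) := by
      funext x
      simp
    rw [this, map_sum, Finset.sum_apply]
    conv_rhs => rw [← hT (c x)]
    refine Finset.sum_congr rfl fun h _ => ?_
    rw [coboundary_comp_linear, ← hc _ (H.inv_mem h.2)]
    change ρ (h : N) (T (coboundary k _ (fun x => b₀ ((h : N)⁻¹ • x)) x)) = _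
    rw [coboundary_comp_smul, hb₀]

open scoped Classical in
/-- The case of degree zero: an equivariant cocycle is an invariant vector, and the invariant
vectors of a projective representation are norms. -/
theorem HigmanProjective.exists_norm {ρ : Representation k N V} {H : Subgroup N}
    (hρ : HigmanProjective ρ H) [Nonempty S] {c : (Fin 1 → S) → V}
    (hc : EquivariantCochain ρ H c) (hd : coboundary k _ c = 0) :
    ∃ w : V, ∀ x, c x = ∑ h : H, ρ (h : N) w := by
  obtain ⟨T, hT⟩ := hρ
  let s : S := Classical.arbitrary S
  have hb₀ := coboundary_cons_of_cocycle k hd s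
  have hconst (x y) : c x = c y := by
    rw [← hb₀, coboundary_zero_apply, coboundary_zero_apply]
  refine ⟨T (c fun _ => s), fun x => ?_⟩
  rw [hconst x fun _ => s]
  conv_lhs => rw [← hT (c fun _ => s)]
  refine Finset.sum_congr rfl fun h _ => ?_
  rw [← hc _ (H.inv_mem h.2), hconst ((h : N)⁻¹ • _)]

end Cochains

/-- A weight whose sum over every free orbit of a finite group is one: the indicator function of
a set of representatives of the orbits. -/
theorem exists_weight_of_finite_group (k : Type*) [Field k] (E : Type*) [Group E] [Fintype E]
    (Z : Type*) [MulAction E Z] :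
    ∃ w : Z → k, ∀ z, (∀ e : E, e • z = z → e = 1) → ∑ e : E, w (e⁻¹ • z) = 1 := by
  classical
  let r : Z → Z := fun z => (Quotient.mk (MulAction.orbitRel E Z) z).out
  have hr (e : E) (z : Z) : r (e • z) = r z :=
    congrArg Quotient.out (Quotient.sound (MulAction.orbitRel_apply.2 ⟨e, rfl⟩))
  refine ⟨fun z => if r z = z then 1 else 0, fun z hz => ?_⟩
  obtain ⟨e₀, he₀⟩ : ∃ e : E, e • z = r z :=
    MulAction.orbitRel_apply.1 (Quotient.mk_out (s := MulAction.orbitRel E Z) z)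
  rw [Finset.sum_eq_single e₀⁻¹]
  · have h0 : r (r z) = r z := by rw [← he₀, hr, he₀]
    simp [he₀, h0]
  · intro e _ he
    refine if_neg fun h => ?_
    rw [hr, ← he₀] at h
    have h1 := hz (e * e₀) (by rw [mul_smul, h, smul_inv_smul])
    exact he (eq_inv_of_mul_eq_one_left h1)
  · simp

/-! ### Alternating functions on tuples -/

section Alternating

variable {k : Type*} [Field k] {Y : Type*}

/-- A function on tuples of elements of `Y` is alternating if it is given by the values of an
alternating form on basis vectors. -/
def IsAlternatingFun {b : ℕ} (c : (Fin b → Y) → k) : Prop :=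
  ∃ f : (Y →₀ k) [⋀^Fin b]→ₗ[k] k, ∀ t, c t = f fun i => Finsupp.single (t i) 1

namespace IsAlternatingFun

variable {b : ℕ} {c : (Fin b → Y) → k}

theorem injective (hc : IsAlternatingFun c) {t : Fin b → Y} (ht : c t ≠ 0) :
    Function.Injective t := by
  obtain ⟨f, hf⟩ := hc
  intro i j hij
  by_contra hne
  refine ht ?_
  rw [hf]
  exact f.map_eq_zero_of_eq _ (by rw [hij]) hne

theorem comp_perm (hc : IsAlternatingFun c) (t : Fin b → Y) (σ : Equiv.Perm (Fin b)) :
    c (t ∘ σ) = Equiv.Perm.sign σ • c t := by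
  obtain ⟨f, hf⟩ := hc
  rw [hf, hf, ← f.map_perm]
  rfl

theorem zero : IsAlternatingFun (0 : (Fin b → Y) → k) := ⟨0, fun _ => rfl⟩

theorem add {c' : (Fin b → Y) → k} (hc : IsAlternatingFun c) (hc' : IsAlternatingFun c') :
    IsAlternatingFun (c + c') := by
  obtain ⟨f, hf⟩ := hc
  obtain ⟨f', hf'⟩ := hc'
  exact ⟨f + f', fun t => by simp [hf, hf']⟩

theorem smul (r : k) (hc : IsAlternatingFun c) : IsAlternatingFun (r • c) := by
  obtain ⟨f, hf⟩ := hc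
  exact ⟨r • f, fun t => by simp [hf]⟩

theorem comp_map (hc : IsAlternatingFun c) (g : Y → Y) : IsAlternatingFun fun t => c (g ∘ t) := by
  obtain ⟨f, hf⟩ := hc
  exact ⟨f.compLinearMap (Finsupp.lmapDomain k k g), fun t => by simp [hf]⟩

theorem cons {c : (Fin (b + 1) → Y) → k} (hc : IsAlternatingFun c) (y : Y) :
    IsAlternatingFun fun t => c (Fin.cons y t : Fin (b + 1) → Y) := by
  obtain ⟨f, hf⟩ := hc
  refine ⟨f.curryLeft (Finsupp.single y 1), fun t => ?_⟩
  beta_reduce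
  rw [hf, AlternatingMap.curryLeft_apply_apply]
  congr 1
  funext i
  refine Fin.cases ?_ (fun i => ?_) i <;> simp

theorem coboundary (hc : IsAlternatingFun c) : IsAlternatingFun (coboundary k b c) := by
  obtain ⟨f, hf⟩ := hc
  refine ⟨AlternatingMap.alternatizeUncurryFin
    ((Finsupp.linearCombination k fun _ : Y => (1 : k)).smulRight f), fun t => ?_⟩
  rw [AlternatingMap.alternatizeUncurryFin_apply, coboundary_apply]
  refine Finset.sum_congr rfl fun j _ => ?_
  rw [hf]
  simp
  rfl

/-- Alternating functions may be multiplied by functions of the set of entries. -/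
theorem mul_range [Finite Y] (hc : IsAlternatingFun c) (w : Set Y → k) :
    IsAlternatingFun fun t => w (Set.range t) * c t := by
  classical
  have := Fintype.ofFinite Y
  have hc' := hc
  obtain ⟨f, hf⟩ := hc
  -- Projecting to the basis vectors in `A` cuts `c` down to the tuples with entries in `A`. As `c`
  -- vanishes on tuples with repetitions, for `A` of cardinality `b` this leaves the enumerations
  -- of `A`.
  refine ⟨∑ A ∈ Finset.univ.filter (fun A : Finset Y => A.card = b), w A • f.compLinearMap
    (Finsupp.linearCombination k fun y : Y => if y ∈ A then Finsupp.single y (1 : k) else 0),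
    fun t => ?_⟩
  have hterm (A : Finset Y) : f.compLinearMap
      (Finsupp.linearCombination k fun y : Y => if y ∈ A then Finsupp.single y (1 : k) else 0)
      (fun i => Finsupp.single (t i) 1) = if ∀ i, t i ∈ A then c t else 0 := by
    rw [AlternatingMap.compLinearMap_apply]
    split_ifs with h
    · rw [hf]
      congr 1
      funext i
      simp [h i]
    · push Not at h
      obtain ⟨i, hi⟩ := h
      exact f.map_coord_zero i (by simp [hi])
  have hsum (s : Finset (Finset Y)) (g : Finset Y → (Y →₀ k) [⋀^Fin b]→ₗ[k] k)
      (v : Fin b → Y →₀ k) : (∑ A ∈ s, g A) v = ∑ A ∈ s, g A v := by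
    induction s using Finset.induction_on with
    | empty => simp
    | insert A s hA ih => simp [Finset.sum_insert hA, ih]
  beta_reduce
  rw [hsum]
  simp only [AlternatingMap.smul_apply, hterm, smul_eq_mul]
  by_cases h0 : c t = 0
  · simp [h0]
  have ht := hc'.injective h0
  rw [Finset.sum_eq_single (Finset.univ.image t)]
  · simp
  · intro A hA hne
    rw [if_neg, mul_zero]
    intro h
    refine hne (Finset.eq_of_subset_of_card_le ?_ ?_).symm
    · intro y hy
      obtain ⟨i, -, rfl⟩ := Finset.mem_image.1 hy
      exact h i
    · rw [(Finset.mem_filter.1 hA).2, Finset.card_image_of_injective _ ht, Finset.card_univ,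
        Fintype.card_fin]
  · intro h
    exact absurd (Finset.mem_filter.2 ⟨Finset.mem_univ _, by
      rw [Finset.card_image_of_injective _ ht, Finset.card_univ, Fintype.card_fin]⟩) h

end IsAlternatingFun

end Alternating

/-! ### The join of the boundaries of the simplices spanned by the orbits -/

section Sphere

variable {N : Type*} [Group N] (E : Subgroup N) {Y : Type*} [MulAction N Y]

/-- A tuple of points is a face if its entries do not exhaust an orbit of `E`. -/
def IsFace {b : ℕ} (t : Fin b → Y) : Prop := ∀ y : Y, ∃ e ∈ E, e • y ∉ Set.range t

variable {E}

theorem IsFace.mono {b b' : ℕ} {t : Fin b → Y} {t' : Fin b' → Y} (ht : IsFace E t)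
    (h : Set.range t' ⊆ Set.range t) : IsFace E t' := by
  intro y
  obtain ⟨e, he, hy⟩ := ht y
  exact ⟨e, he, fun h' => hy (h h')⟩

theorem IsFace.smul [E.Normal] {b : ℕ} {t : Fin b → Y} (ht : IsFace E t) (n : N) :
    IsFace E (n • t) := by
  intro y
  obtain ⟨e, he, hy⟩ := ht (n⁻¹ • y)
  refine ⟨n * e * n⁻¹, ‹E.Normal›.conj_mem e he n, ?_⟩
  rintro ⟨i, hi⟩
  refine hy ⟨i, ?_⟩
  have : t i = n⁻¹ • (n • t) i := by simp
  rw [this, hi]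
  simp [mul_smul]

theorem isFace_smul_iff [E.Normal] {b : ℕ} {t : Fin b → Y} (n : N) :
    IsFace E (n • t) ↔ IsFace E t :=
  ⟨fun h => by simpa using h.smul n⁻¹, fun h => h.smul n⟩

variable (k : Type*) [Field k] (E Y)

/-- The alternating functions on the faces with `b` vertices, extended by zero to the tuples that
are not faces. Under the (augmented) indexing by the number of vertices they form the simplicial
cochain complex of a sphere with an action of `N`. -/
def faceCochains (b : ℕ) : Submodule k ((Fin b → Y) → k) where
  carrier := {c | IsAlternatingFun c ∧ ∀ t, ¬ IsFace E t → c t = 0}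
  zero_mem' := ⟨.zero, fun _ _ => rfl⟩
  add_mem' h h' := ⟨h.1.add h'.1, fun t ht => by simp [h.2 t ht, h'.2 t ht]⟩
  smul_mem' r _ h := ⟨h.1.smul r, fun t ht => by simp [h.2 t ht]⟩

variable {k E Y}

open scoped Classical in
/-- An alternating function becomes a cochain on the faces if it is set to zero on the other
tuples. -/
theorem IsAlternatingFun.cut_mem [Finite Y] {b : ℕ} {c : (Fin b → Y) → k}
    (hc : IsAlternatingFun c) :
    (fun t => if IsFace E t then c t else 0) ∈ faceCochains E Y k b := by
  refine ⟨?_, fun t ht => if_neg ht⟩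
  convert hc.mul_range (fun A => if ∀ y : Y, ∃ e ∈ E, e • y ∉ A then 1 else 0) using 2 with t
  by_cases h : IsFace E t
  · rw [if_pos (show ∀ y : Y, ∃ e ∈ E, e • y ∉ Set.range t from h), one_mul]
    exact if_pos h
  · rw [if_neg (show ¬ ∀ y : Y, ∃ e ∈ E, e • y ∉ Set.range t from h), zero_mul]
    exact if_neg h

variable (k E Y)

open scoped Classical in
/-- The coboundary of the simplicial cochain complex `faceCochains`. -/
def faceCoboundary [Finite Y] (b : ℕ) : faceCochains E Y k b →ₗ[k] faceCochains E Y k (b + 1) where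
  toFun c := ⟨fun t => if IsFace E t then coboundary k b c.1 t else 0, c.2.1.coboundary.cut_mem⟩
  map_add' c c' := Subtype.ext <| funext fun t => by
    by_cases h : IsFace E t <;> simp [h]
  map_smul' r c := Subtype.ext <| funext fun t => by
    by_cases h : IsFace E t <;> simp [h]

/-- The action of `N` on `faceCochains`. -/
def faceRep [E.Normal] (b : ℕ) : Representation k N (faceCochains E Y k b) where
  toFun n :=
    { toFun := fun c => ⟨fun t => c.1 (n⁻¹ • t), c.2.1.comp_map (n⁻¹ • ·), fun t ht =>
        c.2.2 _ fun h => ht ((isFace_smul_iff n⁻¹).1 h)⟩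
      map_add' := fun _ _ => rfl
      map_smul' := fun _ _ => rfl }
  map_one' := by
    ext c t
    simp
  map_mul' n n' := by
    ext c t
    simp [mul_smul]

variable {k E Y}

theorem faceRep_apply [E.Normal] {b : ℕ} (n : N) (c : faceCochains E Y k b) (t : Fin b → Y) :
    (faceRep E Y k b n c).1 t = c.1 (n⁻¹ • t) := rfl

variable [Finite Y]

theorem faceCoboundary_of_isFace {b : ℕ} (c : faceCochains E Y k b) {t : Fin (b + 1) → Y}
    (ht : IsFace E t) : (faceCoboundary E Y k b c).1 t = coboundary k b c.1 t := if_pos ht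

theorem faceCoboundary_of_not_isFace {b : ℕ} (c : faceCochains E Y k b) {t : Fin (b + 1) → Y}
    (ht : ¬ IsFace E t) : (faceCoboundary E Y k b c).1 t = 0 := if_neg ht

theorem faceCoboundary_faceRep [E.Normal] {b : ℕ} (n : N) (c : faceCochains E Y k b) :
    faceCoboundary E Y k b (faceRep E Y k b n c) =
      faceRep E Y k (b + 1) n (faceCoboundary E Y k b c) := by
  apply Subtype.ext
  funext t
  rw [faceRep_apply]
  by_cases ht : IsFace E t
  · rw [faceCoboundary_of_isFace _ ht, faceCoboundary_of_isFace _ (ht.smul _)]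
    rfl
  · rw [faceCoboundary_of_not_isFace _ ht,
      faceCoboundary_of_not_isFace _ fun h => ht ((isFace_smul_iff n⁻¹).1 h)]

theorem faceCoboundary_faceCoboundary {b : ℕ} (c : faceCochains E Y k b) :
    faceCoboundary E Y k (b + 1) (faceCoboundary E Y k b c) = 0 := by
  apply Subtype.ext
  funext t
  by_cases ht : IsFace E t
  · rw [faceCoboundary_of_isFace _ ht]
    have h := congrFun (coboundary_coboundary k c.1) t
    rw [coboundary_apply] at h ⊢
    refine Eq.trans (Finset.sum_congr rfl fun j _ => ?_) h
    rw [faceCoboundary_of_isFace _ (ht.mono (Set.range_comp_subset_range _ _))]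
  · rw [faceCoboundary_of_not_isFace _ ht]
    rfl

/-- Inserting a fixed first vertex. -/
def faceCons {b : ℕ} (y : Y) (c : faceCochains E Y k (b + 1)) : faceCochains E Y k b :=
  ⟨fun t => c.1 (Fin.cons y t : Fin (b + 1) → Y), c.2.1.cons y, fun t ht => c.2.2 _ fun h =>
    ht (h.mono (by rw [Fin.range_cons]; exact Set.subset_insert _ _))⟩

/-- Inserting the vertex `y` is a contracting homotopy away from the faces to which `y` cannot be
added. -/
theorem faceCoboundary_faceCons {b : ℕ} (y : Y) {c : faceCochains E Y k (b + 1)}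
    (hc : faceCoboundary E Y k (b + 1) c = 0) {t : Fin (b + 1) → Y}
    (ht : IsFace E (Fin.cons y t : Fin (b + 2) → Y)) :
    (faceCoboundary E Y k b (faceCons y c)).1 t = c.1 t := by
  have h := congrFun (congrArg Subtype.val hc) (Fin.cons y t : Fin (b + 2) → Y)
  rw [faceCoboundary_of_isFace _ ht, coboundary_cons] at h
  rw [faceCoboundary_of_isFace _ (ht.mono (by rw [Fin.range_cons]; exact Set.subset_insert _ _))]
  exact (sub_eq_zero.1 h).symm

/-- The cochain `c` is supported on the tuples that contain, of the orbit of `y`, exactly the points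
other than `y`. -/
def SupportedOff {b : ℕ} (c : faceCochains E Y k b) (y : Y) : Prop :=
  ∀ t, c.1 t ≠ 0 → ∀ e ∈ E, e • y ∈ Set.range t ↔ e ≠ 1

end Sphere

/-! ### The cohomology of the sphere -/

section SphereExact

variable {N : Type*} [Group N] {E : Subgroup N} {Y : Type*} [MulAction N Y]
  {k : Type*} [Field k]

theorem isFace_of_apply_ne_zero {b : ℕ} {c : faceCochains E Y k b} {t : Fin b → Y}
    (h : c.1 t ≠ 0) : IsFace E t :=
  by_contra fun h' => h (c.2.2 t h')

/-- A set of representatives of the orbits of `E`. -/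
structure IsOrbitTransversal (E : Subgroup N) (B : Set Y) : Prop where
  exists_smul : ∀ y : Y, ∃ e ∈ E, ∃ b ∈ B, e • b = y
  eq_of_smul : ∀ b ∈ B, ∀ b' ∈ B, ∀ e ∈ E, e • b = b' → b = b'

variable (E Y) in
theorem exists_isOrbitTransversal : ∃ B : Set Y, IsOrbitTransversal E B := by
  let r : Y → Y := fun y => (Quotient.mk (MulAction.orbitRel E Y) y).out
  have hr (e : E) (y : Y) : r (e • y) = r y :=
    congrArg Quotient.out (Quotient.sound (MulAction.orbitRel_apply.2 ⟨e, rfl⟩))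
  have hr' (y : Y) : ∃ e : E, e • y = r y :=
    MulAction.orbitRel_apply.1 (Quotient.mk_out (s := MulAction.orbitRel E Y) y)
  refine ⟨Set.range r, fun y => ?_, ?_⟩
  · obtain ⟨e, he⟩ := hr' y
    refine ⟨e⁻¹, E.inv_mem e.2, r y, ⟨y, rfl⟩, ?_⟩
    rw [← he]
    exact inv_smul_smul (e : N) y
  · rintro _ ⟨y, rfl⟩ _ ⟨y', rfl⟩ e he h
    have hrr (y : Y) : r (r y) = r y := by
      obtain ⟨e, he⟩ := hr' y
      rw [← he, hr, he]
    have := hr ⟨e, he⟩ (r y)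
    change r (e • r y) = _ at this
    rw [h, hrr, hrr] at this
    exact this.symm

variable {B : Set Y}

/-- A cochain supported off every point of a transversal `B` lives on the tuples that enumerate the
complement of `B`, which span a single facet. -/
theorem range_eq_compl_of_supportedOff (hfree : ∀ e ∈ E, ∀ y : Y, e • y = y → e = 1)
    (hB : IsOrbitTransversal E B) {b : ℕ} {c : faceCochains E Y k b}
    (hc : ∀ y ∈ B, SupportedOff c y) {t : Fin b → Y} (ht : c.1 t ≠ 0) : Set.range t = Bᶜ := by
  ext y
  obtain ⟨e, he, z, hz, rfl⟩ := hB.exists_smul y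
  rw [hc z hz t ht e he, Set.mem_compl_iff, not_iff_not]
  constructor
  · rintro rfl
    rwa [one_smul]
  · intro h
    exact hfree e he z (hB.eq_of_smul z hz _ h e he rfl).symm

variable [Finite Y]

/-- A cocycle is cohomologous to one supported off a given point `y`: the faces to which `y` cannot
be added are those containing the rest of its orbit. -/
theorem supportedOff_sub_faceCoboundary (hfree : ∀ e ∈ E, ∀ y : Y, e • y = y → e = 1) {b : ℕ}
    {c : faceCochains E Y k (b + 1)} (hc : faceCoboundary E Y k (b + 1) c = 0) (y : Y) :
    SupportedOff (c - faceCoboundary E Y k b (faceCons y c)) y := by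
  intro t ht
  have hface := isFace_of_apply_ne_zero ht
  have hnot : ¬ IsFace E (Fin.cons y t : Fin (b + 2) → Y) := fun h =>
    ht (sub_eq_zero.2 (faceCoboundary_faceCons y hc h).symm)
  unfold IsFace at hnot
  push Not at hnot
  obtain ⟨z, hz⟩ := hnot
  simp only [Fin.range_cons] at hz
  obtain ⟨e₀, he₀, hz₀⟩ := hface z
  have hy : e₀ • z = y := (hz e₀ he₀).resolve_right hz₀
  intro e he
  constructor
  · rintro h rfl
    rw [one_smul] at h
    exact hz₀ (hy ▸ h)
  · intro hne
    have h := hz (e * e₀) (E.mul_mem he he₀)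
    rw [mul_smul, hy] at h
    exact h.resolve_left fun h' => hne (hfree e he y h')

/-- Moving the support off `y` keeps it off the points `y'` of the other orbits. -/
theorem SupportedOff.sub_faceCoboundary {b : ℕ} {c : faceCochains E Y k (b + 1)} {y y' : Y}
    (hy : ∀ e ∈ E, e • y' ≠ y) (hc : SupportedOff c y') :
    SupportedOff (c - faceCoboundary E Y k b (faceCons y c)) y' := by
  intro t ht
  have hface := isFace_of_apply_ne_zero ht
  by_cases h0 : c.1 t = 0
  · have h1 : (faceCoboundary E Y k b (faceCons y c)).1 t ≠ 0 := by
      intro h1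
      exact ht (by change c.1 t - _ = 0; rw [h0, h1, sub_zero])
    rw [faceCoboundary_of_isFace _ hface, coboundary_apply] at h1
    obtain ⟨j, -, hj⟩ := Finset.exists_ne_zero_of_sum_ne_zero h1
    have hj' : c.1 (Fin.cons y (t ∘ j.succAbove) : Fin (b + 1) → Y) ≠ 0 := fun h' =>
      hj (by rw [show (faceCons y c).1 (t ∘ j.succAbove) = 0 from h', smul_zero])
    have key := hc _ hj'
    have hmem (e : N) (he : e ∈ E) (hne : e ≠ 1) : e • y' ∈ Set.range t := by
      have := (key e he).2 hne
      rw [Fin.range_cons] at this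
      exact Set.range_comp_subset_range _ _ (this.resolve_left (hy e he))
    intro e he
    refine ⟨?_, hmem e he⟩
    rintro h rfl
    obtain ⟨e', he', hn⟩ := hface y'
    by_cases h1 : e' = 1
    · subst h1
      exact hn h
    · exact hn (hmem e' he' h1)
  · exact hc t h0

/-- Every cocycle is cohomologous to one supported off a transversal of the orbits. -/
theorem exists_supportedOff (hfree : ∀ e ∈ E, ∀ y : Y, e • y = y → e = 1)
    (hB : IsOrbitTransversal E B) {b : ℕ}
    {c : faceCochains E Y k (b + 1)} (hc : faceCoboundary E Y k (b + 1) c = 0) :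
    ∃ a, ∀ y ∈ B, SupportedOff (c - faceCoboundary E Y k b a) y := by
  have key (P : Set Y) (hP : P.Finite) (hPB : P ⊆ B) :
      ∃ a, ∀ y ∈ P, SupportedOff (c - faceCoboundary E Y k b a) y := by
    induction P, hP using Set.Finite.induction_on with
    | empty => exact ⟨0, by simp⟩
    | @insert y P hy hP ih =>
      obtain ⟨a, ha⟩ := ih ((Set.subset_insert _ _).trans hPB)
      have hc' : faceCoboundary E Y k (b + 1) (c - faceCoboundary E Y k b a) = 0 := by
        rw [map_sub, hc, faceCoboundary_faceCoboundary, sub_zero]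
      refine ⟨a + faceCons y (c - faceCoboundary E Y k b a), ?_⟩
      rw [map_add, ← sub_sub]
      rintro y' (rfl | hy')
      · exact supportedOff_sub_faceCoboundary hfree hc' _
      · refine (ha y' hy').sub_faceCoboundary fun e he h => hy ?_
        rwa [← hB.eq_of_smul y' (hPB (Or.inr hy')) y (hPB (Or.inl rfl)) e he h]
  exact key B (Set.toFinite B) subset_rfl

/-- The complex of the sphere is exact below the top degree: a cocycle supported on enumerations of
the complement of a transversal vanishes unless its degree is the number of these points. -/
theorem exists_faceCoboundary_eq (hfree : ∀ e ∈ E, ∀ y : Y, e • y = y → e = 1)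
    (hB : IsOrbitTransversal E B) {b : ℕ} (hb : b + 1 ≠ Bᶜ.ncard)
    {c : faceCochains E Y k (b + 1)} (hc : faceCoboundary E Y k (b + 1) c = 0) :
    ∃ a, faceCoboundary E Y k b a = c := by
  obtain ⟨a, ha⟩ := exists_supportedOff hfree hB hc
  refine ⟨a, (sub_eq_zero.1 ?_).symm⟩
  apply Subtype.ext
  funext t
  by_contra ht
  have hinj := (c - faceCoboundary E Y k b a).2.1.injective ht
  refine hb ?_
  rw [← range_eq_compl_of_supportedOff hfree hB ha ht, ← Set.image_univ,
    Set.ncard_image_of_injective _ hinj, Set.ncard_univ, Nat.card_fin]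

/-- There are no faces of dimension larger than that of the sphere. -/
theorem faceCochains_eq_zero (hB : IsOrbitTransversal E B) {b : ℕ} (hb : Bᶜ.ncard < b)
    (c : faceCochains E Y k b) : c = 0 := by
  apply Subtype.ext
  funext t
  by_contra ht
  have hinj := c.2.1.injective ht
  have hface := isFace_of_apply_ne_zero ht
  choose e he hy using hface
  have h1 : B.ncard ≤ (Set.range t)ᶜ.ncard := by
    refine Set.ncard_le_ncard_of_injOn (fun y => e y • y) (fun y _ => hy y) ?_ (Set.toFinite _)
    intro y hyB y' hyB' h
    refine hB.eq_of_smul y hyB y' hyB' _ (E.mul_mem (E.inv_mem (he y')) (he y)) ?_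
    rw [mul_smul, inv_smul_eq_iff]
    exact h
  have h2 := Set.ncard_add_ncard_compl B
  have h3 := Set.ncard_add_ncard_compl (Set.range t)
  have h4 : (Set.range t).ncard = b := by
    rw [← Set.image_univ, Set.ncard_image_of_injective _ hinj, Set.ncard_univ, Nat.card_fin]
  omega

/-- The top cohomology of the sphere is at most one-dimensional. -/
theorem exists_linear_combination_faceCoboundary
    (hfree : ∀ e ∈ E, ∀ y : Y, e • y = y → e = 1) (hB : IsOrbitTransversal E B) {b : ℕ}
    (hb : b + 1 = Bᶜ.ncard) :
    ∃ ℓ : faceCochains E Y k (b + 1) → k, ∀ c c' : faceCochains E Y k (b + 1),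
      ℓ c' • c - ℓ c • c' ∈ LinearMap.range (faceCoboundary E Y k b) ∧
      (ℓ c = 0 → c ∈ LinearMap.range (faceCoboundary E Y k b)) := by
  have hcocycle (c : faceCochains E Y k (b + 1)) : faceCoboundary E Y k (b + 1) c = 0 :=
    faceCochains_eq_zero hB (by omega) _
  choose a ha using fun c => exists_supportedOff hfree hB (hcocycle c)
  obtain ⟨t₀, hinj₀, ht₀⟩ : ∃ t₀ : Fin (b + 1) → Y, Function.Injective t₀ ∧
      Set.range t₀ = Bᶜ := by
    have e : Fin (b + 1) ≃ (Bᶜ : Set Y) :=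
      (Finite.equivFinOfCardEq (by rw [hb]; rfl)).symm
    exact ⟨fun i => e i, Subtype.val_injective.comp e.injective, by
      rw [Set.range_comp' Subtype.val e, e.range_eq_univ, Set.image_univ, Subtype.range_coe]⟩
  have hzero (c : faceCochains E Y k (b + 1)) (hc : ∀ y ∈ B, SupportedOff c y)
      (h : c.1 t₀ = 0) : c = 0 := by
    apply Subtype.ext
    funext t
    by_contra ht
    have hinj := c.2.1.injective ht
    have hrange := (range_eq_compl_of_supportedOff hfree hB hc ht).trans ht₀.symm
    let σ : Equiv.Perm (Fin (b + 1)) := (Equiv.ofInjective t hinj).trans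
      ((Equiv.setCongr hrange).trans (Equiv.ofInjective t₀ hinj₀).symm)
    have hσ : t = t₀ ∘ σ := by
      funext i
      change t i = t₀ ((Equiv.ofInjective t₀ hinj₀).symm _)
      rw [Equiv.apply_ofInjective_symm hinj₀]
      rfl
    refine ht ?_
    rw [hσ, c.2.1.comp_perm, h, smul_zero]
    rfl
  refine ⟨fun c => (c - faceCoboundary E Y k b (a c)).1 t₀, fun c c' => ⟨?_, fun h => ?_⟩⟩
  · set r := (c - faceCoboundary E Y k b (a c)).1 t₀ with hr
    set r' := (c' - faceCoboundary E Y k b (a c')).1 t₀ with hr'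
    refine ⟨r' • a c - r • a c', ?_⟩
    have h := hzero (r' • (c - faceCoboundary E Y k b (a c)) -
      r • (c' - faceCoboundary E Y k b (a c'))) ?_ ?_
    · rw [map_sub, map_smul, map_smul]
      rw [smul_sub, smul_sub] at h
      rw [← sub_eq_zero, ← neg_eq_zero, ← h]
      abel
    · intro y hy t ht
      by_cases h1 : (c - faceCoboundary E Y k b (a c)).1 t = 0
      · by_cases h2 : (c' - faceCoboundary E Y k b (a c')).1 t = 0
        · refine absurd ?_ ht
          change r' * (c - faceCoboundary E Y k b (a c)).1 t -
            r * (c' - faceCoboundary E Y k b (a c')).1 t = 0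
          rw [h1, h2, mul_zero, mul_zero, sub_zero]
        · exact ha c' y hy t h2
      · exact ha c y hy t h1
    · change r' * r - r * r' = 0
      ring
  · exact ⟨a c, (sub_eq_zero.1 (hzero _ (ha c) h)).symm⟩

end SphereExact

/-! ### The action on the cochains of the sphere -/

section SphereRep

variable {N : Type*} [Group N] {E : Subgroup N} {Y : Type*} [MulAction N Y]
  {k : Type*} [Field k]

theorem smul_mem_of_prime_card (hE : (Nat.card E).Prime) {A : Set Y} {e : N} (he : e ∈ E)
    (hne : e ≠ 1) (hA : ∀ y ∈ A, e • y ∈ A) {y : Y} (hy : y ∈ A) {e' : N} (he' : e' ∈ E) :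
    e' • y ∈ A := by
  have : Fact (Nat.card E).Prime := ⟨hE⟩
  have hfin : Finite E := Nat.finite_of_card_ne_zero hE.ne_zero
  have hne' : (⟨e, he⟩ : E) ≠ 1 := fun h => hne (congrArg Subtype.val h)
  have hmem : (⟨e', he'⟩ : E) ∈ Subgroup.zpowers (⟨e, he⟩ : E) :=
    mem_zpowers_of_prime_card rfl hne'
  rw [← mem_powers_iff_mem_zpowers] at hmem
  obtain ⟨m, hm⟩ := hmem
  have hm' : e ^ m = e' := congrArg Subtype.val hm
  rw [← hm']
  clear hm hm'
  induction m with
  | zero => simpa using hy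
  | succ m ih =>
    rw [pow_succ', mul_smul]
    exact hA _ ih

theorem exists_mem_ne_one (hE : (Nat.card E).Prime) : ∃ e ∈ E, e ≠ 1 := by
  have hfin : Finite E := Nat.finite_of_card_ne_zero hE.ne_zero
  have : Nontrivial E := Finite.one_lt_card_iff_nontrivial.1 hE.one_lt
  obtain ⟨e, he⟩ := exists_ne (1 : E)
  exact ⟨e, e.2, fun h => he (Subtype.ext h)⟩

theorem isFace_of_subsingleton (hE : (Nat.card E).Prime)
    (hfree : ∀ e ∈ E, ∀ y : Y, e • y = y → e = 1) {b : ℕ} {t : Fin b → Y}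
    (ht : (Set.range t).Subsingleton) : IsFace E t := by
  intro y
  by_contra! h
  obtain ⟨e, he, hne⟩ := exists_mem_ne_one hE
  have h1 := h 1 E.one_mem
  rw [one_smul] at h1
  exact hne (hfree e he y (ht (h e he) h1))

/-- Multiplication by a function of the set of vertices. -/
def faceWeight [Finite Y] (w : Set Y → k) (b : ℕ) :
    faceCochains E Y k b →ₗ[k] faceCochains E Y k b where
  toFun c := ⟨fun t => w (Set.range t) * c.1 t, c.2.1.mul_range w,
    fun t ht => mul_eq_zero_of_right _ (c.2.2 t ht)⟩
  map_add' _ _ := Subtype.ext <| funext fun _ => mul_add _ _ _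
  map_smul' _ _ := Subtype.ext <| funext fun _ => mul_left_comm _ _ _

theorem faceWeight_apply [Finite Y] (w : Set Y → k) {b : ℕ} (c : faceCochains E Y k b)
    (t : Fin b → Y) : (faceWeight w b c).1 t = w (Set.range t) * c.1 t := rfl

open scoped Pointwise in
/-- The cochains in nonzero degree are projective over `E`: a subgroup `E` of prime order permutes
the vertex sets of the nonempty faces freely, since a face fixed by an element of `E` would contain
a whole orbit. -/
theorem higmanProjective_faceRep [E.Normal] [Finite Y] [Fintype N] (hE : (Nat.card E).Prime)
    (b : ℕ) : HigmanProjective (faceRep E Y k (b + 1)) E := by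
  classical
  obtain ⟨w, hw⟩ := exists_weight_of_finite_group k E (Set Y)
  refine ⟨faceWeight w (b + 1), fun c => ?_⟩
  apply Subtype.ext
  funext t
  rw [AddSubmonoidClass.coe_finsetSum, Finset.sum_apply]
  have hterm (h : E) : (faceRep E Y k (b + 1) (h : N) (faceWeight w (b + 1)
      (faceRep E Y k (b + 1) (h : N)⁻¹ c))).1 t = w (h⁻¹ • Set.range t) * c.1 t := by
    rw [faceRep_apply, faceWeight_apply, faceRep_apply, inv_inv, smul_inv_smul]
    congr 2
    exact Set.range_comp (fun y => (h : N)⁻¹ • y) t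
  refine (Finset.sum_congr rfl fun h _ => hterm h).trans ?_
  rw [← Finset.sum_mul]
  by_cases h0 : c.1 t = 0
  · rw [h0, mul_zero]
  rw [hw, one_mul]
  intro e he
  by_contra hne
  obtain ⟨e', he', h'⟩ := isFace_of_apply_ne_zero h0 (t 0)
  refine h' (smul_mem_of_prime_card hE e.2 (fun h => hne (Subtype.ext h)) ?_
    (Set.mem_range_self (0 : Fin (b + 1))) he')
  intro y hy
  have := Set.smul_mem_smul_set (a := e) hy
  rwa [he] at this

theorem faceRep_zero_apply [E.Normal] (n : N) (c : faceCochains E Y k 0) :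
    faceRep E Y k 0 n c = c := by
  apply Subtype.ext
  funext t
  rw [faceRep_apply]
  exact congrArg c.1 (Subsingleton.elim _ _)

theorem faceCons_faceRep [E.Normal] {b : ℕ} {y : Y} {n : N} (hn : n • y = y)
    (c : faceCochains E Y k (b + 1)) :
    faceCons y (faceRep E Y k (b + 1) n c) = faceRep E Y k b n (faceCons y c) := by
  apply Subtype.ext
  funext t
  refine congrArg c.1 (a₁ := n⁻¹ • (Fin.cons y t : Fin (b + 1) → Y))
    (a₂ := (Fin.cons y (n⁻¹ • t) : Fin (b + 1) → Y)) (funext fun i => ?_)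
  refine Fin.cases ?_ (fun i => ?_) i
  · simp [inv_smul_eq_iff, hn]
  · simp

variable [Finite Y]

theorem faceCons_faceCoboundary_zero (hE : (Nat.card E).Prime)
    (hfree : ∀ e ∈ E, ∀ y : Y, e • y = y → e = 1) (y : Y) (c : faceCochains E Y k 0) :
    faceCons y (faceCoboundary E Y k 0 c) = c := by
  apply Subtype.ext
  funext t
  change (faceCoboundary E Y k 0 c).1 (Fin.cons y t : Fin 1 → Y) = _
  rw [faceCoboundary_of_isFace, coboundary_zero_apply]
  · exact congrArg c.1 (Subsingleton.elim _ _)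
  · refine isFace_of_subsingleton hE hfree ?_
    rintro _ ⟨i, rfl⟩ _ ⟨j, rfl⟩
    rw [Subsingleton.elim (α := Fin 1) i j]

/-- Insertion of a first vertex as a linear map. -/
def faceConsLinear (b : ℕ) (y : Y) : faceCochains E Y k (b + 1) →ₗ[k] faceCochains E Y k b where
  toFun := faceCons y
  map_add' _ _ := rfl
  map_smul' _ _ := rfl

/-- The constant function `1` on the empty face. -/
def faceUnit : faceCochains E Y k 0 :=
  ⟨fun _ => 1, ⟨AlternatingMap.constOfIsEmpty k _ _ 1, fun _ => rfl⟩, fun t ht => by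
    refine absurd (fun y => ⟨1, E.one_mem, ?_⟩) ht
    simp⟩

variable [E.Normal] [Fintype N]

/-- A sphere with a free action of a group of order `p` carries a nonzero cohomology class in top
degree in characteristic `p`: otherwise the complex of cochains would be a resolution making the
trivial representation relatively projective. -/
theorem range_faceCoboundary_ne_top [Nonempty Y] (hE : (Nat.card E).Prime)
    (hk : (Nat.card E : k) = 0)
    (hfree : ∀ e ∈ E, ∀ y : Y, e • y = y → e = 1) {B : Set Y} (hB : IsOrbitTransversal E B)
    {m : ℕ} (hm : m + 1 = Bᶜ.ncard) : LinearMap.range (faceCoboundary E Y k m) ≠ ⊤ := by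
  classical
  intro htop
  have hexact {b : ℕ} (hb : b ≤ m) {c : faceCochains E Y k (b + 1)}
      (hc : faceCoboundary E Y k (b + 1) c = 0) :
      c ∈ LinearMap.range (faceCoboundary E Y k b) := by
    by_cases h : b = m
    · subst h
      rw [htop]
      trivial
    · exact exists_faceCoboundary_eq hfree hB (by omega) hc
  -- equivariant splittings of the differentials, constructed from the top degree downwards
  have key (d : ℕ) : ∀ b, b + d = m + 1 →
      ∃ s : faceCochains E Y k (b + 1) →ₗ[k] faceCochains E Y k b,
        (∀ e ∈ E, ∀ x, s (faceRep E Y k (b + 1) e x) = faceRep E Y k b e (s x)) ∧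
        ∀ x, faceCoboundary E Y k b (s (faceCoboundary E Y k b x)) = faceCoboundary E Y k b x := by
    induction d with
    | zero =>
      rintro b hb
      refine ⟨0, fun _ _ _ => (map_zero _).symm, fun x => ?_⟩
      rw [faceCochains_eq_zero hB (by omega) (faceCoboundary E Y k b x)]
      simp
    | succ d ih =>
      intro b hb
      obtain ⟨s, hs, hs'⟩ := ih (b + 1) (by omega)
      obtain ⟨T, hT⟩ := higmanProjective_faceRep (k := k) (Y := Y) hE b
      let π : faceCochains E Y k (b + 1) →ₗ[k] LinearMap.range (faceCoboundary E Y k b) :=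
        LinearMap.codRestrict _ (LinearMap.id - s ∘ₗ faceCoboundary E Y k (b + 1)) fun x =>
          hexact (by omega) (by
            rw [LinearMap.sub_apply, LinearMap.id_apply, map_sub, LinearMap.comp_apply, hs',
              sub_self])
      have := Module.Free.of_divisionRing k (LinearMap.range (faceCoboundary E Y k b))
      obtain ⟨u, hu⟩ := (faceCoboundary E Y k b).rangeRestrict.exists_rightInverse_of_surjective
        (LinearMap.range_rangeRestrict _)
      have hu' (x : LinearMap.range (faceCoboundary E Y k b)) : faceCoboundary E Y k b (u x) = x :=
        congrArg Subtype.val (LinearMap.congr_fun hu x)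
      refine ⟨∑ h : E, faceRep E Y k b (h : N) ∘ₗ u ∘ₗ π ∘ₗ T ∘ₗ
        faceRep E Y k (b + 1) (h : N)⁻¹, ?_, ?_⟩
      · intro e he x
        simp only [LinearMap.sum_apply, LinearMap.comp_apply, map_sum]
        refine Fintype.sum_equiv (Equiv.mulLeft (⟨e, he⟩ : E)⁻¹) _ _ fun h => ?_
        simp only [Equiv.coe_mulLeft, Subgroup.coe_mul, InvMemClass.coe_inv, mul_inv_rev, inv_inv,
          map_mul, Module.End.mul_apply]
        rw [← Module.End.mul_apply (faceRep E Y k b e), ← map_mul, mul_inv_cancel, map_one]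
        rfl
      · intro x
        have hπ (e : E) (x) : faceRep E Y k (b + 1) (e : N) (π x) =
            (π (faceRep E Y k (b + 1) (e : N) x)).1 := by
          change faceRep E Y k (b + 1) (e : N) (x - s (faceCoboundary E Y k (b + 1) x)) =
            faceRep E Y k (b + 1) (e : N) x - s (faceCoboundary E Y k (b + 1) _)
          rw [map_sub, faceCoboundary_faceRep, hs _ e.2]
        simp only [LinearMap.sum_apply, LinearMap.comp_apply, map_sum, faceCoboundary_faceRep, hu',
          hπ]
        have h2 := congrArg (fun z => (π z).1) (hT (faceCoboundary E Y k b x))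
        simp only [map_sum, AddSubmonoidClass.coe_finsetSum] at h2
        rw [h2]
        change _ - s (faceCoboundary E Y k (b + 1) _) = _
        rw [faceCoboundary_faceCoboundary, map_zero, sub_zero]
        rfl
  -- a splitting in degree zero writes the unit as a norm from the trivial representation, and
  -- such norms vanish as `p = 0` in `k`
  obtain ⟨s, hs, hs'⟩ := key (m + 1) 0 (zero_add _)
  obtain ⟨T, hT⟩ := higmanProjective_faceRep (k := k) (Y := Y) hE 0
  let y : Y := Classical.arbitrary Y
  have hinj (c : faceCochains E Y k 0) : s (faceCoboundary E Y k 0 c) = c := by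
    rw [← faceCons_faceCoboundary_zero hE hfree y (s _), hs',
      faceCons_faceCoboundary_zero hE hfree y]
  let x := faceCoboundary E Y k 0 (faceUnit : faceCochains E Y k 0)
  have hx (e : N) : faceRep E Y k 1 e x = x := by
    rw [← faceCoboundary_faceRep, faceRep_zero_apply]
  have h1 : (faceUnit : faceCochains E Y k 0) = Nat.card E • s (T x) := by
    rw [← hinj faceUnit, ← hT (faceCoboundary E Y k 0 faceUnit), map_sum]
    refine (Finset.sum_congr rfl fun h _ => ?_).trans
      ((Finset.sum_const (s (T x))).trans (by rw [Finset.card_univ, Nat.card_eq_fintype_card]))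
    change s (faceRep E Y k 1 (h : N) (T (faceRep E Y k 1 (h : N)⁻¹ x))) = _
    rw [hs _ h.2, faceRep_zero_apply, hx]
  rw [← Nat.cast_smul_eq_nsmul k, hk, zero_smul] at h1
  exact one_ne_zero (congrFun (congrArg Subtype.val h1) Fin.elim0)

/-- The fundamental functional of the sphere: its kernel consists of the coboundaries, and `N` acts
on it through a character. -/
theorem exists_fundamental_functional [Nonempty Y] (hE : (Nat.card E).Prime)
    (hk : (Nat.card E : k) = 0)
    (hfree : ∀ e ∈ E, ∀ y : Y, e • y = y → e = 1) {B : Set Y} (hB : IsOrbitTransversal E B)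
    {m : ℕ} (hm : m + 1 = Bᶜ.ncard) :
    ∃ (L : faceCochains E Y k (m + 1) →ₗ[k] k) (μ : N →* kˣ), Function.Surjective L ∧
      (∀ c, L c = 0 → c ∈ LinearMap.range (faceCoboundary E Y k m)) ∧
      (∀ a, L (faceCoboundary E Y k m a) = 0) ∧
      ∀ n c, L (faceRep E Y k (m + 1) n c) = μ n * L c := by
  obtain ⟨ℓ, hℓ⟩ := exists_linear_combination_faceCoboundary (k := k) hfree hB hm
  obtain ⟨c₀, -, hc₀⟩ := SetLike.exists_of_lt
    (lt_top_iff_ne_top.2 (range_faceCoboundary_ne_top (k := k) hE hk hfree hB hm))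
  have hℓ₀ : ℓ c₀ ≠ 0 := fun h => hc₀ ((hℓ c₀ c₀).2 h)
  set R := LinearMap.range (faceCoboundary E Y k m) with hR
  have hne : R.mkQ c₀ ≠ 0 := fun h => hc₀ ((Submodule.Quotient.mk_eq_zero R).1 h)
  obtain ⟨f, hf⟩ : ∃ f : Module.Dual k (_ ⧸ R), f (R.mkQ c₀) ≠ 0 := by
    by_contra! h
    exact hne ((Module.forall_dual_apply_eq_zero_iff k _).1 h)
  let L : faceCochains E Y k (m + 1) →ₗ[k] k := (f (R.mkQ c₀))⁻¹ • (f ∘ₗ R.mkQ)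
  have hL₀ : L c₀ = 1 := inv_mul_cancel₀ hf
  have hLR {c} (hc : c ∈ R) : L c = 0 := by
    change _ * f (R.mkQ c) = 0
    rw [show R.mkQ c = 0 from (Submodule.Quotient.mk_eq_zero R).2 hc, map_zero, mul_zero]
  have hL {c} (hc : L c = 0) : c ∈ R := by
    have h1 := (hℓ c c₀).1
    have h2 := hLR h1
    rw [map_sub, map_smul, map_smul, hc, hL₀, smul_zero, zero_sub, neg_eq_zero, smul_eq_mul,
      mul_one] at h2
    exact (hℓ c c₀).2 h2
  have hstable (n : N) {c} (hc : c ∈ R) : faceRep E Y k (m + 1) n c ∈ R := by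
    obtain ⟨a, rfl⟩ := hc
    exact ⟨faceRep E Y k m n a, faceCoboundary_faceRep n a⟩
  have hchar (n : N) (c) : L (faceRep E Y k (m + 1) n c) =
      L (faceRep E Y k (m + 1) n c₀) * L c := by
    have h1 : c - L c • c₀ ∈ R :=
      hL (by rw [map_sub, map_smul, hL₀, smul_eq_mul, mul_one, sub_self])
    have h2 := hLR (hstable n h1)
    rw [map_sub, map_sub, map_smul, map_smul, sub_eq_zero] at h2
    rw [h2, smul_eq_mul, mul_comm]
  let μ : N →* k :=
    { toFun := fun n => L (faceRep E Y k (m + 1) n c₀)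
      map_one' := by rw [map_one]; exact hL₀
      map_mul' := fun n n' => by rw [map_mul, Module.End.mul_apply, hchar] }
  refine ⟨L, μ.toHomUnits, fun r => ⟨r • c₀, by rw [map_smul, hL₀, smul_eq_mul, mul_one]⟩,
    fun c hc => hL hc, fun a => hLR ⟨a, rfl⟩, fun n c => ?_⟩
  rw [hchar]
  rfl

end SphereRep

/-! ### The periodicity class of the sphere -/

section Twist

variable {k : Type*} [Field k] {N : Type*} [Group N] {V : Type*} [AddCommGroup V] [Module k V]

/-- The twist of a representation by a character. -/
def twistRep (χ : N →* kˣ) (ρ : Representation k N V) : Representation k N V where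
  toFun n := (χ n : k) • ρ n
  map_one' := by simp
  map_mul' n n' := by
    ext v
    simp [mul_smul, smul_comm (χ n' : k)]

theorem twistRep_apply (χ : N →* kˣ) (ρ : Representation k N V) (n : N) (v : V) :
    twistRep χ ρ n v = (χ n : k) • ρ n v := rfl

/-- The one-dimensional representation given by a character. -/
def charRep (χ : N →* kˣ) : Representation k N k := twistRep χ (Representation.trivial k N k)

theorem charRep_apply (χ : N →* kˣ) (n : N) (r : k) : charRep χ n r = χ n * r := rfl

theorem HigmanProjective.twistRep [Fintype N] {ρ : Representation k N V} {H : Subgroup N}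
    (hρ : HigmanProjective ρ H) (χ : N →* kˣ) : HigmanProjective (twistRep χ ρ) H := by
  obtain ⟨T, hT⟩ := hρ
  refine ⟨T, fun v => ?_⟩
  conv_rhs => rw [← hT v]
  refine Finset.sum_congr rfl fun h _ => ?_
  rw [twistRep_apply, twistRep_apply, map_smul, map_smul, smul_smul, ← Units.val_mul, ← map_mul,
    mul_inv_cancel, map_one, Units.val_one, one_smul]

end Twist

section Periodicity

variable {N : Type*} [Group N] [Fintype N] {E : Subgroup N} [E.Normal] {Y : Type*} [MulAction N Y]
  [Finite Y] {k : Type*} [Field k] {S : Type*} [Nonempty S] [MulAction N S] {a : S → N}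

/-- Dimension shifting along the acyclic part of the cochain complex of the sphere, twisted by a
character `ψ`. Coboundaries for `E` are reflected because the terms of the complex are projective
over `E` outside the augmentation degree, while coboundaries for a subgroup `F` fixing
a vertex are preserved because the augmentation splits over `F`. -/
theorem exists_cocycle_of_range (hE : (Nat.card E).Prime)
    (hfree : ∀ e ∈ E, ∀ y : Y, e • y = y → e = 1) {B : Set Y} (hB : IsOrbitTransversal E B)
    (ha : ∀ (n : N) (s : S), a (n • s) = n * a s) (ψ : N →* kˣ) (b : ℕ) (hb : b + 1 ≤ Bᶜ.ncard) :
    ∀ (i j : ℕ), i + 1 + b = j → ∀ c : (Fin (i + 2) → S) → faceCochains E Y k (b + 1),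
      EquivariantCochain (twistRep ψ (faceRep E Y k (b + 1))) ⊤ c → coboundary k _ c = 0 →
      (∀ x, c x ∈ LinearMap.range (faceCoboundary E Y k b)) →
      ∃ f : (Fin (j + 1) → S) → k, EquivariantCochain (charRep ψ) ⊤ f ∧ coboundary k _ f = 0 ∧
        ((∃ θ : (Fin j → S) → k, EquivariantCochain (charRep ψ) E θ ∧ coboundary k _ θ = f) →
          ∃ γ : (Fin (i + 1) → S) → faceCochains E Y k b,
            EquivariantCochain (twistRep ψ (faceRep E Y k b)) E γ ∧
            coboundary k _ (fun x => faceCoboundary E Y k b (γ x)) = c) ∧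
        ∀ F : Subgroup N, (∃ y : Y, ∀ n ∈ F, n • y = y) →
          (∃ β : (Fin (i + 1) → S) → faceCochains E Y k (b + 1),
            EquivariantCochain (twistRep ψ (faceRep E Y k (b + 1))) F β ∧ coboundary k _ β = c) →
          ∃ θ : (Fin j → S) → k, EquivariantCochain (charRep ψ) F θ ∧ coboundary k _ θ = f := by
  have hcomm (b : ℕ) (n : N) (v) : faceCoboundary E Y k b (twistRep ψ (faceRep E Y k b) n v) =
      twistRep ψ (faceRep E Y k (b + 1)) n (faceCoboundary E Y k b v) := by
    rw [twistRep_apply, map_smul, faceCoboundary_faceRep]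
    rfl
  induction b with
  | zero =>
    rintro i _ rfl c hc hdc hrange
    obtain ⟨y₀⟩ : Nonempty Y := by
      by_contra h
      rw [not_nonempty_iff] at h
      have : Bᶜ = (∅ : Set Y) := Set.eq_empty_of_isEmpty _
      rw [this, Set.ncard_empty] at hb
      omega
    let ev : faceCochains E Y k 0 →ₗ[k] k :=
      { toFun := fun c => c.1 Fin.elim0
        map_add' := fun _ _ => rfl
        map_smul' := fun _ _ => rfl }
    have hev (n : N) (v) : ev (twistRep ψ (faceRep E Y k 0) n v) = charRep ψ n (ev v) := by
      rw [twistRep_apply, faceRep_zero_apply]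
      rfl
    let unit : k →ₗ[k] faceCochains E Y k 0 := LinearMap.toSpanSingleton k _ faceUnit
    have hunit (c : faceCochains E Y k 0) : unit (ev c) = c := by
      apply Subtype.ext
      funext t
      change c.1 Fin.elim0 * 1 = c.1 t
      rw [mul_one]
      exact congrArg c.1 (Subsingleton.elim _ _)
    have hunit' (n : N) (r : k) : unit (charRep ψ n r) =
        twistRep ψ (faceRep E Y k 0) n (unit r) := by
      rw [twistRep_apply, faceRep_zero_apply, charRep_apply]
      exact mul_smul _ _ _
    have hcons (c) (hc : c ∈ LinearMap.range (faceCoboundary E Y k 0)) :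
        faceCoboundary E Y k 0 (faceConsLinear 0 y₀ c) = c := by
      obtain ⟨v, rfl⟩ := hc
      exact congrArg _ (faceCons_faceCoboundary_zero hE hfree y₀ v)
    have hinj (v v' : faceCochains E Y k 0)
        (h : faceCoboundary E Y k 0 v = faceCoboundary E Y k 0 v') : v = v' := by
      rw [← faceCons_faceCoboundary_zero hE hfree y₀ v, h, faceCons_faceCoboundary_zero hE hfree]
    refine ⟨fun x => ev (faceConsLinear 0 y₀ (c x)), ?_, ?_, ?_, ?_⟩
    · intro n hn x
      change ev _ = charRep ψ n (ev _)
      rw [← hev]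
      refine congrArg ev (hinj _ _ ?_)
      rw [hcons _ (hrange _), hcomm, hcons _ (hrange _), hc n hn]
    · change coboundary k _ (fun x => (ev ∘ₗ faceConsLinear 0 y₀) (c x)) = 0
      rw [coboundary_comp_linear]
      funext x
      rw [hdc]
      exact map_zero _
    · rintro ⟨θ, hθ, hdθ⟩
      refine ⟨fun x => unit (θ x), hθ.comp fun h _ => hunit' h, ?_⟩
      change coboundary k _ (fun x => (faceCoboundary E Y k 0 ∘ₗ unit) (θ x)) = c
      rw [coboundary_comp_linear]
      funext x
      have := congrFun hdθ x
      change faceCoboundary E Y k 0 (unit (coboundary k _ θ x)) = c x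
      rw [this, hunit, hcons _ (hrange _)]
    · rintro F ⟨y, hy⟩ ⟨β, hβ, hdβ⟩
      refine ⟨fun x => (ev ∘ₗ faceConsLinear 0 y) (β x), hβ.comp fun n hn v => ?_, ?_⟩
      · rw [LinearMap.comp_apply, LinearMap.comp_apply, ← hev, twistRep_apply, twistRep_apply,
          map_smul]
        exact congrArg (fun v => ev (_ • v)) (faceCons_faceRep (hy n hn) v)
      · rw [coboundary_comp_linear, hdβ]
        funext x
        obtain ⟨v, hv⟩ := hrange x
        change ev (faceCons y (c x)) = ev (faceCons y₀ (c x))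
        rw [← hv, faceCons_faceCoboundary_zero hE hfree, faceCons_faceCoboundary_zero hE hfree]
  | succ b ih =>
    rintro i j hj c hc hdc hrange
    obtain ⟨β, hβ, hβc⟩ := hc.exists_lift (hcomm (b + 1)) ha hrange
    have hδβ : (fun x => faceCoboundary E Y k (b + 1) (β x)) = c := funext hβc
    obtain ⟨f, hf, hdf, hfE, hfF⟩ := ih (by omega) (i + 1) j (by omega) (coboundary k _ β)
      hβ.coboundary (coboundary_coboundary k β) fun x => by
        refine exists_faceCoboundary_eq hfree hB (by omega) ?_
        have h := congrFun (coboundary_comp_linear (faceCoboundary E Y k (b + 1)) β) x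
        rw [hδβ, hdc] at h
        exact h.symm
    refine ⟨f, hf, hdf, fun hθ => ?_, fun F hF _ => hfF F hF ⟨β, hβ.mono le_top, rfl⟩⟩
    obtain ⟨γ, hγ, hdγ⟩ := hfE hθ
    have h1 : EquivariantCochain (twistRep ψ (faceRep E Y k (b + 1))) E
        (β - fun x => faceCoboundary E Y k b (γ x)) :=
      (hβ.mono le_top).sub (hγ.comp fun n _ => hcomm b n)
    obtain ⟨γ', hγ', hdγ'⟩ := ((higmanProjective_faceRep hE b).twistRep ψ).exists_coboundary h1
      (by rw [map_sub, hdγ, sub_self])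
    refine ⟨γ', hγ', ?_⟩
    rw [coboundary_comp_linear, hdγ', ← hδβ]
    funext x
    change faceCoboundary E Y k (b + 1) (β x - _) = _
    rw [map_sub, faceCoboundary_faceCoboundary, sub_zero]

/-- One period of dimension shifting along the cochain complex of the sphere: a cocycle
of degree `i` is lifted along the fundamental functional to the cochains of top degree, and
`exists_cocycle_of_range` turns the coboundary of the lift into a cocycle of degree `i + m + 1`.
Here `χ` and `χ * μ` are the characters by which `N` acts on the values. For `i = 0` and trivial `χ`
the new class is nonzero on `E` as soon as `f₀ ≠ 0`, because norms from `E` vanish in `k`. -/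
theorem exists_periodicity_shift [Nonempty Y] (hE : (Nat.card E).Prime)
    (hk : (Nat.card E : k) = 0)
    (hfree : ∀ e ∈ E, ∀ y : Y, e • y = y → e = 1) {B : Set Y} (hB : IsOrbitTransversal E B)
    (ha : ∀ (n : N) (s : S), a (n • s) = n * a s) {m : ℕ} (hm : m + 1 = Bᶜ.ncard) :
    ∃ μ : N →* kˣ, ∀ (i : ℕ) (χ : N →* kˣ) (f₀ : (Fin (i + 1) → S) → k),
      EquivariantCochain (charRep χ) ⊤ f₀ → coboundary k _ f₀ = 0 →
      ∃ f : (Fin (i + (m + 1) + 1) → S) → k, EquivariantCochain (charRep (χ * μ)) ⊤ f ∧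
        coboundary k _ f = 0 ∧
        ((∃ θ, EquivariantCochain (charRep (χ * μ)) E θ ∧ coboundary k _ θ = f) →
          (i ≠ 0 → ∃ θ₀, EquivariantCochain (charRep χ) E θ₀ ∧ coboundary k _ θ₀ = f₀) ∧
          (i = 0 → χ = 1 → f₀ = 0)) ∧
        ∀ F : Subgroup N, (∃ y : Y, ∀ n ∈ F, n • y = y) →
          ∃ θ, EquivariantCochain (charRep (χ * μ)) F θ ∧ coboundary k _ θ = f := by
  classical
  obtain ⟨L, μ, hsurj, hker, hrange, hL⟩ := exists_fundamental_functional hE hk hfree hB hm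
  refine ⟨μ⁻¹, fun i χ f₀ hf₀ hdf₀ => ?_⟩
  set ψ := χ * μ⁻¹ with hψ
  have hLψ (n : N) (v) : L (twistRep ψ (faceRep E Y k (m + 1)) n v) = charRep χ n (L v) := by
    rw [twistRep_apply, map_smul, hL, charRep_apply, smul_eq_mul, ← mul_assoc, ← Units.val_mul, hψ,
      MonoidHom.mul_apply, MonoidHom.inv_apply, inv_mul_cancel_right]
  have hcomm (n : N) (v) : faceCoboundary E Y k m (twistRep ψ (faceRep E Y k m) n v) =
      twistRep ψ (faceRep E Y k (m + 1)) n (faceCoboundary E Y k m v) := by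
    rw [twistRep_apply, map_smul, faceCoboundary_faceRep]
    rfl
  obtain ⟨β, hβ, hβf⟩ := hf₀.exists_lift hLψ ha fun x => hsurj _
  have hLβ : (fun x => L (β x)) = f₀ := funext hβf
  obtain ⟨f, hf, hdf, hfE, hfF⟩ := exists_cocycle_of_range hE hfree hB ha ψ m hm.le i
    (i + (m + 1)) (by omega) (coboundary k _ β) hβ.coboundary
    (coboundary_coboundary k β) fun x => by
      refine hker _ ?_
      have h := congrFun (coboundary_comp_linear L β) x
      rw [hLβ, hdf₀] at h
      exact h.symm
  refine ⟨f, hf, hdf, fun hθ => ?_, fun F hF => hfF F hF ⟨β, hβ.mono le_top, rfl⟩⟩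
  obtain ⟨γ, hγ, hdγ⟩ := hfE hθ
  have h1 : EquivariantCochain (twistRep ψ (faceRep E Y k (m + 1))) E
      (β - fun x => faceCoboundary E Y k m (γ x)) :=
    (hβ.mono le_top).sub (hγ.comp fun n _ => hcomm n)
  have h2 : coboundary k _ (β - fun x => faceCoboundary E Y k m (γ x)) = 0 := by
    rw [map_sub, hdγ, sub_self]
  have h3 : f₀ = fun x => L ((β - fun x => faceCoboundary E Y k m (γ x)) x) := by
    rw [← hLβ]
    funext x
    rw [Pi.sub_apply, map_sub, hrange, sub_zero]
  have hproj := (higmanProjective_faceRep (k := k) (Y := Y) hE m).twistRep ψ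
  constructor
  · intro hi
    obtain ⟨i, rfl⟩ := Nat.exists_eq_succ_of_ne_zero hi
    obtain ⟨γ', hγ', hdγ'⟩ := hproj.exists_coboundary h1 h2
    refine ⟨fun x => L (γ' x), hγ'.comp fun n _ => hLψ n, ?_⟩
    rw [coboundary_comp_linear, hdγ', h3]
  · rintro rfl rfl
    obtain ⟨w, hw⟩ := hproj.exists_norm h1 h2
    rw [h3]
    funext x
    rw [hw x, map_sum]
    refine (Finset.sum_congr rfl fun h _ => ?_).trans
      ((Finset.sum_const (L w)).trans ?_)
    · rw [hLψ, charRep_apply]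
      simp
    · rw [Finset.card_univ, ← Nat.card_eq_fintype_card, ← Nat.cast_smul_eq_nsmul k, hk, zero_smul]
      rfl

/-- If `N` acts on `Y` in such a way that a normal subgroup `E` of prime order `p` acts freely, then
there are cohomology classes of `N` in characteristic `p` of arbitrarily large degree that restrict
to nonzero classes of `E` and to zero on every subgroup fixing a point of `Y`. -/
theorem exists_cocycle_restrict_ne_zero [Nonempty Y] (hE : (Nat.card E).Prime)
    (hk : (Nat.card E : k) = 0) (hfree : ∀ e ∈ E, ∀ y : Y, e • y = y → e = 1)
    (ha : ∀ (n : N) (s : S), a (n • s) = n * a s) (d : ℕ) :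
    ∃ i, d ≤ i ∧ ∃ f : (Fin (i + 1) → S) → k,
      EquivariantCochain (Representation.trivial k N k) ⊤ f ∧ coboundary k _ f = 0 ∧
      (¬ ∃ θ, EquivariantCochain (Representation.trivial k N k) E θ ∧ coboundary k _ θ = f) ∧
      ∀ F : Subgroup N, (∃ y : Y, ∀ n ∈ F, n • y = y) →
        ∃ θ, EquivariantCochain (Representation.trivial k N k) F θ ∧ coboundary k _ θ = f := by
  obtain ⟨B, hB⟩ := exists_isOrbitTransversal E Y
  obtain ⟨m, hm⟩ : ∃ m, m + 1 = Bᶜ.ncard := by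
    refine Nat.exists_eq_succ_of_ne_zero ?_ |>.imp fun m hm => hm.symm
    refine ((Set.ncard_pos (Set.toFinite _)).2 ?_).ne'
    obtain ⟨e, he, hne⟩ := exists_mem_ne_one hE
    obtain ⟨-, -, y, hy, -⟩ := hB.exists_smul (Classical.arbitrary Y)
    exact ⟨e • y, fun h => hne (hfree e he y (hB.eq_of_smul y hy _ h e he rfl).symm)⟩
  obtain ⟨μ, hμ⟩ := exists_periodicity_shift (k := k) hE hk hfree hB ha hm
  have key (J : ℕ) : ∃ χ : N →* kˣ, (∀ n, χ n = μ n ^ (J + 1)) ∧ ∃ i, J < i ∧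
      ∃ f : (Fin (i + 1) → S) → k,
      EquivariantCochain (charRep χ) ⊤ f ∧ coboundary k _ f = 0 ∧
      (¬ ∃ θ, EquivariantCochain (charRep χ) E θ ∧ coboundary k _ θ = f) ∧
      ∀ F : Subgroup N, (∃ y : Y, ∀ n ∈ F, n • y = y) →
        ∃ θ, EquivariantCochain (charRep χ) F θ ∧ coboundary k _ θ = f := by
    induction J with
    | zero =>
      obtain ⟨f, hf, hdf, hfE, hfF⟩ := hμ 0 1 (fun _ => 1) (fun n _ x => by simp [charRep_apply])
        (by
          funext x
          simp [coboundary_apply, Fin.sum_univ_two])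
      exact ⟨1 * μ, by simp, _, by omega, f, hf, hdf, fun h =>
        one_ne_zero (congrFun ((hfE h).2 rfl rfl) fun _ => Classical.arbitrary S), hfF⟩
    | succ J ih =>
      obtain ⟨χ, hχ, i, hi, f₀, hf₀, hdf₀, hE₀, -⟩ := ih
      obtain ⟨f, hf, hdf, hfE, hfF⟩ := hμ i χ f₀ hf₀ hdf₀
      exact ⟨χ * μ, fun n => by rw [MonoidHom.mul_apply, hχ, pow_succ (μ n) (J + 1)],
        _, by omega, f, hf, hdf, fun h => hE₀ ((hfE h).1 (by omega)), hfF⟩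
  -- a number of periods divisible by the order of `N` makes the character trivial
  obtain ⟨χ, hχ, i, hi, f, hf⟩ := key (Fintype.card N * (d + 1) - 1)
  have hpos : 0 < Fintype.card N := Fintype.card_pos
  have hle : d + 1 ≤ Fintype.card N * (d + 1) := Nat.le_mul_of_pos_left _ hpos
  have hχ₁ (n : N) : χ n = 1 := by
    rw [hχ, Nat.sub_add_cancel (by omega), pow_mul, ← map_pow, pow_card_eq_one, map_one, one_pow]
  have hrep : charRep χ = Representation.trivial k N k := by
    ext n
    simp [charRep_apply, hχ₁]
  rw [hrep] at hf
  exact ⟨i, by omega, f, hf⟩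

end Periodicity

/-! ### Cohomology of a finite group in arbitrarily large degrees -/

section Transfer

/-- A group is a free set over each of its subgroups, so that its tuples compute the cohomology of
the subgroup as well. -/
theorem exists_equivariant_map_subgroup {G : Type*} [Group G] (N : Subgroup G) :
    ∃ a : G → N, ∀ (n : N) (g : G), a (n • g) = n * a g := by
  let r : G → G := fun g => (Quotient.mk (MulAction.orbitRel N G) g).out
  have hr (n : N) (g : G) : r (n • g) = r g :=
    congrArg Quotient.out (Quotient.sound (MulAction.orbitRel_apply.2 ⟨n, rfl⟩))
  have hmem (g : G) : g * (r g)⁻¹ ∈ N := by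
    obtain ⟨n, hn⟩ : ∃ n : N, n • g = r g :=
      MulAction.orbitRel_apply.1 (Quotient.mk_out (s := MulAction.orbitRel N G) g)
    rw [← hn, Subgroup.smul_def, smul_eq_mul, mul_inv_rev, mul_inv_cancel_left]
    exact N.inv_mem n.2
  refine ⟨fun g => ⟨g * (r g)⁻¹, hmem g⟩, fun n g => Subtype.ext ?_⟩
  change n • g * (r (n • g))⁻¹ = n * (g * (r g)⁻¹)
  rw [hr, Subgroup.smul_def, smul_eq_mul, mul_assoc]

variable {k : Type*} [Field k]

/-- A finite group has cohomology classes with trivial coefficients in arbitrarily large degrees,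
in a characteristic `p` dividing its order. The class is the transfer of a class of the
normalizer `N` of a subgroup `E₀` of order `p` that restricts to zero on the subgroups of `N` of
order `p` other than `E₀`; by the double coset formula the restriction of the transfer to `E₀` is
the restriction of that class. -/
theorem exists_invariant_cocycle {G : Type*} [Group G] [Finite G] (p : ℕ) [hp : Fact p.Prime]
    [CharP k p] (hG : p ∣ Nat.card G) (d : ℕ) :
    ∃ i, d ≤ i ∧ ∃ f : (Fin (i + 1) → G) → k, (∀ (g : G) x, f (g • x) = f x) ∧
      coboundary k _ f = 0 ∧
      ¬ ∃ θ : (Fin i → G) → k, (∀ (g : G) x, θ (g • x) = θ x) ∧ coboundary k _ θ = f := by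
  classical
  have := Fintype.ofFinite G
  obtain ⟨z, hz⟩ := exists_prime_orderOf_dvd_card' p hG
  let E₀ : Subgroup G := Subgroup.zpowers z
  have hcard₀ : Nat.card E₀ = p := by rw [Nat.card_zpowers, hz]
  let N : Subgroup G := Subgroup.normalizer (E₀ : Set G)
  have hEN : E₀ ≤ N := Subgroup.le_normalizer
  let E : Subgroup N := E₀.subgroupOf N
  have hnormal : E.Normal := Subgroup.normal_in_normalizer
  have hcard : Nat.card E = p := by
    rw [← hcard₀]
    exact Nat.card_congr (Subgroup.subgroupOfEquivOfLe hEN).toEquiv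
  have hE : (Nat.card E).Prime := hcard ▸ hp.out
  have hE₀ : (Nat.card E₀).Prime := hcard₀ ▸ hp.out
  have hk : (Nat.card E : k) = 0 := by rw [hcard, CharP.cast_eq_zero]
  -- the cosets of the subgroups that meet `E` trivially: `E` acts freely, and each such subgroup
  -- fixes a point
  let Y := Σ F : {F : Subgroup N // F ⊓ E = ⊥}, N ⧸ F.1
  have hfree : ∀ e ∈ E, ∀ y : Y, e • y = y → e = 1 := by
    rintro e he ⟨F, y⟩ h
    obtain ⟨n, rfl⟩ := QuotientGroup.mk_surjective y
    have h2 : ((e * n : N) : N ⧸ F.1) = n := eq_of_heq (Sigma.mk.inj_iff.1 h).2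
    rw [eq_comm, QuotientGroup.eq] at h2
    have h3 : n⁻¹ * (e * n) ∈ F.1 ⊓ E :=
      ⟨h2, by simpa [mul_assoc] using hnormal.conj_mem e he n⁻¹⟩
    rw [F.2, Subgroup.mem_bot] at h3
    rwa [inv_mul_eq_one, eq_comm, mul_eq_right] at h3
  have : Nonempty Y := ⟨⟨⟨⊥, bot_inf_eq _⟩, ((1 : N) : N ⧸ (⊥ : Subgroup N))⟩⟩
  obtain ⟨a, ha⟩ := exists_equivariant_map_subgroup N
  obtain ⟨i, hi, φ, hφ, hdφ, hφE, hφF⟩ :=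
    exists_cocycle_restrict_ne_zero (S := G) (Y := Y) hE hk hfree ha d
  refine ⟨i, hi, ?_⟩
  have hφ' {n : G} (hn : n ∈ N) (x : Fin (i + 1) → G) : φ (n • x) = φ x :=
    hφ ⟨n, hn⟩ (Subgroup.mem_top _) x
  -- the conjugates of `φ`
  let Φ : G ⧸ N → (Fin (i + 1) → G) → k := fun q x => φ (q.out⁻¹ • x)
  have hΦmk (g : G) (x) : Φ g x = φ (g⁻¹ • x) := by
    have h1 : (g : G ⧸ N).out⁻¹ * g ∈ N := QuotientGroup.eq.1 (QuotientGroup.out_eq' _)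
    change φ _ = _
    rw [← hφ' h1 (g⁻¹ • x), smul_smul, mul_inv_cancel_right]
  have hΦsmul (g : G) (q : G ⧸ N) (x) : Φ (g • q) (g • x) = Φ q x := by
    obtain ⟨g', rfl⟩ := QuotientGroup.mk_surjective q
    change Φ ((g * g' : G) : G ⧸ N) _ = _
    rw [hΦmk, hΦmk, smul_smul, mul_inv_rev, inv_mul_cancel_right]
  have hΦsum (A : Finset (G ⧸ N)) (x) : (∑ q ∈ A, Φ q) x = ∑ q ∈ A, Φ q x := Finset.sum_apply _ _ _
  refine ⟨∑ q, Φ q, fun g x => ?_, ?_, ?_⟩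
  · rw [hΦsum, hΦsum]
    refine (Fintype.sum_equiv (MulAction.toPerm g) _ _ fun q => ?_).symm
    exact (hΦsmul g q x).symm
  · rw [map_sum]
    refine Finset.sum_eq_zero fun q _ => ?_
    funext x
    change coboundary k _ (fun x => φ (q.out⁻¹ • x)) x = 0
    rw [coboundary_comp_smul, hdφ]
    rfl
  rintro ⟨θ, hθ, hdθ⟩
  -- cosets fixed by `E₀`, other than the trivial one
  have hfix (q : G ⧸ N) (hq : q ≠ (1 : G)) (hqE : ∀ e ∈ E₀, e • q = q) :
      ∃ η : (Fin i → G) → k, (∀ e ∈ E₀, ∀ x, η (e • x) = η x) ∧ coboundary k _ η = Φ q := by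
    obtain ⟨g, rfl⟩ := QuotientGroup.mk_surjective q
    have hgN : g ∉ N := fun h => hq (by
      rw [QuotientGroup.eq, mul_one]
      exact N.inv_mem h)
    -- `F` is the intersection of `N` with the conjugate `g⁻¹ E₀ g`; it meets `E₀` trivially since
    -- `g` does not normalize `E₀`.
    let F : Subgroup N := E₀.comap ((MulAut.conj g).toMonoidHom.comp N.subtype)
    have hFmem (n : N) : n ∈ F ↔ g * n * g⁻¹ ∈ E₀ := Iff.rfl
    have hF : F ⊓ E = ⊥ := by
      rw [eq_bot_iff]
      rintro n ⟨hn, hnE⟩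
      rw [Subgroup.mem_bot]
      by_contra hne
      refine hgN (Subgroup.mem_normalizer_iff.2 fun h => ?_)
      have : Fact (Nat.card E₀).Prime := ⟨hE₀⟩
      have hnE₀ : (n : G) ∈ E₀ := hnE
      have hsub : ∀ x ∈ E₀, g * x * g⁻¹ ∈ E₀ := by
        intro x hx
        have h1 : (⟨x, hx⟩ : E₀) ∈ Subgroup.zpowers (⟨n, hnE₀⟩ : E₀) :=
          mem_zpowers_of_prime_card rfl fun h =>
            hne (Subtype.ext (congrArg (fun x : E₀ => (x : G)) h))
        obtain ⟨m, hm⟩ := h1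
        have hm' : (n : G) ^ m = x := congrArg Subtype.val hm
        rw [← hm', ← conj_zpow]
        exact E₀.zpow_mem ((hFmem n).1 hn) m
      refine ⟨hsub h, fun hh => ?_⟩
      have hmap : E₀.map (MulAut.conj g).toMonoidHom = E₀ := by
        refine Subgroup.eq_of_le_of_card_ge ?_ ?_
        · rintro _ ⟨x, hx, rfl⟩
          exact hsub x hx
        · exact (Nat.card_congr
            (E₀.equivMapOfInjective _ (MulAut.conj g).injective).toEquiv).le
      rw [← hmap] at hh
      obtain ⟨x, hx, hxh⟩ := hh
      have : x = h := (MulAut.conj g).injective hxh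
      rwa [← this]
    obtain ⟨η, hη, hdη⟩ := hφF F ⟨⟨⟨F, hF⟩, ((1 : N) : N ⧸ F)⟩, fun n hn => by
      refine Sigma.ext rfl (heq_of_eq ?_)
      change ((n * 1 : N) : N ⧸ F) = (1 : N)
      rw [QuotientGroup.eq, mul_one, mul_one]
      exact F.inv_mem hn⟩
    refine ⟨fun x => η (g⁻¹ • x), fun e he x => ?_, ?_⟩
    · have h1 : g⁻¹ * e * g ∈ N := by
        have h2 : ((e * g : G) : G ⧸ N) = g := hqE e he
        rw [eq_comm, QuotientGroup.eq] at h2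
        rwa [mul_assoc]
      have h3 := hη ⟨g⁻¹ * e * g, h1⟩ (by
        rw [hFmem]
        simpa [mul_assoc] using he) (g⁻¹ • x)
      change η ((g⁻¹ * e * g) • g⁻¹ • x) = η (g⁻¹ • x) at h3
      rw [smul_smul, mul_inv_cancel_right] at h3
      beta_reduce
      rw [smul_smul, h3]
    · funext x
      rw [coboundary_comp_smul, hdη, hΦmk]
  -- cosets permuted freely by `E₀`
  let D : Finset (G ⧸ N) := Finset.univ.filter fun q => ∃ e ∈ E₀, e • q ≠ q
  have hD {q : G ⧸ N} : q ∈ D ↔ ∃ e ∈ E₀, e • q ≠ q := by simp [D]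
  have hDsmul {e : G} (he : e ∈ E₀) {q : G ⧸ N} (hq : q ∈ D) : e • q ∈ D := by
    rw [hD] at hq ⊢
    obtain ⟨e', he', hne⟩ := hq
    refine ⟨e * e' * e⁻¹, E₀.mul_mem (E₀.mul_mem he he') (E₀.inv_mem he), fun h => hne ?_⟩
    rw [mul_smul, inv_smul_smul, mul_smul] at h
    exact smul_left_cancel e h
  have hfreeD : ∃ η : (Fin i → G) → k, (∀ e ∈ E₀, ∀ x, η (e • x) = η x) ∧
      coboundary k _ η = ∑ q ∈ D, Φ q := by
    obtain ⟨w, hw⟩ := exists_weight_of_finite_group k E₀ (G ⧸ N)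
    let ψ : (Fin i → G) → k := fun x => φ (Fin.cons 1 x : Fin (i + 1) → G)
    have hψ : coboundary k _ ψ = φ := coboundary_cons_of_cocycle k hdφ 1
    refine ⟨∑ e : E₀, ∑ q ∈ D, w q • fun x => ψ ((q.out⁻¹ * (e : G)⁻¹) • x), fun e he x => ?_, ?_⟩
    · simp only [Finset.sum_apply, Pi.smul_apply]
      refine Fintype.sum_equiv (Equiv.mulLeft (⟨e, he⟩ : E₀)⁻¹) _ _ fun e' => ?_
      refine Finset.sum_congr rfl fun q _ => ?_
      simp [smul_smul, mul_assoc]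
    · funext x
      have hterm (e : E₀) (q : G ⧸ N) :
          coboundary k i (fun x => ψ ((q.out⁻¹ * (e : G)⁻¹) • x)) x = Φ (e • q) x := by
        rw [coboundary_comp_smul, hψ, mul_smul]
        exact ((hΦsmul (e : G) q ((e : G)⁻¹ • x)).symm.trans (by rw [smul_inv_smul]; rfl))
      simp only [map_sum, map_smul, Finset.sum_apply, Pi.smul_apply, hterm, smul_eq_mul]
      have hreindex (e : E₀) : ∑ q ∈ D, w q * Φ (e • q) x = ∑ q ∈ D, w (e⁻¹ • q) * Φ q x := by
        refine Finset.sum_bij' (fun q _ => e • q) (fun q _ => e⁻¹ • q) (fun q hq => hDsmul e.2 hq)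
          (fun q hq => hDsmul (E₀.inv_mem e.2) hq) ?_ ?_ ?_
        · intro q _
          exact inv_smul_smul e q
        · intro q _
          exact smul_inv_smul e q
        · intro q _
          rw [inv_smul_smul]
      rw [Finset.sum_congr rfl fun e _ => hreindex e, Finset.sum_comm]
      refine Finset.sum_congr rfl fun q hq => ?_
      rw [← Finset.sum_mul, hw q, one_mul]
      intro e he
      by_contra hne
      obtain ⟨e', he', h⟩ := hD.1 hq
      refine h (smul_mem_of_prime_card (A := {q}) hE₀ e.2 (fun h => hne (Subtype.ext h)) ?_ rfl he')
      rintro _ rfl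
      exact he
  -- the remaining summand is `φ`
  obtain ⟨ηD, hηD, hdηD⟩ := hfreeD
  let D' : Finset (G ⧸ N) := (Finset.univ \ D).erase ((1 : G) : G ⧸ N)
  have hD' : ∃ η : (Fin i → G) → k, (∀ e ∈ E₀, ∀ x, η (e • x) = η x) ∧
      coboundary k _ η = ∑ q ∈ D', Φ q := by
    have hmem (q : D') : ∃ η : (Fin i → G) → k, (∀ e ∈ E₀, ∀ x, η (e • x) = η x) ∧
        coboundary k _ η = Φ q := by
      have h := Finset.mem_erase.1 q.2
      refine hfix q h.1 ?_
      by_contra! h'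
      exact (Finset.mem_sdiff.1 h.2).2 (hD.2 h')
    choose η hη hdη using hmem
    refine ⟨∑ q, η q, fun e he x => ?_, ?_⟩
    · simp only [Finset.sum_apply, hη _ e he]
    · rw [map_sum, ← Finset.sum_coe_sort D']
      exact Finset.sum_congr rfl fun q _ => hdη q
  obtain ⟨η, hη, hdη⟩ := hD'
  have h1D : ((1 : G) : G ⧸ N) ∈ Finset.univ \ D := by
    rw [Finset.mem_sdiff, hD]
    refine ⟨Finset.mem_univ _, ?_⟩
    rintro ⟨e, he, hne⟩
    refine hne ?_
    change ((e * 1 : G) : G ⧸ N) = (1 : G)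
    rw [QuotientGroup.eq, mul_one, mul_one]
    exact N.inv_mem (hEN he)
  have hφ₁ : Φ ((1 : G) : G ⧸ N) = φ := by
    funext x
    rw [hΦmk, inv_one, one_smul]
  refine hφE ⟨θ - ηD - η, fun e he x => ?_, ?_⟩
  · have he' : (e : G) ∈ E₀ := he
    change θ ((e : G) • x) - ηD ((e : G) • x) - η ((e : G) • x) = θ x - ηD x - η x
    rw [hθ, hηD _ he', hη _ he']
  · rw [map_sub, map_sub, hdθ, hdηD, hdη, ← Finset.sum_sdiff (Finset.subset_univ D),
      ← Finset.add_sum_erase _ _ h1D, hφ₁]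
    abel

end Transfer

/-! ### Comparison of cochains with `Ext` for a finite group -/

section RepModule

variable {k : Type*} [Field k] {B : Type*} [Semiring B] [Algebra k B] {V : Type*} [AddCommGroup V]
  [Module k V]

/-- The `B`-module given by a representation of a `k`-algebra `B` on a vector space. -/
def RepModule (_ : B →ₐ[k] Module.End k V) : Type _ := V

instance (ρ : B →ₐ[k] Module.End k V) : AddCommGroup (RepModule ρ) :=
  inferInstanceAs (AddCommGroup V)

instance (ρ : B →ₐ[k] Module.End k V) : Module k (RepModule ρ) :=
  inferInstanceAs (Module k V)

instance (ρ : B →ₐ[k] Module.End k V) : Module B (RepModule ρ) :=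
  Module.compHom V ρ.toRingHom

theorem RepModule.smul_def (ρ : B →ₐ[k] Module.End k V) (b : B) (v : RepModule ρ) :
    b • v = ρ b v := rfl

theorem RepModule.algebraMap_smul (ρ : B →ₐ[k] Module.End k V) (r : k) (v : RepModule ρ) :
    algebraMap k B r • v = r • v := by
  rw [RepModule.smul_def, AlgHom.commutes]
  rfl

end RepModule

namespace CategoryAlgebra

variable {k : Type u} [Field k] {G : Type} [Group G]

/-- A representation of a group `G` as a representation of the category algebra of `G`. -/
def ofRepresentation {V : Type*} [AddCommGroup V] [Module k V] (ρ : Representation k G V) :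
    CategoryAlgebra k (SingleObj G) →ₐ[k] Module.End k V :=
  AlgHom.ofLinearMap (lift k (fun _ _ g => ρ g))
    (by
      rw [one_eq, map_sum, Fintype.sum_unique, lift_of]
      exact map_one ρ)
    (algHom_ext_mul _ (by
      intro X Y Z W g f
      obtain rfl : Y = Z := Subsingleton.elim (α := Unit) _ _
      rw [of_mul_of, lift_of, lift_of, lift_of]
      exact map_mul ρ g f))

theorem ofRepresentation_of {V : Type*} [AddCommGroup V] [Module k V] (ρ : Representation k G V)
    {X Y : SingleObj G} (g : X ⟶ Y) : ofRepresentation ρ (of k g) = ρ g := by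
  change lift k (C := SingleObj G) (fun _ _ g => ρ g) (of k g) = _
  rw [lift_of]

variable (k G)

/-- The action of `G` on functions on tuples of elements of `G`. -/
def tupleRep (i : ℕ) : Representation k G ((Fin i → G) → k) where
  toFun g :=
    { toFun := fun c x => c (g⁻¹ • x)
      map_add' := fun _ _ => rfl
      map_smul' := fun _ _ => rfl }
  map_one' := by
    ext c x
    simp
  map_mul' g h := by
    ext c x
    simp [mul_smul]

/-- Functions on tuples of elements of `G` as a module over the category algebra of `G`. -/
abbrev TupleModule (i : ℕ) : Type u := RepModule (ofRepresentation (tupleRep k G i))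

variable {k G}

theorem of_smul_tupleModule {i : ℕ} {X Y : SingleObj G} (g : X ⟶ Y) (c : TupleModule k G i) :
    of k g • c = tupleRep k G i (show G from g) c := by
  rw [RepModule.smul_def, ofRepresentation_of]

variable (k G) in
/-- The coboundary as a map of modules over the category algebra. -/
def tupleCoboundary (i : ℕ) :
    TupleModule k G i →ₗ[CategoryAlgebra k (SingleObj G)] TupleModule k G (i + 1) :=
  linearMapMk (AddMonoidHomClass.toAddMonoidHom (coboundary k i))
    (fun r m => by
      rw [RepModule.algebraMap_smul, RepModule.algebraMap_smul]
      exact map_smul (coboundary k i) r m)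
    (fun X Y g m => by
      rw [of_smul_tupleModule, of_smul_tupleModule]
      rfl)

/-- Functions on tuples of positive length form an injective module: `G` acts freely on these
tuples, so that linear extensions can be averaged with a weight of total mass one on each orbit. -/
theorem injective_tupleModule [Finite G] (i : ℕ) :
    Injective (ModuleCat.of (CategoryAlgebra k (SingleObj G)) (TupleModule k G (i + 1))) := by
  have := Fintype.ofFinite G
  refine ⟨fun {X Y} g f hf => ?_⟩
  have hg (s : k) (x : X) : g.hom (algebraMap k (CategoryAlgebra k (SingleObj G)) s • x) =
      s • (show (Fin (i + 1) → G) → k from g.hom x) := by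
    rw [map_smul]
    exact RepModule.algebraMap_smul (V := (Fin (i + 1) → G) → k) _ s _
  let _ (Z : ModuleCat.{u} (CategoryAlgebra k (SingleObj G))) : Module k Z :=
    Module.compHom Z (algebraMap k (CategoryAlgebra k (SingleObj G)))
  have hsmul (Z : ModuleCat.{u} (CategoryAlgebra k (SingleObj G))) (r : k) (z : Z) :
    r • z = algebraMap k (CategoryAlgebra k (SingleObj G)) r • z := rfl
  let f' : X →ₗ[k] Y := { f.hom with map_smul' := fun r x => map_smul f.hom _ x }
  let g' : X →ₗ[k] ((Fin (i + 1) → G) → k) :=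
    { toFun := g.hom
      map_add' := map_add g.hom
      map_smul' := hg }
  obtain ⟨r, hr⟩ := f'.exists_leftInverse_of_injective
    (LinearMap.ker_eq_bot.2 ((ModuleCat.mono_iff_injective f).1 hf))
  obtain ⟨w, hw⟩ := exists_weight_of_finite_group k G (Fin (i + 1) → G)
  let star : SingleObj G := SingleObj.star G
  let o (g : G) : CategoryAlgebra k (SingleObj G) := of k (X := star) (Y := star) g
  have ho (g h : G) : o g * o h = o (g * h) := of_mul_of _ _
  have hok (g : G) (Z : ModuleCat.{u} (CategoryAlgebra k (SingleObj G))) (s : k) (z : Z) :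
      o g • s • z = s • o g • z := by
    rw [hsmul, hsmul, ← mul_smul, ← mul_smul, Algebra.commutes]
  let T (a : G) : Y →ₗ[k] ((Fin (i + 1) → G) → k) :=
    { toFun := fun y x => w (a⁻¹ • x) * g' (r (o a⁻¹ • y)) (a⁻¹ • x)
      map_add' := fun y y' => by
        funext x
        simp [smul_add, mul_add]
      map_smul' := fun s y => by
        funext x
        rw [hok, map_smul, map_smul]
        exact mul_left_comm _ _ _ }
  have hT : ∀ (b : G) (y : Y), (∑ a, T a) (o b • y) = tupleRep k G (i + 1) b ((∑ a, T a) y) := by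
    intro b y
    funext x
    rw [LinearMap.sum_apply, Finset.sum_apply]
    change _ = (∑ a, T a) y (b⁻¹ • x)
    rw [LinearMap.sum_apply, Finset.sum_apply]
    refine Fintype.sum_equiv (Equiv.mulLeft b⁻¹) _ _ fun a => ?_
    change w (a⁻¹ • x) * g' (r (o a⁻¹ • o b • y)) (a⁻¹ • x) =
      w ((b⁻¹ * a)⁻¹ • b⁻¹ • x) * g' (r (o (b⁻¹ * a)⁻¹ • y)) ((b⁻¹ * a)⁻¹ • b⁻¹ • x)
    rw [← mul_smul (o a⁻¹), ho, smul_smul, mul_inv_rev, inv_inv, mul_inv_cancel_right]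
  refine ⟨ModuleCat.ofHom (linearMapMk (AddMonoidHomClass.toAddMonoidHom (∑ a, T a)) ?_ ?_), ?_⟩
  · intro s y
    rw [RepModule.algebraMap_smul]
    exact map_smul (∑ a, T a) s y
  · intro A B b y
    rw [of_smul_tupleModule]
    exact hT b y
  · apply ModuleCat.hom_ext
    apply LinearMap.ext
    intro z
    change (∑ a, T a) (f.hom z) = g.hom z
    funext x
    rw [LinearMap.sum_apply, Finset.sum_apply]
    have hterm (a : G) : T a (f.hom z) x = w (a⁻¹ • x) * g' z x := by
      change w (a⁻¹ • x) * g' (r (o a⁻¹ • f.hom z)) (a⁻¹ • x) = _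
      rw [← map_smul f.hom]
      have h1 : r (f.hom (o a⁻¹ • z)) = o a⁻¹ • z := LinearMap.congr_fun hr _
      rw [h1]
      have h2 : g' (o a⁻¹ • z) = tupleRep k G (i + 1) a⁻¹ (g' z) :=
        (map_smul g.hom _ z).trans (of_smul_tupleModule _ _)
      rw [h2]
      change _ * g' z ((a⁻¹)⁻¹ • a⁻¹ • x) = _
      rw [inv_smul_smul]
    rw [Finset.sum_congr rfl fun a _ => hterm a, ← Finset.sum_mul, hw, one_mul]
    · rfl
    · intro a ha
      have := congrFun ha 0
      rwa [Pi.smul_apply, smul_eq_mul, mul_eq_right] at this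

variable (k G) in
/-- The module of cocycles on tuples of elements of `G`. -/
abbrev tupleCocycles (i : ℕ) : ModuleCat.{u} (CategoryAlgebra k (SingleObj G)) :=
  ModuleCat.of _ (LinearMap.ker (tupleCoboundary k G i))

variable (k G) in
/-- The coboundary, as a map onto the module of cocycles. -/
def tupleCoboundaryToCocycles (i : ℕ) :
    TupleModule k G i →ₗ[CategoryAlgebra k (SingleObj G)] tupleCocycles k G (i + 1) :=
  (tupleCoboundary k G i).codRestrict _ fun c => coboundary_coboundary k c

theorem tupleCoboundaryToCocycles_surjective (i : ℕ) :
    Function.Surjective (tupleCoboundaryToCocycles k G i) :=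
  fun c => ⟨_, Subtype.ext (coboundary_cons_of_cocycle k c.2 1)⟩

variable (k G) in
/-- The cocycles, the cochains and the cocycles of the next degree. -/
def tupleSequence (i : ℕ) : ShortComplex (ModuleCat.{u} (CategoryAlgebra k (SingleObj G))) :=
  ShortComplex.mk (X₁ := tupleCocycles k G i) (X₂ := ModuleCat.of _ (TupleModule k G i))
    (X₃ := tupleCocycles k G (i + 1))
    (ModuleCat.ofHom (LinearMap.ker (tupleCoboundary k G i)).subtype)
    (ModuleCat.ofHom (tupleCoboundaryToCocycles k G i))
    (ModuleCat.hom_ext (LinearMap.ext fun c => Subtype.ext c.2))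

theorem tupleSequence_shortExact (i : ℕ) : (tupleSequence k G i).ShortExact :=
  ModuleCat.shortComplex_shortExact _
    (fun c => ⟨fun h => ⟨⟨c, congrArg Subtype.val h⟩, rfl⟩,
      fun ⟨b, hb⟩ => hb ▸ Subtype.ext b.2⟩)
    Subtype.val_injective (tupleCoboundaryToCocycles_surjective i)

/-- Dimension shifting along the sequences of cocycles and cochains. -/
theorem subsingleton_ext_one_tupleCocycles [Finite G]
    (X : ModuleCat.{u} (CategoryAlgebra k (SingleObj G))) (m i : ℕ)
    (h : Subsingleton (Abelian.Ext.{u} X (tupleCocycles k G (i + 1)) (m + 1))) :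
    Subsingleton (Abelian.Ext.{u} X (tupleCocycles k G (m + i + 1)) 1) := by
  induction m generalizing i with
  | zero => rwa [Nat.zero_add]
  | succ m ih =>
    rw [Nat.add_right_comm m 1 i]
    refine ih (i + 1) (subsingleton_of_forall_eq 0 fun x => ?_)
    obtain ⟨y, rfl⟩ := Abelian.Ext.covariant_sequence_exact₃ X
      (tupleSequence_shortExact (k := k) (G := G) (i + 1)) x rfl (Subsingleton.elim (h := h) _ _)
    have := injective_tupleModule (k := k) (G := G) i
    have hy : y = 0 :=
      Abelian.Ext.eq_zero_of_injective (I := ModuleCat.of _ (TupleModule k G (i + 1))) y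
    rw [hy, Abelian.Ext.zero_comp]
    rfl

/-- The component at an object of an element of the constant module. -/
def constProj {C : Type} [SmallCategory C] [Fintype C] (X : C) : constModule k C →+ k :=
  ModuleOfFunctor.proj X

theorem constProj_algebraMap_smul {C : Type} [SmallCategory C] [Fintype C] (X : C) (r : k)
    (v : constModule k C) :
    constProj X (algebraMap k (CategoryAlgebra k C) r • v) = r * constProj X v :=
  proj_algebraMap_smul _ r v X

theorem constProj_of_smul {C : Type} [SmallCategory C] [Fintype C] {X Y : C} (f : X ⟶ Y)
    (v : constModule k C) : constProj Y (of k f • v) = constProj X v :=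
  proj_of_smul_same _ f v

/-- The trivial module consists of the cocycles on single elements of `G`. -/
def constModuleIsoCocycles : constModule k (SingleObj G) ≅ tupleCocycles k G 1 :=
  LinearEquiv.toModuleIso (LinearEquiv.ofBijective
    ((tupleCoboundaryToCocycles k G 0) ∘ₗ
      (linearMapMk
        { toFun := fun v _ => constProj (SingleObj.star G) v
          map_zero' := rfl
          map_add' := fun _ _ => rfl }
        (fun r m => by
          rw [RepModule.algebraMap_smul]
          funext x
          exact constProj_algebraMap_smul _ r m)
        (fun X Y g m => by
          rw [of_smul_tupleModule]
          funext x
          exact constProj_of_smul g m) :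
        constModule k (SingleObj G) →ₗ[CategoryAlgebra k (SingleObj G)] TupleModule k G 0))
    ⟨fun v w h => by
      have h1 := congrFun (congrArg Subtype.val h) (fun _ => 1)
      have h2 : constProj (SingleObj.star G) v =
          constProj (SingleObj.star G) w := by
        exact (coboundary_zero_apply k _ _).symm.trans (h1.trans (coboundary_zero_apply k _ _))
      exact ModuleOfFunctor.ext fun _ => h2,
    fun c => by
      obtain ⟨b, rfl⟩ := tupleCoboundaryToCocycles_surjective 0 c
      refine ⟨fun _ => b Fin.elim0, congrArg (tupleCoboundaryToCocycles k G 0) ?_⟩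
      funext x
      exact congrArg b (Subsingleton.elim _ _)⟩)

/-- If a cohomology group of a finite group vanishes, invariant cocycles of this degree are
coboundaries of invariant cochains. -/
theorem exists_invariant_coboundary [Finite G] (i : ℕ)
    (h : Subsingleton (Cohomology k (SingleObj G) (i + 1))) (f : (Fin (i + 2) → G) → k)
    (hf : ∀ (g : G) x, f (g • x) = f x) (hd : coboundary k _ f = 0) :
    ∃ θ : (Fin (i + 1) → G) → k, (∀ (g : G) x, θ (g • x) = θ x) ∧ coboundary k _ θ = f := by
  let K := constModule k (SingleObj G)
  have h1 : Subsingleton (Abelian.Ext.{u} K (tupleCocycles k G 1) (i + 1)) := by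
    refine subsingleton_of_forall_eq 0 fun x => ?_
    have hx : x.comp (Abelian.Ext.mk₀ constModuleIsoCocycles.inv) (add_zero _) =
      (0 : Abelian.Ext.{u} K K (i + 1)) := Subsingleton.elim (h := h) _ _
    have := congrArg (fun y => y.comp (Abelian.Ext.mk₀ constModuleIsoCocycles.hom) (add_zero _)) hx
    simpa using this
  have h2 := subsingleton_ext_one_tupleCocycles K i 0 h1
  let φ : K →ₗ[CategoryAlgebra k (SingleObj G)] tupleCocycles k G (i + 2) :=
    (linearMapMk
      { toFun := fun v => constProj (SingleObj.star G) v • f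
        map_zero' := zero_smul k f
        map_add' := fun v w => add_smul _ _ f }
      (fun r m => by
        rw [RepModule.algebraMap_smul]
        exact (congrArg (fun s : k => s • f) (constProj_algebraMap_smul _ r m)).trans
          (mul_smul r _ f))
      (fun X Y g m => by
        rw [of_smul_tupleModule]
        refine (congrArg (fun s : k => s • f) (constProj_of_smul g m)).trans ?_
        funext x
        exact congrArg (fun s : k => _ * s) (hf _ x).symm) :
      K →ₗ[CategoryAlgebra k (SingleObj G)] TupleModule k G (i + 2)).codRestrict _ fun v => by
        refine (map_smul (coboundary k _) _ f).trans ?_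
        rw [hd, smul_zero]
        rfl
  obtain ⟨y, hy⟩ := Abelian.Ext.covariant_sequence_exact₃ K
    (tupleSequence_shortExact (k := k) (G := G) (i + 1)) (Abelian.Ext.mk₀ (ModuleCat.ofHom φ)) rfl
    (Subsingleton.elim (h := h2) _ _)
  obtain ⟨ψ, rfl⟩ := (Abelian.Ext.mk₀_bijective _ _).2 y
  rw [Abelian.Ext.mk₀_comp_mk₀] at hy
  have hψ := (Abelian.Ext.mk₀_bijective _ _).1 hy
  let v : K := fun _ => (1 : k)
  have hv (g : G) : of k (X := SingleObj.star G) (Y := SingleObj.star G) g • v = v :=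
    ModuleOfFunctor.ext fun _ => proj_of_smul_same _ _ _
  let θ : TupleModule k G (i + 1) := ψ.hom v
  refine ⟨θ, fun g x => ?_, ?_⟩
  · have h3 : of k (X := SingleObj.star G) (Y := SingleObj.star G) g⁻¹ • θ = θ :=
      (map_smul ψ.hom _ v).symm.trans (congrArg ψ.hom (hv g⁻¹))
    rw [of_smul_tupleModule] at h3
    refine Eq.trans ?_ (congrFun h3 x)
    change _ = θ ((g⁻¹)⁻¹ • x)
    rw [inv_inv]
  · have h4 : tupleCoboundaryToCocycles k G (i + 1) θ = φ v :=
      congrArg (fun q => ModuleCat.Hom.hom q v) hψ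
    exact (congrArg Subtype.val h4).trans (one_smul k f)

/-- If the characteristic of `k` divides the order of a finite group, the cohomology of the group
with coefficients in `k` does not vanish in high degrees. -/
theorem exists_nontrivial_cohomology [Finite G] (p : ℕ) [Fact p.Prime] [CharP k p]
    (hG : p ∣ Nat.card G) (d : ℕ) : ∃ n, d ≤ n ∧ Nontrivial (Cohomology k (SingleObj G) n) := by
  obtain ⟨i, hi, f, hf, hd, hnot⟩ := exists_invariant_cocycle (k := k) p hG (d + 1)
  obtain ⟨j, rfl⟩ : ∃ j, i = j + 1 := ⟨i - 1, by omega⟩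
  refine ⟨j + 1, by omega, ?_⟩
  rw [← not_subsingleton_iff_nontrivial]
  exact fun h => hnot (exists_invariant_coboundary j h f hf hd)

end CategoryAlgebra

/-! ### Exact functors and `Ext` -/

section ExactFunctor

universe w w' v v' u₁ u₂

theorem shortExact_cokernel {𝒜 : Type u₁} [Category.{v} 𝒜] [Abelian 𝒜] {X Y : 𝒜}
    (f : X ⟶ Y) [Mono f] :
    (ShortComplex.mk f (cokernel.π f) (cokernel.condition f)).ShortExact where
  exact := ShortComplex.exact_of_g_is_cokernel _ (cokernelIsCokernel f)

variable {𝒜 : Type u₁} [Category.{v} 𝒜] [Abelian 𝒜] [HasExt.{w} 𝒜]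
  {ℬ : Type u₂} [Category.{v'} ℬ] [Abelian ℬ] [HasExt.{w'} ℬ]

open Abelian

variable {F F' : 𝒜 ⥤ ℬ} [F.Additive] [PreservesFiniteLimits F] [PreservesFiniteColimits F]
  [F'.Additive] [PreservesFiniteLimits F'] [PreservesFiniteColimits F']

/-- A natural transformation of exact functors induces a natural transformation on `Ext`. -/
theorem mapExactFunctor_comp_mk₀_app [EnoughInjectives 𝒜] (σ : F ⟶ F') {X Y : 𝒜} {n : ℕ}
    (e : Ext.{w} X Y n) :
    (e.mapExactFunctor F).comp (Ext.mk₀ (σ.app Y)) (add_zero n) =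
      (Ext.mk₀ (σ.app X)).comp (e.mapExactFunctor F') (zero_add n) := by
  induction n generalizing Y with
  | zero =>
    obtain ⟨f, rfl⟩ := (Ext.mk₀_bijective _ _).2 e
    rw [Ext.mapExactFunctor_mk₀, Ext.mapExactFunctor_mk₀, Ext.mk₀_comp_mk₀, Ext.mk₀_comp_mk₀,
      σ.naturality]
  | succ n ih =>
    let S := ShortComplex.mk _ _ (cokernel.condition (Injective.ι Y))
    have hS : S.ShortExact := shortExact_cokernel _
    obtain ⟨e', rfl⟩ := Ext.covariant_sequence_exact₁ X hS e (Ext.eq_zero_of_injective _) rfl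
    have hδ : ∃ (δ : Ext (F.obj S.X₃) (F.obj Y) 1) (δ' : Ext (F'.obj S.X₃) (F'.obj Y) 1),
        hS.extClass.mapExactFunctor F = δ ∧ hS.extClass.mapExactFunctor F' = δ' ∧
        δ.comp (Ext.mk₀ (σ.app Y)) (add_zero 1) = (Ext.mk₀ (σ.app S.X₃)).comp δ' (zero_add 1) :=
      ⟨_, _, Ext.mapExactFunctor_extClass F hS, Ext.mapExactFunctor_extClass F' hS,
        ShortComplex.ShortExact.extClass_naturality (hS.map_of_exact F)
          (hS.map_of_exact F') (S.mapNatTrans σ)⟩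
    obtain ⟨δ, δ', h1, h2, h3⟩ := hδ
    rw [Ext.mapExactFunctor_comp, Ext.mapExactFunctor_comp, h1, h2,
      Ext.comp_assoc_of_third_deg_zero, h3, ← Ext.comp_assoc_of_second_deg_zero, ih,
      Ext.comp_assoc _ _ _ (zero_add n) rfl (by omega)]

/-- Let `η : P ⟶ F X` be universal for morphisms from `P` to objects in the image of an exact
functor `F`. If every object embeds in an injective object whose image under `F` is acyclic for
`Ext P`, then the comparison map `Ext X N ⟶ Ext P (F N)` is injective. -/
theorem eq_zero_of_mk₀_comp_mapExactFunctor_eq_zero {X : 𝒜} {P : ℬ} (η : P ⟶ F.obj X)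
    (hη : ∀ N, Function.Bijective (fun f : X ⟶ N => η ≫ F.map f))
    (hJ : ∀ N : 𝒜, ∃ (J : 𝒜) (f : N ⟶ J), Mono f ∧ Injective J ∧
      ∀ m, Subsingleton (Ext.{w'} P (F.obj J) (m + 1)))
    {n : ℕ} {N : 𝒜} (e : Ext.{w} X N n)
    (he : (Ext.mk₀ η).comp (e.mapExactFunctor F) (zero_add n) = 0) : e = 0 := by
  induction n generalizing N with
  | zero =>
    obtain ⟨f, rfl⟩ := (Ext.mk₀_bijective _ _).2 e
    rw [Ext.mapExactFunctor_mk₀, Ext.mk₀_comp_mk₀, Ext.mk₀_eq_zero_iff] at he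
    rw [Ext.mk₀_eq_zero_iff]
    exact (hη N).1 (he.trans (by simp))
  | succ n ih =>
    obtain ⟨J, f, _, _, hac⟩ := hJ N
    let S := ShortComplex.mk _ _ (cokernel.condition f)
    have hS : S.ShortExact := shortExact_cokernel _
    obtain ⟨e', rfl⟩ := Ext.covariant_sequence_exact₁ X hS e
      (Ext.eq_zero_of_injective (I := J) _) rfl
    have he' : ((Ext.mk₀ η).comp (e'.mapExactFunctor F) (zero_add n)).comp
        (hS.map_of_exact F).extClass rfl = 0 := by
      rw [Ext.mapExactFunctor_comp] at he
      rw [← Ext.mapExactFunctor_extClass F hS]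
      exact (Ext.comp_assoc _ _ _ (zero_add n) rfl (by omega)).trans he
    obtain ⟨y, hy⟩ := Ext.covariant_sequence_exact₃ P (hS.map_of_exact F) _ rfl he'
    -- It suffices to lift `y` along the comparison map for `J`.
    suffices ∃ y' : Ext.{w} X J n,
        (Ext.mk₀ η).comp (y'.mapExactFunctor F) (zero_add n) = y by
      obtain ⟨y', rfl⟩ := this
      have hy' : (Ext.mk₀ η).comp ((y'.comp (Ext.mk₀ S.g) (add_zero n)).mapExactFunctor F)
          (zero_add n) = (Ext.mk₀ η).comp (e'.mapExactFunctor F) (zero_add n) := by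
        rw [← hy, Ext.mapExactFunctor_comp, Ext.mapExactFunctor_mk₀]
        exact (Ext.comp_assoc_of_third_deg_zero _ _ _ _).symm
      have hsub : e' - y'.comp (Ext.mk₀ S.g) (add_zero n) = 0 := by
        refine ih _ ?_
        rw [← Functor.mapExtAddHom_apply, map_sub, Functor.mapExtAddHom_apply,
          Functor.mapExtAddHom_apply, sub_eq_add_neg, Ext.comp_add, Ext.comp_neg, hy',
          add_neg_cancel]
      rw [sub_eq_zero.1 hsub, Ext.comp_assoc_of_second_deg_zero,
        ShortComplex.ShortExact.comp_extClass, Ext.comp_zero]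
    cases n with
    | zero =>
      obtain ⟨g, rfl⟩ := (Ext.mk₀_bijective _ _).2 y
      obtain ⟨h, rfl⟩ := (hη J).2 g
      exact ⟨Ext.mk₀ h, by rw [Ext.mapExactFunctor_mk₀, Ext.mk₀_comp_mk₀]; rfl⟩
    | succ m => exact ⟨0, @Subsingleton.elim _ (hac m) _ _⟩

end ExactFunctor

/-! ### Bimodules of linear maps -/

section Enveloping

variable {k : Type u} [Field k] {A : Type u} [Ring A] [Algebra k A]

/-- An additive map of modules over the enveloping algebra is linear if it commutes with the left
and the right action. -/
def envelopingLinearMap {M N : Type*} [AddCommGroup M] [AddCommGroup N]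
    [Module (A ⊗[k] Aᵐᵒᵖ) M] [Module (A ⊗[k] Aᵐᵒᵖ) N] (φ : M →+ N)
    (hl : ∀ (a : A) (m : M), φ ((a ⊗ₜ[k] (1 : Aᵐᵒᵖ)) • m) = (a ⊗ₜ[k] (1 : Aᵐᵒᵖ)) • φ m)
    (hr : ∀ (b : Aᵐᵒᵖ) (m : M), φ (((1 : A) ⊗ₜ[k] b) • m) = ((1 : A) ⊗ₜ[k] b) • φ m) :
    M →ₗ[A ⊗[k] Aᵐᵒᵖ] N where
  toFun := φ
  map_add' := φ.map_add
  map_smul' t m := by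
    change φ (t • m) = t • φ m
    induction t with
    | zero =>
      exact (congrArg φ (zero_smul (A ⊗[k] Aᵐᵒᵖ) m)).trans
        (φ.map_zero.trans (zero_smul (A ⊗[k] Aᵐᵒᵖ) (φ m)).symm)
    | add s t hs ht => rw [add_smul, add_smul, map_add, hs, ht]
    | tmul a b =>
      have h : a ⊗ₜ[k] b = (a ⊗ₜ[k] (1 : Aᵐᵒᵖ)) * ((1 : A) ⊗ₜ[k] b) := by
        rw [Algebra.TensorProduct.tmul_mul_tmul, mul_one, one_mul]
      rw [h, mul_smul, mul_smul, hl, hr]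

/-- The bimodule of `k`-linear maps between two left `A`-modules, on which `a ⊗ b` acts by
`n ↦ (w ↦ a • n (b • w))`. The algebra is a parameter because it determines this action. -/
@[nolint unusedArguments]
def HomBimodule (k _A W N : Type u) [Field k] [AddCommGroup W] [AddCommGroup N] [Module k W]
    [Module k N] : Type u := W →ₗ[k] N

section HomBimodule

variable (k) (W N : Type u) [AddCommGroup W] [AddCommGroup N] [Module k W] [Module k N]
  [Module A W] [Module A N] [IsScalarTower k A W] [IsScalarTower k A N]

variable (A) in
/-- The right action of `A` on the linear maps out of an `A`-module. -/
def precompAlgHom : Aᵐᵒᵖ →ₐ[k] Module.End k (W →ₗ[k] N) where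
  toFun b := LinearMap.lcomp k N (Algebra.lsmul k k W b.unop)
  map_one' := by ext; simp
  map_mul' b c := by ext; simp
  map_zero' := by ext; simp
  map_add' b c := by ext; simp
  commutes' r := by ext; simp

variable (A) in
/-- The action of the enveloping algebra on the linear maps between two `A`-modules. -/
def homBimoduleAction : A ⊗[k] Aᵐᵒᵖ →ₐ[k] Module.End k (W →ₗ[k] N) :=
  Algebra.TensorProduct.lift (Algebra.lsmul k k (W →ₗ[k] N)) (precompAlgHom k A W N)
    (fun a b => by
      ext n w
      rfl)

variable {k W N} in
theorem homBimoduleAction_tmul (a : A) (b : Aᵐᵒᵖ) : homBimoduleAction k A W N (a ⊗ₜ[k] b) =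
    Algebra.lsmul k k (W →ₗ[k] N) a * precompAlgHom k A W N b :=
  Algebra.TensorProduct.lift_tmul _ _ _ a b

instance : AddCommGroup (HomBimodule k A W N) := inferInstanceAs (AddCommGroup (W →ₗ[k] N))

instance : Module (A ⊗[k] Aᵐᵒᵖ) (HomBimodule k A W N) :=
  Module.compHom (W →ₗ[k] N) (homBimoduleAction k A W N).toRingHom

instance : FunLike (HomBimodule k A W N) W N := inferInstanceAs (FunLike (W →ₗ[k] N) W N)

instance : LinearMapClass (HomBimodule k A W N) k W N :=
  inferInstanceAs (LinearMapClass (W →ₗ[k] N) k W N)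

variable {k W N}

theorem HomBimodule.smul_apply (a : A) (b : Aᵐᵒᵖ) (n : HomBimodule k A W N) (w : W) :
    ((a ⊗ₜ[k] b) • n) w = a • n (b.unop • w) := by
  change homBimoduleAction k A W N (a ⊗ₜ[k] b) n w = _
  rw [homBimoduleAction_tmul]
  rfl

end HomBimodule

open scoped ModuleCat

variable (k) in
/-- The functor `Hom_k(W, -)` from left `A`-modules to bimodules. -/
def homFunctor (W : ModuleCat.{u} A) : ModuleCat.{u} A ⥤ ModuleCat.{u} (A ⊗[k] Aᵐᵒᵖ) where
  obj N := ModuleCat.of _ (HomBimodule k A W N)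
  map {N N'} f := ModuleCat.ofHom (envelopingLinearMap
    { toFun := fun n => (show HomBimodule k A W N' from
        (f.hom.restrictScalars k) ∘ₗ (show W →ₗ[k] N from n))
      map_zero' := LinearMap.ext fun w => map_zero f.hom
      map_add' := fun n n' => LinearMap.ext fun w => map_add f.hom (n w) (n' w) }
    (fun a n => LinearMap.ext fun w => by
      refine Eq.trans ?_ (HomBimodule.smul_apply (W := W) (N := N') a 1 _ w).symm
      exact (congrArg f.hom (HomBimodule.smul_apply a 1 n w)).trans (map_smul f.hom _ _))
    (fun b n => LinearMap.ext fun w => by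
      refine Eq.trans ?_ (HomBimodule.smul_apply (W := W) (N := N') 1 b _ w).symm
      exact (congrArg f.hom (HomBimodule.smul_apply 1 b n w)).trans (map_smul f.hom _ _)))
  map_id _ := rfl
  map_comp _ _ := rfl

instance (W : ModuleCat.{u} A) : (homFunctor k W).Additive where
  map_add := rfl

theorem homFunctor_shortExact (W : ModuleCat.{u} A) (S : ShortComplex (ModuleCat.{u} A))
    (hS : S.ShortExact) : (S.map (homFunctor k W)).ShortExact := by
  have hf := hS.moduleCat_injective_f
  have hg := hS.moduleCat_surjective_g
  have hex := (ShortComplex.ShortExact.moduleCat_exact_iff_function_exact S).1 hS.exact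
  obtain ⟨s, hs⟩ := (S.g.hom.restrictScalars k).exists_rightInverse_of_surjective
    (LinearMap.range_eq_top.2 hg)
  obtain ⟨r, hr⟩ := (S.f.hom.restrictScalars k).exists_leftInverse_of_injective
    (LinearMap.ker_eq_bot.2 hf)
  apply ModuleCat.shortComplex_shortExact
  · intro n
    constructor
    · intro hn
      refine ⟨r ∘ₗ n, LinearMap.ext fun w => ?_⟩
      obtain ⟨v, hv⟩ := (hex ((show W →ₗ[k] S.X₂ from n) w)).1 (LinearMap.congr_fun hn w)
      change S.f.hom (r ((show W →ₗ[k] S.X₂ from n) w)) = (show W →ₗ[k] S.X₂ from n) w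
      rw [← hv]
      exact congrArg S.f.hom (LinearMap.congr_fun hr v)
    · rintro ⟨n, rfl⟩
      exact LinearMap.ext fun w => (hex _).2 ⟨_, rfl⟩
  · intro n n' h
    exact LinearMap.ext fun w => hf (LinearMap.congr_fun h w)
  · intro n
    exact ⟨s ∘ₗ n, LinearMap.ext fun w => LinearMap.congr_fun hs _⟩

instance (W : ModuleCat.{u} A) : PreservesFiniteLimits (homFunctor k W) :=
  (((homFunctor k W).exact_tfae.out 0 3 :).1 (homFunctor_shortExact W)).1

instance (W : ModuleCat.{u} A) : PreservesFiniteColimits (homFunctor k W) :=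
  (((homFunctor k W).exact_tfae.out 0 3 :).1 (homFunctor_shortExact W)).2

theorem enveloping_smul (a : A) (b : Aᵐᵒᵖ) (x : envelopingModule k A) :
    (a ⊗ₜ[k] b) • x = (a * (show A from x) * b.unop : A) := by
  let _ : Module (A ⊗[k] Aᵐᵒᵖ) A := TensorProduct.Algebra.module
  change (a ⊗ₜ[k] b) • (show A from x) = _
  rw [TensorProduct.Algebra.smul_def]
  exact (mul_assoc a (show A from x) b.unop).symm

variable (k) in
/-- The action of `A` on a left module, as a map of bimodules `A ⟶ Hom_k(W, W)`. -/
def actionBimoduleHom (W : ModuleCat.{u} A) :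
    envelopingModule k A ⟶ (homFunctor k W).obj W :=
  ModuleCat.ofHom (X := envelopingModule k A) (Y := HomBimodule k A W W)
    (envelopingLinearMap (M := envelopingModule k A) (N := HomBimodule k A W W)
    { toFun := fun x => (Algebra.lsmul k k W : A →ₐ[k] Module.End k W) x
      map_zero' := map_zero (Algebra.lsmul k k W : A →ₐ[k] Module.End k W)
      map_add' := map_add (Algebra.lsmul k k W : A →ₐ[k] Module.End k W) }
    (fun a x => LinearMap.ext fun w => by
      refine Eq.trans ?_ (HomBimodule.smul_apply (W := W) (N := W) a 1 _ w).symm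
      refine (congrArg (fun c : A => c • w) (enveloping_smul a 1 x)).trans ?_
      change (a * (show A from x) * 1) • w = a • (show A from x) • (1 : A) • w
      rw [mul_one, one_smul, mul_smul])
    (fun b x => LinearMap.ext fun w => by
      refine Eq.trans ?_ (HomBimodule.smul_apply (W := W) (N := W) 1 b _ w).symm
      refine (congrArg (fun c : A => c • w) (enveloping_smul 1 b x)).trans ?_
      change (1 * (show A from x) * b.unop) • w = (1 : A) • (show A from x) • b.unop • w
      rw [one_mul, one_smul, mul_smul]))

/-- Bimodule maps `A ⟶ Hom_k(W, N)` are determined by the image of `1`, which is an `A`-linear map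
`W ⟶ N`. This is the comparison of `Ext` groups in degree zero. -/
theorem actionBimoduleHom_comp_bijective (W N : ModuleCat.{u} A) :
    Function.Bijective (fun f : W ⟶ N => actionBimoduleHom k W ≫ (homFunctor k W).map f) := by
  constructor
  · intro f g h
    apply ModuleCat.hom_ext
    ext w
    have h1 := LinearMap.congr_fun (congrArg (fun q => (show W →ₗ[k] N from
      ModuleCat.Hom.hom q (show envelopingModule k A from (1 : A)))) h) w
    have h2 : f.hom ((1 : A) • w) = g.hom ((1 : A) • w) := h1
    rwa [one_smul] at h2
  · intro q
    let u : HomBimodule k A W N := q.hom (show envelopingModule k A from (1 : A))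
    have hl (a : A) : (a ⊗ₜ[k] (1 : Aᵐᵒᵖ)) • u = q.hom (show envelopingModule k A from a) := by
      refine (map_smul q.hom _ _).symm.trans (congrArg q.hom ?_)
      rw [enveloping_smul]
      exact (mul_one _).trans (mul_one a)
    have hr (a : A) : ((1 : A) ⊗ₜ[k] MulOpposite.op a) • u =
        q.hom (show envelopingModule k A from a) := by
      refine (map_smul q.hom _ _).symm.trans (congrArg q.hom ?_)
      rw [enveloping_smul]
      exact (congrArg (fun c : A => c * a) (one_mul 1)).trans (one_mul a)
    have hlr (a : A) (w : W) : u (a • w) = a • u w := by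
      have h1 := HomBimodule.smul_apply a 1 u w
      have h2 := HomBimodule.smul_apply 1 (MulOpposite.op a) u w
      rw [hl] at h1
      rw [hr, h1] at h2
      simpa using h2.symm
    refine ⟨ModuleCat.ofHom
      { toFun := u
        map_add' := map_add u
        map_smul' := hlr }, ?_⟩
    apply ModuleCat.hom_ext
    refine LinearMap.ext fun (a : A) => ?_
    refine Eq.trans ?_ (hl a)
    refine LinearMap.ext fun w => ?_
    refine Eq.trans ?_ (HomBimodule.smul_apply a 1 u w).symm
    exact (hlr a w).trans (congrArg (fun v => a • u v) (one_smul A w).symm)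

end Enveloping

/-! ### Acyclicity of bimodules of linear maps into cofree modules -/

/-- Restriction of scalars along a ring homomorphism `ι : S → T` preserves projectivity if `T` is
projective over `S`. -/
theorem projective_restrictScalars {S T : Type u} [Ring S] [Ring T] (ι : S →+* T)
    (hT : Projective ((ModuleCat.restrictScalars.{u} ι).obj (ModuleCat.of T T)))
    (P : ModuleCat.{u} T) [Projective P] :
    Projective ((ModuleCat.restrictScalars.{u} ι).obj P) := by
  let _ : Module S T := Module.compHom T ι
  let _ : Module S P := Module.compHom P ι
  have : IsScalarTower S T T := ⟨fun s t p => mul_smul (ι s) t p⟩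
  have : IsScalarTower S T P := ⟨fun s t p => mul_smul (ι s) t p⟩
  have : Module.Projective S T := (IsProjective.iff_projective (R := S) T).2 hT
  have : Module.Projective T P := (IsProjective.iff_projective (R := T) P).2 inferInstance
  obtain ⟨s, hs⟩ := Module.projective_def'.1 this
  have : Module.Projective S (P →₀ T) := by
    classical
    exact Module.Projective.of_equiv' (finsuppLequivDFinsupp S).symm
  refine (IsProjective.iff_projective (R := S) P).1 ?_
  exact Module.Projective.of_split (s.restrictScalars S)
    ((Finsupp.linearCombination T id).restrictScalars S)
    (LinearMap.ext fun x => LinearMap.congr_fun hs x)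

variable {k : Type u} [Field k] {A : Type u} [Ring A] [Algebra k A]

variable (k A) in
/-- The inclusion of the right action into the enveloping algebra. -/
def rightInclusion : Aᵐᵒᵖ →+* A ⊗[k] Aᵐᵒᵖ :=
  (Algebra.TensorProduct.includeRight : Aᵐᵒᵖ →ₐ[k] A ⊗[k] Aᵐᵒᵖ).toRingHom

theorem projective_restrictScalars_enveloping_self : Projective
    ((ModuleCat.restrictScalars.{u} (rightInclusion k A)).obj
      (ModuleCat.of (A ⊗[k] Aᵐᵒᵖ) (A ⊗[k] Aᵐᵒᵖ))) := by
  refine Projective.of_iso (P := ModuleCat.of Aᵐᵒᵖ (Aᵐᵒᵖ ⊗[k] A)) ?_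
    ((IsProjective.iff_projective (R := Aᵐᵒᵖ) _).1 inferInstance)
  let E := (ModuleCat.restrictScalars.{u} (rightInclusion k A)).obj
    (ModuleCat.of (A ⊗[k] Aᵐᵒᵖ) (A ⊗[k] Aᵐᵒᵖ))
  let e : (Aᵐᵒᵖ ⊗[k] A) ≃ₗ[Aᵐᵒᵖ] E :=
    { (show (Aᵐᵒᵖ ⊗[k] A) ≃+ E from (TensorProduct.comm k Aᵐᵒᵖ A).toAddEquiv) with
      map_smul' := fun b t => by
        change TensorProduct.comm k Aᵐᵒᵖ A (b • t) =
          ((1 : A) ⊗ₜ[k] b) * TensorProduct.comm k Aᵐᵒᵖ A t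
        induction t with
        | zero => simp
        | add s t hs ht => rw [smul_add, map_add, map_add, mul_add, hs, ht]
        | tmul c a => simp [TensorProduct.smul_tmul'] }
  exact e.toModuleIso

theorem projective_restrictScalars_envelopingModule : Projective
    ((ModuleCat.restrictScalars.{u} (rightInclusion k A)).obj (envelopingModule k A)) := by
  refine Projective.of_iso (P := ModuleCat.of Aᵐᵒᵖ Aᵐᵒᵖ) ?_
    ((IsProjective.iff_projective (R := Aᵐᵒᵖ) _).1 inferInstance)
  let E := (ModuleCat.restrictScalars.{u} (rightInclusion k A)).obj (envelopingModule k A)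
  let e : Aᵐᵒᵖ ≃ₗ[Aᵐᵒᵖ] E :=
    { (show Aᵐᵒᵖ ≃+ E from (MulOpposite.opAddEquiv (α := A)).symm) with
      map_smul' := fun b c => by
        refine Eq.trans ?_ (enveloping_smul (k := k) (1 : A) b (MulOpposite.unop c)).symm
        exact congrArg (fun a : A => a * b.unop) (one_mul c.unop).symm }
  exact e.toModuleIso

section Cofree

variable (V : Type u) [AddCommGroup V] [Module k V]

variable (k A) in
/-- The cofree `A`-module `Hom_k(A, V)` on a vector space `V`, with `(a • φ) c = φ (c * a)`. -/
def CofreeModule : Type u := A →ₗ[k] V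

instance : AddCommGroup (CofreeModule k A V) := inferInstanceAs (AddCommGroup (A →ₗ[k] V))

instance : FunLike (CofreeModule k A V) A V := inferInstanceAs (FunLike (A →ₗ[k] V) A V)

instance : Module A (CofreeModule k A V) where
  smul a φ := (show A →ₗ[k] V from φ) ∘ₗ LinearMap.mulRight k a
  one_smul φ := LinearMap.ext fun c => congrArg φ (mul_one c)
  mul_smul a b φ := LinearMap.ext fun c => congrArg φ (mul_assoc c a b).symm
  smul_zero _ := rfl
  smul_add _ _ _ := rfl
  add_smul a b φ := LinearMap.ext fun c =>
    (congrArg φ (mul_add c a b)).trans (map_add (show A →ₗ[k] V from φ) _ _)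
  zero_smul φ := LinearMap.ext fun c =>
    (congrArg φ (mul_zero c)).trans (map_zero (show A →ₗ[k] V from φ))

variable (k A) in
/-- The cofree module as an object of the category of modules. -/
def cofreeModule : ModuleCat.{u} A := ModuleCat.of A (CofreeModule k A V)

variable {V}

theorem CofreeModule.map_smul (φ : CofreeModule k A V) (r : k) (c : A) : φ (r • c) = r • φ c :=
  LinearMap.map_smul (show A →ₗ[k] V from φ) r c

@[ext] theorem CofreeModule.ext {φ ψ : CofreeModule k A V} (h : ∀ c, φ c = ψ c) : φ = ψ :=
  LinearMap.ext h

open scoped ModuleCat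

variable (V) in
/-- Evaluation at `1` on a cofree module. -/
def cofreeEvalOne : cofreeModule k A V →ₗ[k] V where
  toFun φ := (show CofreeModule k A V from φ) 1
  map_add' _ _ := rfl
  map_smul' r φ := by
    change (show CofreeModule k A V from φ) (1 * algebraMap k A r) = _
    rw [one_mul, Algebra.algebraMap_eq_smul_one, CofreeModule.map_smul]
    rfl

variable (V) in
theorem injective_cofreeModule : Injective (cofreeModule k A V) := by
  refine ⟨fun {X Y} g f hf => ?_⟩
  obtain ⟨s, hs⟩ := (f.hom.restrictScalars k).exists_leftInverse_of_injective
    (LinearMap.ker_eq_bot.2 ((ModuleCat.mono_iff_injective f).1 hf))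
  let h : Y →ₗ[k] V := cofreeEvalOne V ∘ₗ g.hom.restrictScalars k ∘ₗ s
  refine ⟨ModuleCat.ofHom (Y := CofreeModule k A V)
    { toFun := fun y => h ∘ₗ (LinearMap.toSpanSingleton A Y y).restrictScalars k
      map_add' := fun y y' => LinearMap.ext fun a =>
        (congrArg h (smul_add a y y')).trans (map_add h _ _)
      map_smul' := fun b y => LinearMap.ext fun a => congrArg h (mul_smul a b y).symm }, ?_⟩
  apply ModuleCat.hom_ext
  refine LinearMap.ext fun x => CofreeModule.ext fun a => ?_
  change (show CofreeModule k A V from g.hom (s (a • f.hom x))) 1 =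
    (show CofreeModule k A V from g.hom x) a
  have h1 : s (a • f.hom x) = a • x := by
    rw [← map_smul f.hom]
    exact LinearMap.congr_fun hs _
  rw [h1, map_smul]
  exact congrArg (show CofreeModule k A V from g.hom x) (one_mul a)

end Cofree

open scoped ModuleCat

theorem exists_mono_cofreeModule (N : ModuleCat.{u} A) :
    ∃ f : N ⟶ cofreeModule k A N, Mono f := by
  refine ⟨ModuleCat.ofHom (Y := CofreeModule k A N)
    { toFun := fun n => (LinearMap.toSpanSingleton A N n).restrictScalars k
      map_add' := fun n n' => LinearMap.ext fun a => smul_add a n n'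
      map_smul' := fun b n => LinearMap.ext fun a => (mul_smul a b n).symm },
    (ModuleCat.mono_iff_injective _).2 fun n n' h => ?_⟩
  have h1 : (1 : A) • n = (1 : A) • n' := LinearMap.congr_fun h (1 : A)
  rwa [one_smul, one_smul] at h1

/-- Bimodule maps to `Hom_k(W, Hom_k(A, V))` extend along monomorphisms which split as maps of
right modules. -/
theorem exists_extension_homFunctor_cofree (W : ModuleCat.{u} A) (V : Type u) [AddCommGroup V]
    [Module k V] {Y P : ModuleCat.{u} (A ⊗[k] Aᵐᵒᵖ)} (f : Y ⟶ P) (r : P →+ Y)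
    (hr : ∀ (b : Aᵐᵒᵖ) (x : P), r (((1 : A) ⊗ₜ[k] b) • x) = ((1 : A) ⊗ₜ[k] b) • r x)
    (hf : ∀ y, r (f.hom y) = y)
    (q : Y ⟶ (homFunctor k W).obj (cofreeModule k A V)) :
    ∃ q' : P ⟶ (homFunctor k W).obj (cofreeModule k A V), f ≫ q' = q := by
  let q₀ (y : Y) : HomBimodule k A W (cofreeModule k A V) := q.hom y
  have hq₀ (a : A) (b : Aᵐᵒᵖ) (y : Y) (w : W) :
      q₀ ((a ⊗ₜ[k] b) • y) w = a • q₀ y (b.unop • w) := by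
    refine Eq.trans ?_ (HomBimodule.smul_apply a b (q₀ y) w)
    exact congrArg (fun n : HomBimodule k A W (cofreeModule k A V) => n w)
      (map_smul q.hom _ y)
  let E : Y →+ W →ₗ[k] V :=
    { toFun := fun y => cofreeEvalOne V ∘ₗ (show W →ₗ[k] _ from q₀ y)
      map_zero' := by
        ext w
        exact congrArg (fun n : W →ₗ[k] _ => cofreeEvalOne V (n w)) (map_zero q.hom)
      map_add' := fun y y' => by
        ext w
        exact congrArg (fun n : W →ₗ[k] _ => cofreeEvalOne V (n w)) (map_add q.hom y y') }
  have hEr (b : Aᵐᵒᵖ) (y : Y) (w : W) : E (((1 : A) ⊗ₜ[k] b) • y) w = E y (b.unop • w) :=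
    congrArg (cofreeEvalOne V) ((hq₀ 1 b y w).trans (one_smul A _))
  have hEl (a : A) (y : Y) (w : W) : E ((a ⊗ₜ[k] (1 : Aᵐᵒᵖ)) • y) w =
      (show CofreeModule k A V from q₀ y w) a := by
    refine (congrArg (cofreeEvalOne V) (hq₀ a 1 y w)).trans ?_
    change (show CofreeModule k A V from q₀ y ((1 : A) • w)) (1 * a) = _
    rw [one_smul, one_mul]
  -- Scalars may be moved from the left to the right factor of the enveloping algebra.
  have hk (c : k) (a : A) : (c • a) ⊗ₜ[k] (1 : Aᵐᵒᵖ) =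
      ((1 : A) ⊗ₜ[k] (c • (1 : Aᵐᵒᵖ))) * (a ⊗ₜ[k] (1 : Aᵐᵒᵖ)) := by
    rw [Algebra.TensorProduct.tmul_mul_tmul, one_mul, mul_one, TensorProduct.smul_tmul]
  have hlr (a : A) (b : Aᵐᵒᵖ) : (a ⊗ₜ[k] (1 : Aᵐᵒᵖ)) * ((1 : A) ⊗ₜ[k] b) =
      ((1 : A) ⊗ₜ[k] b) * (a ⊗ₜ[k] (1 : Aᵐᵒᵖ)) := by
    simp only [Algebra.TensorProduct.tmul_mul_tmul, one_mul, mul_one]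
  let φ (x : P) (w : W) : CofreeModule k A V :=
    { toFun := fun a => E (r ((a ⊗ₜ[k] (1 : Aᵐᵒᵖ)) • x)) w
      map_add' := fun a a' => by
        rw [TensorProduct.add_tmul, add_smul, map_add, map_add, LinearMap.add_apply]
      map_smul' := fun c a => by
        rw [hk, mul_smul, hr, hEr, MulOpposite.unop_smul, MulOpposite.unop_one, smul_assoc,
          one_smul, _root_.map_smul]
        rfl }
  let ψ (x : P) : HomBimodule k A W (cofreeModule k A V) :=
    { toFun := φ x
      map_add' := fun w w' => CofreeModule.ext fun a => map_add (E _) w w'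
      map_smul' := fun c w => CofreeModule.ext fun a => by
        refine (_root_.map_smul (E _) c w).trans ?_
        change c • φ x w a = φ x w (a * algebraMap k A c)
        rw [← CofreeModule.map_smul, ← Algebra.commutes, Algebra.smul_def] }
  refine ⟨ModuleCat.ofHom (Y := HomBimodule k A W (cofreeModule k A V))
    (envelopingLinearMap (N := HomBimodule k A W (cofreeModule k A V))
      { toFun := ψ
        map_zero' := LinearMap.ext fun w => CofreeModule.ext fun a => by
          change E (r ((a ⊗ₜ[k] (1 : Aᵐᵒᵖ)) • 0)) w = 0
          rw [smul_zero, map_zero, map_zero, LinearMap.zero_apply]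
        map_add' := fun x x' => LinearMap.ext fun w => CofreeModule.ext fun a => by
          change E (r ((a ⊗ₜ[k] (1 : Aᵐᵒᵖ)) • (x + x'))) w =
            E (r ((a ⊗ₜ[k] (1 : Aᵐᵒᵖ)) • x)) w + E (r ((a ⊗ₜ[k] (1 : Aᵐᵒᵖ)) • x')) w
          rw [smul_add, map_add, map_add, LinearMap.add_apply] }
      (fun b x => LinearMap.ext fun w => CofreeModule.ext fun a => ?_)
      (fun b x => LinearMap.ext fun w => CofreeModule.ext fun a => ?_)), ?_⟩
  · refine Eq.trans ?_ (congrArg (fun z : CofreeModule k A V => z a)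
      (HomBimodule.smul_apply b 1 (ψ x) w)).symm
    change E (r ((a ⊗ₜ[k] (1 : Aᵐᵒᵖ)) • (b ⊗ₜ[k] (1 : Aᵐᵒᵖ)) • x)) w =
      E (r (((a * b) ⊗ₜ[k] (1 : Aᵐᵒᵖ)) • x)) ((1 : A) • w)
    rw [one_smul, ← mul_smul, Algebra.TensorProduct.tmul_mul_tmul, one_mul]
  · refine Eq.trans ?_ (congrArg (fun z : CofreeModule k A V => z a)
      (HomBimodule.smul_apply 1 b (ψ x) w)).symm
    change E (r ((a ⊗ₜ[k] (1 : Aᵐᵒᵖ)) • ((1 : A) ⊗ₜ[k] b) • x)) w =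
      E (r (((a * 1) ⊗ₜ[k] (1 : Aᵐᵒᵖ)) • x)) (b.unop • w)
    rw [mul_one, ← mul_smul, hlr, mul_smul, hr, hEr]
  · apply ModuleCat.hom_ext
    refine LinearMap.ext fun y => LinearMap.ext fun w => CofreeModule.ext fun a => ?_
    change E (r ((a ⊗ₜ[k] (1 : Aᵐᵒᵖ)) • f.hom y)) w = _
    rw [← _root_.map_smul f.hom, hf, hEl]
    rfl

/-- Bimodules which are projective as right modules are acyclic for `Hom_k(W, Hom_k(A, V))`. -/
theorem subsingleton_ext_homFunctor_cofree (W : ModuleCat.{u} A) (V : Type u) [AddCommGroup V]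
    [Module k V] (m : ℕ) (X : ModuleCat.{u} (A ⊗[k] Aᵐᵒᵖ))
    (hX : Projective ((ModuleCat.restrictScalars.{u} (rightInclusion k A)).obj X)) :
    Subsingleton (Abelian.Ext.{u} X
      ((homFunctor k W).obj (cofreeModule k A V)) (m + 1)) := by
  let R := ModuleCat.restrictScalars.{u} (rightInclusion k A)
  let S := ShortComplex.mk _ _ (kernel.condition (Projective.π X))
  have hS : S.ShortExact :=
    { exact := ShortComplex.exact_of_f_is_kernel _ (kernelIsKernel S.g) }
  have : Projective (S.map R).X₃ := hX
  have hSR : (S.map R).ShortExact := ModuleCat.shortComplex_shortExact _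
    ((ShortComplex.ShortExact.moduleCat_exact_iff_function_exact S).1 hS.exact)
    hS.moduleCat_injective_f hS.moduleCat_surjective_g
  let σ := hSR.splittingOfProjective
  have hP : Projective (R.obj (Projective.over X)) :=
    projective_restrictScalars _ projective_restrictScalars_enveloping_self _
  have hY : Projective (R.obj S.X₁) :=
    Retract.projective (Y := R.obj S.X₂) ⟨(S.map R).f, σ.r, σ.f_r⟩
  refine subsingleton_of_forall_eq 0 fun e => ?_
  obtain ⟨y, rfl⟩ := Abelian.Ext.contravariant_sequence_exact₃ hS _ e
    (Abelian.Ext.eq_zero_of_projective (P := Projective.over X) _) (Nat.add_comm 1 m)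
  cases m with
  | zero =>
    obtain ⟨q, rfl⟩ := (Abelian.Ext.mk₀_bijective _ _).2 y
    obtain ⟨q', rfl⟩ := exists_extension_homFunctor_cofree W V S.f
      (r := AddMonoidHomClass.toAddMonoidHom σ.r.hom)
      (fun b x => σ.r.hom.map_smul' b x)
      (fun y => LinearMap.congr_fun (congrArg ModuleCat.Hom.hom σ.f_r) y) q
    rw [← Abelian.Ext.mk₀_comp_mk₀]
    exact ShortComplex.ShortExact.extClass_comp_assoc hS _
  | succ m =>
    have h0 := subsingleton_ext_homFunctor_cofree W V m S.X₁ hY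
    rw [Subsingleton.elim y 0, Abelian.Ext.comp_zero]

/-- The comparison of `Ext` over `A` with `Ext` of bimodules,
`Ext_A(W, N) ⟶ Ext_{A ⊗ Aᵐᵒᵖ}(A, Hom_k(W, N))`, is injective. -/
theorem eq_zero_of_actionBimoduleHom_comp_eq_zero {W N : ModuleCat.{u} A} {n : ℕ}
    (e : Abelian.Ext.{u} W N n)
    (he : (Abelian.Ext.mk₀ (actionBimoduleHom k W)).comp
      (e.mapExactFunctor (homFunctor k W)) (zero_add n) = 0) : e = 0 := by
  refine eq_zero_of_mk₀_comp_mapExactFunctor_eq_zero (actionBimoduleHom k W)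
    (actionBimoduleHom_comp_bijective W) (fun N => ?_) e he
  obtain ⟨f, hf⟩ := exists_mono_cofreeModule (k := k) N
  exact ⟨_, f, hf, injective_cofreeModule N, fun m =>
    subsingleton_ext_homFunctor_cofree W N m _ projective_restrictScalars_envelopingModule⟩

/-! ### Modules over a group with diagonal action -/

namespace CategoryAlgebra

section Induction

variable {k : Type u} [Field k] {C : Type} [SmallCategory C]

theorem induction_on {motive : CategoryAlgebra k C → Prop} (a : CategoryAlgebra k C)
    (zero : motive 0) (add : ∀ a b, motive a → motive b → motive (a + b))
    (smul_of : ∀ (r : k) (X Y : C) (f : X ⟶ Y), motive (r • of k f)) : motive a := by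
  refine Finsupp.induction_linear a zero (fun a b => add a b) ?_
  rintro ⟨X, Y, f⟩ r
  have h : r • of k f = Finsupp.single (⟨X, Y, f⟩ : Σ (X Y : C), X ⟶ Y) r :=
    (Finsupp.smul_single r _ (1 : k)).trans (by rw [smul_eq_mul, mul_one])
  rw [← h]
  exact smul_of r X Y f

variable [Fintype C]

/-- An additive map of bimodules over a category algebra is linear if it commutes with the left
action of the morphisms and with the right action. -/
def bimoduleMapMk {M N : Type*} [AddCommGroup M] [AddCommGroup N]
    [Module (CategoryAlgebra k C ⊗[k] (CategoryAlgebra k C)ᵐᵒᵖ) M]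
    [Module (CategoryAlgebra k C ⊗[k] (CategoryAlgebra k C)ᵐᵒᵖ) N] (φ : M →+ N)
    (hl : ∀ (X Y : C) (f : X ⟶ Y) (m : M), φ ((of k f ⊗ₜ[k] (1 : (CategoryAlgebra k C)ᵐᵒᵖ)) • m) =
      (of k f ⊗ₜ[k] (1 : (CategoryAlgebra k C)ᵐᵒᵖ)) • φ m)
    (hr : ∀ (b : (CategoryAlgebra k C)ᵐᵒᵖ) (m : M),
      φ (((1 : CategoryAlgebra k C) ⊗ₜ[k] b) • m) = ((1 : CategoryAlgebra k C) ⊗ₜ[k] b) • φ m) :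
    M →ₗ[CategoryAlgebra k C ⊗[k] (CategoryAlgebra k C)ᵐᵒᵖ] N :=
  envelopingLinearMap φ (fun a m => by
    induction a using induction_on with
    | zero =>
      rw [TensorProduct.zero_tmul]
      exact (congrArg φ (zero_smul (CategoryAlgebra k C ⊗[k] (CategoryAlgebra k C)ᵐᵒᵖ) m)).trans
        (φ.map_zero.trans
          (zero_smul (CategoryAlgebra k C ⊗[k] (CategoryAlgebra k C)ᵐᵒᵖ) (φ m)).symm)
    | add a b ha hb => rw [TensorProduct.add_tmul, add_smul, add_smul, map_add, ha, hb]
    | smul_of r X Y f =>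
      have h : (r • of k f) ⊗ₜ[k] (1 : (CategoryAlgebra k C)ᵐᵒᵖ) =
          ((1 : CategoryAlgebra k C) ⊗ₜ[k] (r • (1 : (CategoryAlgebra k C)ᵐᵒᵖ))) *
            (of k f ⊗ₜ[k] (1 : (CategoryAlgebra k C)ᵐᵒᵖ)) := by
        rw [Algebra.TensorProduct.tmul_mul_tmul, one_mul, mul_one, TensorProduct.smul_tmul]
      rw [h, mul_smul, mul_smul, hr, hl]) hr

end Induction

variable {k : Type u} [Field k] {C : Type} [SmallCategory C] [Fintype C] {G : Type} [Group G]

theorem of_id_singleObj (X : SingleObj G) : of k (𝟙 X) = 1 := by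
  rw [one_eq, Fintype.sum_unique]
  rfl

section DiagonalBimodule

variable (π : C ⥤ SingleObj G) (M : Type u) [AddCommGroup M] [Module k M]
  [Module (CategoryAlgebra k (SingleObj G)) M] [IsScalarTower k (CategoryAlgebra k (SingleObj G)) M]

/-- The diagonal action of a morphism `f` on `M ⊗ k C`. -/
def diagonalHom {X Y : C} (f : X ⟶ Y) : Module.End k (M ⊗[k] CategoryAlgebra k C) :=
  TensorProduct.map (Algebra.lsmul k k M (of k (π.map f))) (LinearMap.mulLeft k (of k f))

/-- The diagonal action of the category algebra on `M ⊗ k C`. -/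
def diagonalAction : CategoryAlgebra k C →ₐ[k] Module.End k (M ⊗[k] CategoryAlgebra k C) :=
  AlgHom.ofLinearMap (lift k (fun _ _ f => diagonalHom π M f))
    (by
      refine TensorProduct.ext' fun m a => ?_
      rw [one_eq, map_sum, LinearMap.sum_apply]
      have h (X : C) : lift k (fun _ _ f => diagonalHom π M f) (of k (𝟙 X)) (m ⊗ₜ[k] a) =
          m ⊗ₜ[k] (of k (𝟙 X) * a) := by
        rw [lift_of, diagonalHom, TensorProduct.map_tmul, π.map_id, of_id_singleObj, map_one]
        rfl
      rw [Finset.sum_congr rfl fun X _ => h X, ← TensorProduct.tmul_sum, ← Finset.sum_mul,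
        ← one_eq, one_mul]
      rfl)
    (algHom_ext_mul _ (by
      intro X Y Z W g f
      rw [lift_of, lift_of]
      by_cases h : Y = Z
      · subst h
        rw [of_mul_of, lift_of]
        refine TensorProduct.ext' fun m a => ?_
        rw [Module.End.mul_apply]
        simp only [diagonalHom, TensorProduct.map_tmul, Algebra.lsmul_coe, LinearMap.mulLeft_apply]
        rw [π.map_comp, ← of_mul_of, ← of_mul_of, mul_smul, mul_assoc]
      · rw [of_mul_of_ne _ _ h, map_zero]
        refine TensorProduct.ext' fun m a => ?_
        rw [Module.End.mul_apply]
        simp only [diagonalHom, TensorProduct.map_tmul, LinearMap.mulLeft_apply]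
        rw [← mul_assoc, of_mul_of_ne _ _ h, zero_mul, TensorProduct.tmul_zero]
        rfl))

variable (k C) in
/-- The right action of the category algebra on `M ⊗ k C`. -/
def diagonalRightAction : (CategoryAlgebra k C)ᵐᵒᵖ →ₐ[k]
    Module.End k (M ⊗[k] CategoryAlgebra k C) :=
  (Module.End.lTensorAlgHom k (CategoryAlgebra k C) M).comp
    (Algebra.lsmul k k (CategoryAlgebra k C))

theorem diagonalAction_commute (a : CategoryAlgebra k C) (b : (CategoryAlgebra k C)ᵐᵒᵖ) :
    Commute (diagonalAction π M a) (diagonalRightAction k C M b) := by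
  have h : (LinearMap.mulRight k (diagonalRightAction k C M b)) ∘ₗ
      (diagonalAction π M).toLinearMap =
      (LinearMap.mulLeft k (diagonalRightAction k C M b)) ∘ₗ (diagonalAction π M).toLinearMap := by
    refine hom_ext fun X Y f => TensorProduct.ext' fun m a => ?_
    have hf : (diagonalAction π M).toLinearMap (of k f) = diagonalHom π M f :=
      lift_of (fun _ _ f => diagonalHom π M f) f
    rw [LinearMap.comp_apply, LinearMap.comp_apply, hf]
    change _ ⊗ₜ[k] (of k f * (a * b.unop)) = _ ⊗ₜ[k] ((of k f * a) * b.unop)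
    rw [mul_assoc]
    rfl
  exact LinearMap.congr_fun h a

variable (k) in
/-- The bimodule `M ⊗ k C` with the diagonal left action, given on morphisms by
`f • (m ⊗ a) = π f • m ⊗ f * a`, and the right action on the second factor. The functor `π` is a
parameter because it determines this action. -/
@[nolint unusedArguments]
def DiagonalBimodule (_π : C ⥤ SingleObj G) (M : Type u) [AddCommGroup M] [Module k M] : Type u :=
  M ⊗[k] CategoryAlgebra k C

instance : AddCommGroup (DiagonalBimodule k π M) :=
  inferInstanceAs (AddCommGroup (M ⊗[k] CategoryAlgebra k C))

/-- The action of the enveloping algebra on `M ⊗ k C`. -/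
def diagonalBimoduleAction : CategoryAlgebra k C ⊗[k] (CategoryAlgebra k C)ᵐᵒᵖ →ₐ[k]
    Module.End k (M ⊗[k] CategoryAlgebra k C) :=
  Algebra.TensorProduct.lift (diagonalAction π M) (diagonalRightAction k C M)
    (diagonalAction_commute π M)

instance : Module (CategoryAlgebra k C ⊗[k] (CategoryAlgebra k C)ᵐᵒᵖ) (DiagonalBimodule k π M) :=
  Module.compHom (M ⊗[k] CategoryAlgebra k C) (diagonalBimoduleAction π M).toRingHom

variable {M}

theorem left_smul_diagonalBimodule {X Y : C} (f : X ⟶ Y) (t : DiagonalBimodule k π M) :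
    (of k f ⊗ₜ[k] (1 : (CategoryAlgebra k C)ᵐᵒᵖ)) • t = diagonalHom π M f t := by
  have h : diagonalBimoduleAction π M (of k f ⊗ₜ[k] (1 : (CategoryAlgebra k C)ᵐᵒᵖ)) =
      diagonalHom π M f := by
    refine (Algebra.TensorProduct.lift_tmul _ _ _ _ _).trans ?_
    rw [map_one, mul_one]
    exact lift_of (fun _ _ f => diagonalHom π M f) f
  exact LinearMap.congr_fun h t

theorem right_smul_diagonalBimodule (b : (CategoryAlgebra k C)ᵐᵒᵖ) (t : DiagonalBimodule k π M) :
    ((1 : CategoryAlgebra k C) ⊗ₜ[k] b) • t = diagonalRightAction k C M b t := by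
  have h : diagonalBimoduleAction π M ((1 : CategoryAlgebra k C) ⊗ₜ[k] b) =
      diagonalRightAction k C M b := by
    refine (Algebra.TensorProduct.lift_tmul _ _ _ _ _).trans ?_
    rw [map_one, one_mul]
  exact LinearMap.congr_fun h t

theorem diagonalHom_tmul {X Y : C} (f : X ⟶ Y) (m : M) (a : CategoryAlgebra k C) :
    diagonalHom π M f (m ⊗ₜ[k] a) = (of k (π.map f) • m) ⊗ₜ[k] (of k f * a) := rfl

variable {π} in
/-- An additive map out of `M ⊗ k C` is a map of bimodules if it commutes with the actions on pure
tensors. -/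
def diagonalBimoduleLift {N : Type u} [AddCommGroup N]
    [Module (CategoryAlgebra k C ⊗[k] (CategoryAlgebra k C)ᵐᵒᵖ) N]
    (φ : M ⊗[k] CategoryAlgebra k C →+ N)
    (hl : ∀ (X Y : C) (f : X ⟶ Y) (m : M) (a : CategoryAlgebra k C),
      φ ((of k (π.map f) • m) ⊗ₜ[k] (of k f * a)) =
        (of k f ⊗ₜ[k] (1 : (CategoryAlgebra k C)ᵐᵒᵖ)) • φ (m ⊗ₜ[k] a))
    (hr : ∀ (b : (CategoryAlgebra k C)ᵐᵒᵖ) (m : M) (a : CategoryAlgebra k C),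
      φ (m ⊗ₜ[k] (a * b.unop)) = ((1 : CategoryAlgebra k C) ⊗ₜ[k] b) • φ (m ⊗ₜ[k] a)) :
    DiagonalBimodule k π M →ₗ[CategoryAlgebra k C ⊗[k] (CategoryAlgebra k C)ᵐᵒᵖ] N :=
  bimoduleMapMk (M := DiagonalBimodule k π M) φ
    (fun X Y f t => by
      rw [left_smul_diagonalBimodule]
      change φ (diagonalHom π M f t) = _ • φ t
      induction t using TensorProduct.induction_on with
      | zero => rw [map_zero, map_zero, smul_zero]
      | add s t hs ht => rw [map_add, map_add, map_add, smul_add, hs, ht]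
      | tmul m a => exact hl X Y f m a)
    (fun b t => by
      rw [right_smul_diagonalBimodule]
      change φ (diagonalRightAction k C M b t) = _ • φ t
      induction t using TensorProduct.induction_on with
      | zero => rw [map_zero, map_zero, smul_zero]
      | add s t hs ht => rw [map_add, map_add, map_add, smul_add, hs, ht]
      | tmul m a => exact hr b m a)

end DiagonalBimodule

open scoped ModuleCat

variable (k) in
/-- The functor `M ↦ M ⊗ k C` from modules over a group to bimodules over a category algebra. -/
def diagonalFunctor (π : C ⥤ SingleObj G) : ModuleCat.{u} (CategoryAlgebra k (SingleObj G)) ⥤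
    ModuleCat.{u} (CategoryAlgebra k C ⊗[k] (CategoryAlgebra k C)ᵐᵒᵖ) where
  obj M := ModuleCat.of _ (DiagonalBimodule k π M)
  map {M M'} g := ModuleCat.ofHom (diagonalBimoduleLift (π := π) (N := DiagonalBimodule k π M')
    (LinearMap.rTensor (CategoryAlgebra k C) (g.hom.restrictScalars k)).toAddMonoidHom
    (fun X Y f m a => by
      rw [left_smul_diagonalBimodule]
      refine Eq.trans ?_ (diagonalHom_tmul π f (g.hom m) a).symm
      exact congrArg (fun m' => m' ⊗ₜ[k] (of k f * a)) (map_smul g.hom _ m))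
    (fun b m a => by
      rw [right_smul_diagonalBimodule]
      rfl))
  map_id M := ModuleCat.hom_ext (LinearMap.ext fun t =>
    LinearMap.congr_fun (LinearMap.rTensor_id (CategoryAlgebra k C) M) t)
  map_comp {M M' M''} g h := ModuleCat.hom_ext (LinearMap.ext fun t =>
    LinearMap.congr_fun (LinearMap.rTensor_comp (CategoryAlgebra k C) (h.hom.restrictScalars k)
      (g.hom.restrictScalars k)) t)

variable (π : C ⥤ SingleObj G)

instance : (diagonalFunctor k π).Additive where
  map_add {_ _ g h} := ModuleCat.hom_ext (LinearMap.ext fun t =>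
    LinearMap.congr_fun (LinearMap.rTensor_add (CategoryAlgebra k C) (g.hom.restrictScalars k)
      (h.hom.restrictScalars k)) t)

theorem diagonalFunctor_shortExact
    (S : ShortComplex (ModuleCat.{u} (CategoryAlgebra k (SingleObj G)))) (hS : S.ShortExact) :
    (S.map (diagonalFunctor k π)).ShortExact := by
  have hf := hS.moduleCat_injective_f
  have hg := hS.moduleCat_surjective_g
  have hex := (ShortComplex.ShortExact.moduleCat_exact_iff_function_exact S).1 hS.exact
  exact ModuleCat.shortComplex_shortExact _
    (rTensor_exact (CategoryAlgebra k C) (f := S.f.hom.restrictScalars k)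
      (g := S.g.hom.restrictScalars k) hex hg)
    (Module.Flat.rTensor_preserves_injective_linearMap (M := CategoryAlgebra k C)
      (S.f.hom.restrictScalars k) hf)
    (LinearMap.rTensor_surjective (CategoryAlgebra k C) (g := S.g.hom.restrictScalars k) hg)

instance : PreservesFiniteLimits (diagonalFunctor k π) :=
  (((diagonalFunctor k π).exact_tfae.out 0 3 :).1 (diagonalFunctor_shortExact π)).1

instance : PreservesFiniteColimits (diagonalFunctor k π) :=
  (((diagonalFunctor k π).exact_tfae.out 0 3 :).1 (diagonalFunctor_shortExact π)).2

end CategoryAlgebra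

/-! ### Cohomology of groups and Hochschild cohomology of category algebras -/

section ExactFunctorComp

universe w w' w'' v v' v'' u₁ u₂ u₃

/-- The action on `Ext` of a composite of exact functors. -/
theorem mapExactFunctor_mapExactFunctor {𝒜 : Type u₁} [Category.{v} 𝒜] [Abelian 𝒜] [HasExt.{w} 𝒜]
    [EnoughInjectives 𝒜] {ℬ : Type u₂} [Category.{v'} ℬ] [Abelian ℬ] [HasExt.{w'} ℬ]
    {𝒟 : Type u₃} [Category.{v''} 𝒟] [Abelian 𝒟] [HasExt.{w''} 𝒟]
    (F : 𝒜 ⥤ ℬ) [F.Additive] [PreservesFiniteLimits F] [PreservesFiniteColimits F]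
    (F' : ℬ ⥤ 𝒟) [F'.Additive] [PreservesFiniteLimits F'] [PreservesFiniteColimits F']
    [PreservesFiniteLimits (F ⋙ F')] [PreservesFiniteColimits (F ⋙ F')]
    {X Y : 𝒜} {n : ℕ} (e : Abelian.Ext.{w} X Y n) :
    (e.mapExactFunctor F).mapExactFunctor F' = e.mapExactFunctor (F ⋙ F') := by
  induction n generalizing Y with
  | zero =>
    obtain ⟨f, rfl⟩ := (Abelian.Ext.mk₀_bijective _ _).2 e
    rw [Abelian.Ext.mapExactFunctor_mk₀, Abelian.Ext.mapExactFunctor_mk₀,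
      Abelian.Ext.mapExactFunctor_mk₀]
    rfl
  | succ n ih =>
    let S := ShortComplex.mk _ _ (cokernel.condition (Injective.ι Y))
    have hS : S.ShortExact := shortExact_cokernel _
    obtain ⟨e', rfl⟩ := Abelian.Ext.covariant_sequence_exact₁ X hS e
      (Abelian.Ext.eq_zero_of_injective _) rfl
    have h : (hS.extClass.mapExactFunctor F).mapExactFunctor F' =
        hS.extClass.mapExactFunctor (F ⋙ F') := by
      rw [Abelian.Ext.mapExactFunctor_extClass F hS,
        Abelian.Ext.mapExactFunctor_extClass (F ⋙ F') hS]
      exact Abelian.Ext.mapExactFunctor_extClass F' (hS.map_of_exact F)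
    rw [Abelian.Ext.mapExactFunctor_comp, Abelian.Ext.mapExactFunctor_comp,
      Abelian.Ext.mapExactFunctor_comp, ih, h]

end ExactFunctorComp

namespace CategoryAlgebra

variable {k : Type u} [Field k] {C : Type} [SmallCategory C] [Fintype C] {G : Type} [Group G]
  (π : C ⥤ SingleObj G)

open scoped ModuleCat

theorem constProj_smul (X : C) (r : k) (v : constModule k C) :
    constProj X (r • v) = r * constProj X v :=
  constProj_algebraMap_smul X r v

theorem constProj_of_smul_ne {X Y Z : C} (f : X ⟶ Y) (v : constModule k C) (h : Z ≠ Y) :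
    constProj Z (of k f • v) = 0 :=
  proj_of_smul_ne _ f v h

theorem constModule_ext {v w : constModule k C} (h : ∀ X, constProj X v = constProj X w) : v = w :=
  ModuleOfFunctor.ext h

section Res

variable {M : ModuleCat.{u} (CategoryAlgebra k (SingleObj G))}

theorem res_ext {m m' : (resFunctor k C π).obj M}
    (h : ∀ X, resComponent π X m = resComponent π X m') : m = m' :=
  funext fun X => Subtype.ext (h X)

theorem resComponent_of_smul {X Y : C} (f : X ⟶ Y) (m : (resFunctor k C π).obj M) :
    resComponent π Y (of k f • m) = of k (π.map f) • resComponent π X m :=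
  congrArg Subtype.val (proj_of_smul_same (π ⋙ (toFunctor k (SingleObj G)).obj M) f m)

theorem resComponent_of_smul_ne {X Y Z : C} (f : X ⟶ Y) (m : (resFunctor k C π).obj M)
    (h : Z ≠ Y) : resComponent π Z (of k f • m) = 0 :=
  congrArg Subtype.val (proj_of_smul_ne (π ⋙ (toFunctor k (SingleObj G)).obj M) f m h)

theorem resComponent_smul (r : k) (X : C) (m : (resFunctor k C π).obj M) :
    resComponent π X (r • m) = r • resComponent π X m :=
  congrArg Subtype.val
    (proj_algebraMap_smul (π ⋙ (toFunctor k (SingleObj G)).obj M) r m X)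

theorem resComponent_add (X : C) (m m' : (resFunctor k C π).obj M) :
    resComponent π X (m + m') = resComponent π X m + resComponent π X m' := rfl

/-- The element of the restriction of `M` whose component at `X` is the multiple of a given element
of `M` by the component at `X` of an element of the constant module. -/
def spreadElement (m : M) (v : constModule k C) : (resFunctor k C π).obj M :=
  (fun X => ⟨constProj X v • m, by rw [mem_value, of_id_singleObj, one_smul]⟩ :
    ∀ X : C, value k M (π.obj X))

theorem resComponent_spreadElement (m : M) (v : constModule k C) (X : C) :
    resComponent π X (spreadElement π m v) = constProj X v • m := rfl

variable (M) in
/-- The bilinear map given by `spreadElement`. -/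
def spread : M →ₗ[k] constModule k C →ₗ[k] (resFunctor k C π).obj M :=
  LinearMap.mk₂ k (spreadElement π)
    (fun m m' v => res_ext π fun X => smul_add (constProj X v) m m')
    (fun r m v => res_ext π fun X => by
      rw [resComponent_smul, resComponent_spreadElement, resComponent_spreadElement]
      exact smul_comm (constProj X v) r m)
    (fun m v v' => res_ext π fun X => by
      rw [resComponent_add, resComponent_spreadElement, resComponent_spreadElement,
        resComponent_spreadElement, map_add, add_smul])
    (fun r m v => res_ext π fun X => by
      rw [resComponent_smul, resComponent_spreadElement, resComponent_spreadElement,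
        constProj_smul, mul_smul])

theorem resComponent_spread (m : M) (v : constModule k C) (X : C) :
    resComponent π X (spread π M m v) = constProj X v • m := rfl

theorem spread_of_smul {X Y : C} (f : X ⟶ Y) (m : M) (v : constModule k C) :
    spread π M (of k (π.map f) • m) (of k f • v) = of k f • spread π M m v := by
  refine res_ext π fun Z => ?_
  rw [resComponent_spread]
  by_cases h : Z = Y
  · subst h
    rw [resComponent_of_smul, constProj_of_smul, resComponent_spread]
    exact smul_comm _ _ m
  · rw [resComponent_of_smul_ne _ _ _ h, constProj_of_smul_ne _ _ h, zero_smul]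

variable (M) in
/-- The map of bimodules `M ⊗ k C ⟶ Hom_k(k, res M)`, where `k` stands for the constant module: it
sends `m ⊗ a` to the map `v ↦ spread m (a • v)`. -/
def diagonalToHom : (diagonalFunctor k π).obj M ⟶
    (homFunctor k (constModule k C)).obj ((resFunctor k C π).obj M) :=
  ModuleCat.ofHom (Y := HomBimodule k (CategoryAlgebra k C) (constModule k C)
      ((resFunctor k C π).obj M)) (diagonalBimoduleLift (π := π)
    (TensorProduct.lift (LinearMap.mk₂ k
      (fun m a => (spread π M m ∘ₗ Algebra.lsmul k k (constModule k C) a :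
        constModule k C →ₗ[k] (resFunctor k C π).obj M))
      (fun m m' a => by ext v; simp)
      (fun r m a => by ext v; simp)
      (fun m a a' => by ext v; simp)
      (fun r m a => by ext v; simp))).toAddMonoidHom
    (fun X Y f m a => LinearMap.ext fun v => by
      refine Eq.trans ?_ (HomBimodule.smul_apply (of k f) 1 _ v).symm
      change spread π M (of k (π.map f) • m) ((of k f * a) • v) =
        of k f • spread π M m (a • (1 : CategoryAlgebra k C) • v)
      rw [one_smul, mul_smul, spread_of_smul])
    (fun b m a => LinearMap.ext fun v => by
      refine Eq.trans ?_ (HomBimodule.smul_apply 1 b _ v).symm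
      change spread π M m ((a * b.unop) • v) =
        (1 : CategoryAlgebra k C) • spread π M m (a • b.unop • v)
      rw [one_smul, mul_smul]))

end Res

theorem diagonalFunctor_hom_ext {M : ModuleCat.{u} (CategoryAlgebra k (SingleObj G))}
    {N : ModuleCat.{u} (CategoryAlgebra k C ⊗[k] (CategoryAlgebra k C)ᵐᵒᵖ)}
    {f g : (diagonalFunctor k π).obj M ⟶ N}
    (h : ∀ (m : M) (a : CategoryAlgebra k C), f.hom (m ⊗ₜ[k] a) = g.hom (m ⊗ₜ[k] a)) : f = g := by
  apply ModuleCat.hom_ext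
  refine LinearMap.ext fun (t : M ⊗[k] CategoryAlgebra k C) => ?_
  induction t using TensorProduct.induction_on with
  | zero => exact (map_zero f.hom).trans (map_zero g.hom).symm
  | add s t hs ht =>
    exact (map_add f.hom _ _).trans ((congrArg₂ (· + ·) hs ht).trans (map_add g.hom _ _).symm)
  | tmul m a => exact h m a

variable (k) in
/-- The maps `M ⊗ k C ⟶ Hom_k(k, res M)` as a natural transformation. -/
def diagonalToHomNatTrans : diagonalFunctor k π ⟶
    resFunctor k C π ⋙ homFunctor k (constModule k C) where
  app M := diagonalToHom π M
  naturality M M' g := diagonalFunctor_hom_ext π fun m a =>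
    LinearMap.ext fun v => res_ext π fun X => by
      change constProj X (a • v) • g.hom m = g.hom (constProj X (a • v) • m)
      exact ((g.hom.restrictScalars k).map_smul _ m).symm

/-- The bimodule map `k ⊗ k C ⟶ k C`. -/
def diagonalConstHom : DiagonalBimodule k π (constModule k (SingleObj G))
    →ₗ[CategoryAlgebra k C ⊗[k] (CategoryAlgebra k C)ᵐᵒᵖ]
      envelopingModule k (CategoryAlgebra k C) :=
  diagonalBimoduleLift (N := envelopingModule k (CategoryAlgebra k C))
    (show _ →+ CategoryAlgebra k C from (TensorProduct.lift (LinearMap.mk₂ k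
      (fun (m : constModule k (SingleObj G)) (a : CategoryAlgebra k C) =>
        constProj (SingleObj.star G) m • a)
      (fun m m' a => by rw [map_add, add_smul])
      (fun r m a => by rw [constProj_smul, mul_smul])
      (fun m a a' => smul_add _ a a')
      (fun r m a => smul_comm _ r a))).toAddMonoidHom)
    (fun X Y f m a => by
      rw [enveloping_smul]
      change constProj (SingleObj.star G) (of k (π.map f) • m) • (of k f * a) =
        of k f * (constProj (SingleObj.star G) m • a) * 1
      rw [constProj_of_smul, mul_one, Algebra.mul_smul_comm]
      rfl)
    (fun b m a => by
      rw [enveloping_smul]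
      change constProj (SingleObj.star G) m • (a * b.unop) =
        1 * (constProj (SingleObj.star G) m • a) * b.unop
      rw [one_mul, Algebra.smul_mul_assoc])

theorem diagonalConstHom_bijective : Function.Bijective (diagonalConstHom (k := k) π) := by
  let u : constModule k (SingleObj G) := fun _ => (1 : k)
  refine Function.bijective_iff_has_inverse.2 ⟨fun a : CategoryAlgebra k C =>
    u ⊗ₜ[k] a, fun t => ?_, fun (a : CategoryAlgebra k C) => one_smul k a⟩
  change constModule k (SingleObj G) ⊗[k] CategoryAlgebra k C at t
  change u ⊗ₜ[k] (show CategoryAlgebra k C from diagonalConstHom π t) = t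
  induction t using TensorProduct.induction_on with
  | zero => exact (congrArg (fun b : CategoryAlgebra k C => u ⊗ₜ[k] b)
      (map_zero (diagonalConstHom π))).trans (TensorProduct.tmul_zero _ _)
  | add s t hs ht =>
    refine (congrArg (fun b : CategoryAlgebra k C => u ⊗ₜ[k] b)
      (map_add (diagonalConstHom π) s t)).trans ?_
    exact (TensorProduct.tmul_add _ _ _).trans (congrArg₂ (· + ·) hs ht)
  | tmul m a =>
    change u ⊗ₜ[k] (constProj (SingleObj.star G) m • a) = m ⊗ₜ[k] a
    rw [← TensorProduct.smul_tmul]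
    congr 1
    refine constModule_ext fun X => ?_
    rw [constProj_smul]
    exact mul_one _

/-- The bimodule `k ⊗ k C` with diagonal action is the regular bimodule. -/
def diagonalConstIso : (diagonalFunctor k π).obj (constModule k (SingleObj G)) ≅
    envelopingModule k (CategoryAlgebra k C) :=
  LinearEquiv.toModuleIso (LinearEquiv.ofBijective (diagonalConstHom π)
    (diagonalConstHom_bijective π))

/-- The identification of the constant module with the restriction of the constant module is the
identity on components. -/
theorem constProj_resComponent_resConstIso (v : constModule k C) (X : C) :
    constProj (π.obj X) (resComponent π X ((resConstIso k π).hom.hom v)) = constProj X v := by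
  let F := (Functor.const (SingleObj G)).obj (ModuleCat.of k k)
  let x : k := constProj X v
  exact LinearMap.congr_fun (congrArg ModuleCat.Hom.hom
    ((toFunctorToModuleIso k F).hom_inv_id_app (π.obj X))) (show F.obj (π.obj X) from x)

/-- On the trivial module the map `diagonalToHom` is the action of the regular bimodule on the
constant module, up to the identifications of both sides. -/
theorem diagonalConstIso_hom_comp :
    (diagonalConstIso π).hom ≫ actionBimoduleHom k (constModule k C) ≫
      (homFunctor k (constModule k C)).map (resConstIso k π).hom = diagonalToHom π _ := by
  refine diagonalFunctor_hom_ext π fun m a => LinearMap.ext fun v => res_ext π fun X =>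
    constModule_ext fun Z => ?_
  obtain rfl : π.obj X = Z := Subsingleton.elim (α := Unit) _ _
  refine (constProj_resComponent_resConstIso π
    ((constProj (SingleObj.star G) m • a : CategoryAlgebra k C) • v) X).trans ?_
  change _ = constProj (π.obj X) (constProj X (a • v) • m)
  rw [smul_assoc, constProj_smul, constProj_smul, mul_comm]
  rfl

/-- If a Hochschild cohomology group of `k C` vanishes, so does the restriction map along `π` from
the cohomology of the group in this degree: by naturality of `diagonalToHom`, the image of the
restriction of `e` under the injective comparison map factors through the class of `e` in
Hochschild cohomology given by `diagonalFunctor`. -/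
theorem cohomologyRes_eq_zero {n : ℕ}
    (h : Subsingleton (HochschildCohomology k (CategoryAlgebra k C) n))
    (e : Cohomology k (SingleObj G) n) : cohomologyRes k π n e = 0 := by
  have h1 : e.mapExactFunctor (diagonalFunctor k π) = 0 := by
    have h0 : ((Abelian.Ext.mk₀ (diagonalConstIso (k := k) π).inv).comp
      (e.mapExactFunctor (diagonalFunctor k π)) (zero_add n)).comp
        (Abelian.Ext.mk₀ (diagonalConstIso (k := k) π).hom) (add_zero n) =
        (0 : HochschildCohomology k (CategoryAlgebra k C) n) := Subsingleton.elim _ _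
    have h2 := congrArg (fun y => ((Abelian.Ext.mk₀ (diagonalConstIso (k := k) π).hom).comp y
      (zero_add n)).comp (Abelian.Ext.mk₀ (diagonalConstIso (k := k) π).inv) (add_zero n)) h0
    simpa using h2
  have h2 := mapExactFunctor_comp_mk₀_app (diagonalToHomNatTrans k π) e
  rw [h1, Abelian.Ext.zero_comp, ← mapExactFunctor_mapExactFunctor] at h2
  have h3 : (Abelian.Ext.mk₀ (diagonalToHom π (constModule k (SingleObj G)))).comp
      ((e.mapExactFunctor (resFunctor k C π)).mapExactFunctor
        (homFunctor k (constModule k C))) (zero_add n) = 0 := h2.symm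
  rw [← diagonalConstIso_hom_comp, ← Abelian.Ext.mk₀_comp_mk₀_assoc,
    ← Abelian.Ext.mk₀_comp_mk₀_assoc] at h3
  have h4 : (Abelian.Ext.mk₀ (actionBimoduleHom k (constModule k C))).comp
      (((Abelian.Ext.mk₀ (resConstIso k π).hom).comp (e.mapExactFunctor (resFunctor k C π))
        (zero_add n)).mapExactFunctor (homFunctor k (constModule k C))) (zero_add n) = 0 := by
    rw [Abelian.Ext.mapExactFunctor_comp, Abelian.Ext.mapExactFunctor_mk₀]
    have h5 := congrArg (fun y =>
      (Abelian.Ext.mk₀ (diagonalConstIso (k := k) π).inv).comp y (zero_add n)) h3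
    simpa using h5
  rw [cohomologyRes, eq_zero_of_actionBimoduleHom_comp_eq_zero _ h4, Abelian.Ext.zero_comp]

end CategoryAlgebra

theorem theorem1p3 {k : Type u} [Field k] [IsAlgClosed k] (p : ℕ) [Fact p.Prime] [CharP k p]
    {C : Type} [SmallCategory C] [FinCategory C]
    (hC : IsFrobeniusAlgebra k (CategoryAlgebra k C))
    {G : Type} [Group G] [Finite G] (hG : p ∣ Nat.card G)
    (π : C ⥤ SingleObj G)
    (hπ : ∀ n : ℕ, Function.Injective (CategoryAlgebra.cohomologyRes k π n)) :
    HappelProperty k (CategoryAlgebra k C) ∧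
      hchDim k (CategoryAlgebra k C) = ⊤ ∧ globalDim (CategoryAlgebra k C) = ⊤ := by
  have hres (n : ℕ) : CategoryAlgebra.cohomologyRes k π n 0 = 0 := by
    rw [CategoryAlgebra.cohomologyRes, Abelian.Ext.mapExactFunctor_zero, Abelian.Ext.comp_zero,
      Abelian.Ext.zero_comp]
  have hne (d : ℕ) : ∃ n, d ≤ n ∧ ∃ e, CategoryAlgebra.cohomologyRes k π n e ≠ 0 := by
    obtain ⟨n, hn, _⟩ := CategoryAlgebra.exists_nontrivial_cohomology (k := k) p hG d
    obtain ⟨e, he⟩ := exists_ne (0 : CategoryAlgebra.Cohomology k (SingleObj G) n)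
    exact ⟨n, hn, e, fun h => he (hπ n (h.trans (hres n).symm))⟩
  have hhch : hchDim k (CategoryAlgebra k C) = ⊤ := by
    refine (WithTop.eq_top_iff_forall_ge (α := ℕ)).2 fun d => ?_
    obtain ⟨n, hn, e, he⟩ := hne d
    refine le_trans (Nat.cast_le.2 hn) (le_sSup ⟨n, rfl, ?_⟩)
    rw [← not_subsingleton_iff_nontrivial]
    exact fun h => he (CategoryAlgebra.cohomologyRes_eq_zero π h e)
  refine ⟨fun h => absurd hhch h.ne, hhch, ?_⟩
  have hpd : projectiveDimension (CategoryAlgebra.constModule k C) = ⊤ := by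
    by_contra h
    obtain ⟨d, hd⟩ := (projectiveDimension_ne_top_iff _).1 h
    obtain ⟨n, hn, e, he⟩ := hne (d + 1)
    exact he (@Subsingleton.elim _ (HasProjectiveDimensionLT.subsingleton _ (d + 1) n hn _) _ _)
  rw [globalDim, eq_top_iff, ← hpd]
  exact le_iSup (fun M : ModuleCat.{u} (CategoryAlgebra k C) => projectiveDimension M) _

end
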